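/- Let $d \ge 2$ be a fixed integer. All algorithms run on a pointer machine: the memory consists of records with a constant number of fields, each holding a pointer, a word, a real coordinate or a colour; pointers can be followed and tested for equality, coordinates and colours can be copied and compared, and words (integers of $O(\log n)$ bits) can be added, subtracted and compared; each of these operations, and the allocation of a record, takes one step. The size of a data structure is the number of its records. Let $P$ be a family of $n$ points in $\mathbb{R}^d$ (repetitions are allowed), each of which has a colour from $\{1,\dots,\varphi\}$, given as a linked list, and let $s$ be an integer parameter with $2 \le s \le n$. Given a box $Q = [a_1,b_1]\times\cdots\times[a_d,b_d]$, a frequency reporting query asks for all pairs $(c,f)$ where $c$ is a colour and $f>0$ is the number of points of colour $c$ in $Q$, each pair being reported once, in any order; $k$ denotes the number of these pairs. Then there are a construction algorithm and a query algorithm, depending only on $d$, such that the following holds. In $O\bigl(n \log^{d+1} n\,(s \log_s n)^{d-1}\bigr)$ time one can build a data structure of size $O\bigl(n \log^{d} n\,(s \log_s n)^{d-1}\bigr)$ that answers any sequence of frequency reporting queries with arbitrary axis-aligned boxes, each in $O\bigl(\log n\,\log_s^{d-2} n + k \log_s^{d-1} n\bigr)$ time, where the implied constants depend only on $d$. In particular,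 for every $\varepsilon>0$ and all $n \ge 2$, the parameter $s = \min\{n, \lceil n^{\varepsilon/d}\rceil\}$ gives construction time and size $O(n^{1+\varepsilon})$ and query time $O(\log n + k)$, where the implied constants depend only on $d$ and $\varepsilon$. -/

import Mathlib

/- A pointer machine. The memory consists of records; a record has a constant number of fields (field
names are literals in the program text), each holding one value. Pointers support no arithmetic, real
coordinates and colours can only be copied and compared, and integers are words of bounded size that can
be added, subtracted and compared. -/
namespace PointerMachine

/-- The contents of a register or of a field of a record. -/
inductive Val : Type
  | nil : Val
  | ptr (a : ℕ) : Val
  | int (z : ℤ) : Val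
  | real (x : ℝ) : Val
  | col (c : ℕ) : Val

/-- The order test; it fails on pointers, on `nil` and on values of different kinds. -/
def Val.le : Val → Val → Prop
  | .int a, .int b => a ≤ b
  | .real a, .real b => a ≤ b
  | .col a, .col b => a ≤ b
  | _, _ => False

/-- The word with value `z`, or `nil` if `z` overflows the word bound `W`. -/
def word (W : ℕ) (z : ℤ) : Val := if |z| ≤ (W : ℤ) then .int z else .nil

def Val.plus (W : ℕ) : Val → Val → Val
  | .int a, .int b => word W (a + b)
  | _, _ => .nil

def Val.minus (W : ℕ) : Val → Val → Val
  | .int a, .int b => word W (a - b)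
  | _, _ => .nil

/-- The memory: records `0, …, next - 1` have been allocated, and `cell a f` is field `f` of record `a`. -/
structure Heap : Type where
  next : ℕ
  cell : ℕ → ℕ → Val

structure Config : Type where
  reg : ℕ → Val
  heap : Heap
  out : List (Val × Val)

def Config.set (σ : Config) (x : ℕ) (v : Val) : Config :=
  { σ with reg := Function.update σ.reg x v }

/-- Basic instructions. Registers `x y z` and fields `f` are literals of the program. -/
inductive Instr : Type
  | lit (x : ℕ) (k : ℤ) : Instr
  | copy (x y : ℕ) : Instr
  | plus (x y z : ℕ) : Instr
  | minus (x y z : ℕ) : Instr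
  | new (x : ℕ) : Instr
  | load (x y f : ℕ) : Instr
  | store (x f y : ℕ) : Instr
  | emit (x y : ℕ) : Instr

def Instr.exec (W : ℕ) : Instr → Config → Config
  | .lit x k, σ => σ.set x (.int k)
  | .copy x y, σ => σ.set x (σ.reg y)
  | .plus x y z, σ => σ.set x ((σ.reg y).plus W (σ.reg z))
  | .minus x y z, σ => σ.set x ((σ.reg y).minus W (σ.reg z))
  | .new x, σ =>
      { σ with
        reg := Function.update σ.reg x (.ptr σ.heap.next)
        heap :=
          { next := σ.heap.next + 1
            cell := Function.update σ.heap.cell σ.heap.next (fun _ => .nil) } }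
  | .load x y f, σ =>
      match σ.reg y with
      | .ptr a => σ.set x (σ.heap.cell a f)
      | _ => σ.set x .nil
  | .store x f y, σ =>
      match σ.reg x with
      | .ptr a =>
          { σ with
            heap :=
              { σ.heap with
                cell := Function.update σ.heap.cell a
                  (Function.update (σ.heap.cell a) f (σ.reg y)) } }
      | _ => σ
  | .emit x y, σ => { σ with out := (σ.reg x, σ.reg y) :: σ.out }

/-- Tests that compare the contents of two registers. -/
inductive Test : Type
  | eq (x y : ℕ) : Test
  | le (x y : ℕ) : Test

def Test.Holds : Test → Config → Prop
  | .eq x y, σ => σ.reg x = σ.reg y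
  | .le x y, σ => (σ.reg x).le (σ.reg y)

/-- Programs. -/
inductive Cmd : Type
  | skip : Cmd
  | instr (i : Instr) : Cmd
  | seq (p q : Cmd) : Cmd
  | ite (b : Test) (p q : Cmd) : Cmd
  | loop (b : Test) (p : Cmd) : Cmd

/-- `Exec W p σ t τ`: started in `σ`, with word bound `W`, the program `p` halts in `τ` after `t` steps.
Every basic instruction and every evaluation of a test takes one step; `loop b p` repeats `p` while
`b` holds. -/
inductive Exec (W : ℕ) : Cmd → Config → ℕ → Config → Prop
  | skip (σ : Config) : Exec W .skip σ 1 σ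
  | instr (i : Instr) (σ : Config) : Exec W (.instr i) σ 1 (i.exec W σ)
  | seq {p q : Cmd} {σ τ υ : Config} {t u : ℕ} :
      Exec W p σ t τ → Exec W q τ u υ → Exec W (.seq p q) σ (t + u) υ
  | iteTrue {b : Test} {p q : Cmd} {σ τ : Config} {t : ℕ} :
      b.Holds σ → Exec W p σ t τ → Exec W (.ite b p q) σ (1 + t) τ
  | iteFalse {b : Test} {p q : Cmd} {σ τ : Config} {t : ℕ} :
      ¬ b.Holds σ → Exec W q σ t τ → Exec W (.ite b p q) σ (1 + t) τ
  | loopDone {b : Test} {p : Cmd} {σ : Config} :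
      ¬ b.Holds σ → Exec W (.loop b p) σ 1 σ
  | loopStep {b : Test} {p : Cmd} {σ τ υ : Config} {t u : ℕ} :
      b.Holds σ → Exec W p σ t τ → Exec W (.loop b p) τ u υ →
        Exec W (.loop b p) σ (1 + t + u) υ

/-- The records that can be reached from the value `v` by following pointers. -/
inductive Reachable (h : Heap) (v : Val) : ℕ → Prop
  | root {a : ℕ} : v = .ptr a → Reachable h v a
  | step {a b f : ℕ} : Reachable h v a → h.cell a f = .ptr b → Reachable h v b

/-- The data structure with entry pointer `v` consists of at most `B` records. -/
def SizeAtMost (h : Heap) (v : Val) (B : ℝ) : Prop :=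
  ∃ A : Finset ℕ, (∀ a, Reachable h v a → a ∈ A) ∧ (A.card : ℝ) ≤ B

end PointerMachine

namespace ColorFrequency

open PointerMachine

/-- The number of points of colour `c` in the region `Q`. -/
noncomputable def freq {n d φ : ℕ} (P : Fin n → Fin d → ℝ) (color : Fin n → Fin φ)
    (Q : Set (Fin d → ℝ)) (c : Fin φ) : ℕ :=
  Set.ncard {i : Fin n | P i ∈ Q ∧ color i = c}

/-- The number of colours that occur in the region `Q`. -/
noncomputable def numColors {n d φ : ℕ} (P : Fin n → Fin d → ℝ) (color : Fin n → Fin φ)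
    (Q : Set (Fin d → ℝ)) : ℕ :=
  Set.ncard {c : Fin φ | 0 < freq P color Q c}

/-- The output consists of the pairs `(c, freq c)` for the colours `c` that occur in `Q`, each pair being
reported once, in any order. -/
def Reports {n d φ : ℕ} (P : Fin n → Fin d → ℝ) (color : Fin n → Fin φ)
    (Q : Set (Fin d → ℝ)) (out : List (Val × Val)) : Prop :=
  ∃ L : List (Fin φ × ℕ), L.Nodup ∧
    (∀ c f, (c, f) ∈ L ↔ f = freq P color Q c ∧ 0 < f) ∧
    out = L.map (fun p => (Val.col p.1, Val.int p.2))

/-- The start of the construction: the coloured points form a linked list in an otherwise empty memory,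
fields `0, …, d - 1` being the coordinates, field `d` the colour and field `d + 1` the link. Register `0`
points to the first record, register `1` holds the parameter `s`. -/
noncomputable def buildStart {n d φ : ℕ} (s : ℕ) (P : Fin n → Fin d → ℝ) (color : Fin n → Fin φ) :
    Config where
  reg r := if r = 0 then (if 0 < n then .ptr 0 else .nil) else if r = 1 then .int s else .nil
  heap :=
    { next := n
      cell := fun a f =>
        if ha : a < n then
          if hf : f < d then .real (P ⟨a, ha⟩ ⟨f, hf⟩)
          else if f = d then .col (color ⟨a, ha⟩)
          else if f = d + 1 ∧ a + 1 < n then .ptr (a + 1)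
          else .nil
        else .nil }
  out := []

/-- The start of a query with the box `[a, b]`: register `0` holds the entry pointer `v` of the data
structure, registers `1, …, d` hold `a` and registers `d + 1, …, 2 d` hold `b`. -/
noncomputable def queryStart {d : ℕ} (h : Heap) (v : Val) (a b : Fin d → ℝ) : Config where
  reg r :=
    if r = 0 then v
    else if h₁ : r - 1 < d then .real (a ⟨r - 1, h₁⟩)
    else if h₂ : r - 1 - d < d then .real (b ⟨r - 1 - d, h₂⟩)
    else .nil
  heap := h
  out := []

/-- The memories that can arise from `h₀` by answering finitely many queries one after the other. -/
inductive AfterQueries (W d : ℕ) (query : Cmd) (v : Val) (h₀ : Heap) : Heap → Prop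
  | init : AfterQueries W d query v h₀ h₀
  | step {h : Heap} {a b : Fin d → ℝ} {t : ℕ} {σ : Config} :
      AfterQueries W d query v h₀ h → Exec W query (queryStart h v a b) t σ →
        AfterQueries W d query v h₀ σ.heap

/-- On the coloured points `P` and the parameter `s`, with word bound `W`, the program `build` constructs
within `buildTime` steps a data structure with which `query` answers every sequence of frequency reporting
queries with axis-aligned boxes: it always has at most `size` records, and a query whose box contains `k`
colours takes at most `queryTime k` steps. -/
def Solves {n d φ : ℕ} (W : ℕ) (build query : Cmd) (s : ℕ) (P : Fin n → Fin d → ℝ)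
    (color : Fin n → Fin φ) (buildTime size : ℝ) (queryTime : ℝ → ℝ) : Prop :=
  ∃ (t : ℕ) (σ : Config),
    Exec W build (buildStart s P color) t σ ∧ (t : ℝ) ≤ buildTime ∧
    ∀ h : Heap, AfterQueries W d query (σ.reg 0) σ.heap h →
      SizeAtMost h (σ.reg 0) size ∧
      ∀ a b : Fin d → ℝ, ∃ (u : ℕ) (τ : Config),
        Exec W query (queryStart h (σ.reg 0) a b) u τ ∧
        Reports P color (Set.Icc a b) τ.out ∧
        (u : ℝ) ≤ queryTime (numColors P color (Set.Icc a b))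

end ColorFrequency

/-! A first-order functional language with a cost semantics, over immutable trees whose leaves are atoms
and pointers to the input records. The only mutable data are one scratch field of the input records and
the output. -/

/-! Two-sided conditions are traded for one-sided ones, and these are answered by a sweep that
stores all versions of a persistent structure.

Coordinates are replaced by ranks. For each coordinate a range tree splits the ranks at values
`mid`. An interval descends until a splitting value falls strictly inside it; there it becomes an
upper bound on the distance to `mid` in each of the two halves (`sel_cross`, `walks_node`). After
all `d` coordinates at most `2 ^ d` dominance queries with `d` keys remain, and each point has been
copied into `O(log^d n)` dominance structures (`split_spec`, `struct_spec`).

For dominance, the points are inserted in the order of the first key into a structure for the other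
`d - 1` keys. Trees are immutable, so every insertion leaves the older versions intact, and the
first key of a query merely selects a version (`versions_spec`, `dom_spec`). The structure treats
the remaining keys one by one. The bits of a key are cut into blocks of about `log_2 s` bits, which
gives a trie of degree at most `s` and depth `O(log_s n)`. Each child carries a structure in the
later keys for the points of its left siblings. A query asks one of these per level (`askIn_spec`),
while an insertion may update `s` of them per level (`ins_spec`). This is the trade-off between
`log_s^(d-1) n` in the query and `(s log_s n)^(d-1)` in the construction.

When no key is left there is a bag: a list of counts of colour representatives whose length is at
most twice its number of colours. New points are put in front, and equal colours are merged once the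
new entries are as many as the merged ones, at constant amortised cost (`bag_spec`). A query
therefore gathers `O(k log_s^(d-1) n)` entries for `k` colours. They are added up in scratch fields
of the representatives, which are cleared afterwards (`aggregate_spec`).

The algorithm is written in a small functional language with a cost semantics and compiled to the
machine. The simulation `sim` shows that machine time exceeds the cost by a constant factor at most.
A query leaves the records of the structure as they were, so it can be repeated, and the number of
records is at most `n` plus the construction time (`exists_solves`). What remains is the comparison
of the cost recursions with powers of `log n` and `log_s n` (`exists_solves_real`,
`exists_solves_rpow`). -/

namespace FunLang

open PointerMachine

/-- Data of the functional language; `pt a` is a pointer to the input record `a`. -/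
inductive T : Type
  | nil : T
  | int (z : ℤ) : T
  | real (x : ℝ) : T
  | col (c : ℕ) : T
  | pt (a : ℕ) : T
  | node (x y z : T) : T

def T.le : T → T → Prop
  | .int a, .int b => a ≤ b
  | .real a, .real b => a ≤ b
  | .col a, .col b => a ≤ b
  | _, _ => False

def T.fld : T → ℕ → T
  | .node x _ _, 0 => x
  | .node _ y _, 1 => y
  | .node _ _ z, 2 => z
  | _, _ => .nil

def T.word (W : ℕ) (z : ℤ) : T := if |z| ≤ (W : ℤ) then .int z else .nil

def T.plus (W : ℕ) : T → T → T
  | .int a, .int b => T.word W (a + b)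
  | _, _ => .nil

def T.minus (W : ℕ) : T → T → T
  | .int a, .int b => T.word W (a - b)
  | _, _ => .nil

/-- The input: the word bound, the number of input records, their contents, and the scratch field. -/
structure Inp : Type where
  W : ℕ
  n : ℕ
  sc : ℕ
  cell : ℕ → ℕ → T

/-- The mutable state: the scratch fields and the output. -/
structure S : Type where
  mem : ℕ → T
  out : List (ℕ × ℤ)

/-- Field `f` of the input record `a`. -/
def Inp.field (I : Inp) (μ : ℕ → T) (a f : ℕ) : T := if f = I.sc then μ a else I.cell a f

def Inp.look (I : Inp) (μ : ℕ → T) : T → ℕ → T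
  | .pt a, f => I.field μ a f
  | t, f => t.fld f

inductive Ex : Type
  | var (i : ℕ) : Ex
  | nil : Ex
  | lit (z : ℤ) : Ex
  | get (f : ℕ) (e : Ex) : Ex
  | add (e₁ e₂ : Ex) : Ex
  | sub (e₁ e₂ : Ex) : Ex
  | mk (e₁ e₂ e₃ : Ex) : Ex

inductive Cond : Type
  | isNil (e : Ex) : Cond
  | le (e₁ e₂ : Ex) : Cond

/-- Function bodies. `call` and `bind` append their result to the environment. -/
inductive Code : Type
  | ret (e : Ex) : Code
  | ite (b : Cond) (p q : Code) : Code
  | bind (e : Ex) (k : Code) : Code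
  | call (f : ℕ) (args : List Ex) (k : Code) : Code
  | setScratch (e₁ e₂ : Ex) (k : Code) : Code
  | emit (e₁ e₂ : Ex) (k : Code) : Code

def Ex.eval (I : Inp) (env : List T) (μ : ℕ → T) : Ex → T
  | .var i => env.getD i .nil
  | .nil => .nil
  | .lit z => .int z
  | .get f e => I.look μ (e.eval I env μ) f
  | .add a b => (a.eval I env μ).plus I.W (b.eval I env μ)
  | .sub a b => (a.eval I env μ).minus I.W (b.eval I env μ)
  | .mk a b c => .node (a.eval I env μ) (b.eval I env μ) (c.eval I env μ)

def Cond.holds (I : Inp) (env : List T) (μ : ℕ → T) : Cond → Prop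
  | .isNil e => e.eval I env μ = .nil
  | .le a b => (a.eval I env μ).le (b.eval I env μ)

/-- A program: the number of functions, their arities and their bodies. -/
structure Prog : Type where
  num : ℕ
  ar : ℕ → ℕ
  body : ℕ → Code

/-- `Run I π c env s r s' k`: in the environment `env` and the state `s`, the code `c` returns `r`, leaves
the state `s'` and costs `k`. -/
inductive Run (I : Inp) (π : Prog) : Code → List T → S → T → S → ℕ → Prop
  | ret (e : Ex) (env : List T) (s : S) : Run I π (.ret e) env s (e.eval I env s.mem) s 1
  | iteTrue {b : Cond} {p q : Code} {env : List T} {s s' : S} {r : T} {k : ℕ} :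
      b.holds I env s.mem → Run I π p env s r s' k → Run I π (.ite b p q) env s r s' (k + 1)
  | iteFalse {b : Cond} {p q : Code} {env : List T} {s s' : S} {r : T} {k : ℕ} :
      ¬ b.holds I env s.mem → Run I π q env s r s' k → Run I π (.ite b p q) env s r s' (k + 1)
  | bind {e : Ex} {c : Code} {env : List T} {s s' : S} {r : T} {k : ℕ} :
      Run I π c (env ++ [e.eval I env s.mem]) s r s' k → Run I π (.bind e c) env s r s' (k + 1)
  | call {f : ℕ} {args : List Ex} {c : Code} {env : List T} {s s' s'' : S} {r r' : T} {k k' : ℕ} :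
      Run I π (π.body f) (args.map (Ex.eval I env s.mem)) s r s' k →
        Run I π c (env ++ [r]) s' r' s'' k' →
        Run I π (.call f args c) env s r' s'' (k + k' + 1)
  | setScratch {e₁ e₂ : Ex} {c : Code} {env : List T} {s s' : S} {r : T} {a k : ℕ} :
      e₁.eval I env s.mem = .pt a →
        Run I π c env { s with mem := Function.update s.mem a (e₂.eval I env s.mem) } r s' k →
        Run I π (.setScratch e₁ e₂ c) env s r s' (k + 1)
  | emit {e₁ e₂ : Ex} {c : Code} {env : List T} {s s' : S} {r : T} {a k : ℕ} {z : ℤ} :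
      e₁.eval I env s.mem = .col a → e₂.eval I env s.mem = .int z →
        Run I π c env { s with out := (a, z) :: s.out } r s' k →
        Run I π (.emit e₁ e₂ c) env s r s' (k + 1)

/-- The function `f` returns `r` on `args`, at a cost of at most `k`. -/
def Ev (I : Inp) (π : Prog) (f : ℕ) (args : List T) (s : S) (r : T) (s' : S) (k : ℕ) : Prop :=
  ∃ c ≤ k, Run I π (π.body f) args s r s' c

/-- Weakest preconditions of code. -/
def wp (I : Inp) (π : Prog) : Code → List T → S → (T → S → ℕ → Prop) → Prop
  | .ret e, env, s, Q => Q (e.eval I env s.mem) s 1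
  | .ite b p q, env, s, Q =>
      (b.holds I env s.mem → wp I π p env s fun r s' k => Q r s' (k + 1)) ∧
      (¬ b.holds I env s.mem → wp I π q env s fun r s' k => Q r s' (k + 1))
  | .bind e c, env, s, Q => wp I π c (env ++ [e.eval I env s.mem]) s fun r s' k => Q r s' (k + 1)
  | .call f args c, env, s, Q =>
      ∃ r s' k, Ev I π f (args.map (Ex.eval I env s.mem)) s r s' k ∧
        wp I π c (env ++ [r]) s' fun r' s'' k' => ∀ k₁ ≤ k, Q r' s'' (k₁ + k' + 1)
  | .setScratch e₁ e₂ c, env, s, Q =>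
      ∃ a, e₁.eval I env s.mem = .pt a ∧
        wp I π c env { s with mem := Function.update s.mem a (e₂.eval I env s.mem) }
          fun r s' k => Q r s' (k + 1)
  | .emit e₁ e₂ c, env, s, Q =>
      ∃ a z, e₁.eval I env s.mem = .col a ∧ e₂.eval I env s.mem = .int z ∧
        wp I π c env { s with out := (a, z) :: s.out } fun r s' k => Q r s' (k + 1)

/-- `Ev` only bounds the cost of a callee from above. The call clause of `wp` therefore demands the
postcondition at every cost `k₁ ≤ k`, and the actual cost is substituted here. -/
theorem run_of_wp (I : Inp) (π : Prog) (c : Code) :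
    ∀ (env : List T) (s : S) (Q : T → S → ℕ → Prop), wp I π c env s Q →
      ∃ r s' k, Run I π c env s r s' k ∧ Q r s' k := by
  induction c with
  | ret e => exact fun env s Q h => ⟨_, _, _, .ret e env s, h⟩
  | ite b p q ihp ihq =>
    intro env s Q h
    by_cases hb : b.holds I env s.mem
    · obtain ⟨r, s', k, h1, h2⟩ := ihp _ _ _ (h.1 hb)
      exact ⟨_, _, _, .iteTrue hb h1, h2⟩
    · obtain ⟨r, s', k, h1, h2⟩ := ihq _ _ _ (h.2 hb)
      exact ⟨_, _, _, .iteFalse hb h1, h2⟩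
  | bind e c ih =>
    intro env s Q h
    obtain ⟨r, s', k, h1, h2⟩ := ih _ _ _ h
    exact ⟨_, _, _, .bind h1, h2⟩
  | call f args c ih =>
    rintro env s Q ⟨r, s', k, ⟨k₁, hk, h0⟩, h⟩
    obtain ⟨r', s'', k', h1, h2⟩ := ih _ _ _ h
    exact ⟨_, _, _, .call h0 h1, h2 _ hk⟩
  | setScratch e₁ e₂ c ih =>
    rintro env s Q ⟨a, ha, h⟩
    obtain ⟨r, s', k, h1, h2⟩ := ih _ _ _ h
    exact ⟨_, _, _, .setScratch ha h1, h2⟩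
  | emit e₁ e₂ c ih =>
    rintro env s Q ⟨a, z, ha, hz, h⟩
    obtain ⟨r, s', k, h1, h2⟩ := ih _ _ _ h
    exact ⟨_, _, _, .emit ha hz h1, h2⟩

theorem ev_of_wp {I : Inp} {π : Prog} {f : ℕ} {args : List T} {s : S} {r : T} {s' : S} {k : ℕ}
    (h : wp I π (π.body f) args s fun r₁ s₁ k₁ => r₁ = r ∧ s₁ = s' ∧ k₁ ≤ k) :
    Ev I π f args s r s' k := by
  obtain ⟨r₁, s₁, k₁, h1, rfl, rfl, h2⟩ := run_of_wp I π _ _ _ _ h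
  exact ⟨k₁, h2, h1⟩

theorem Ev.mono {I : Inp} {π : Prog} {f : ℕ} {args : List T} {s : S} {r : T} {s' : S} {k k' : ℕ}
    (h : Ev I π f args s r s' k) (hk : k ≤ k') : Ev I π f args s r s' k' := by
  obtain ⟨c, hc, h⟩ := h
  exact ⟨c, hc.trans hk, h⟩

/-- The function `f` returns `r` on `args` at a cost of at most `k` when the scratch fields are empty, and
leaves the state unchanged. -/
def Pu (I : Inp) (π : Prog) (f : ℕ) (args : List T) (r : T) (k : ℕ) : Prop :=
  ∀ o, Ev I π f args ⟨fun _ => .nil, o⟩ r ⟨fun _ => .nil, o⟩ k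

theorem Pu.mono {I : Inp} {π : Prog} {f : ℕ} {args : List T} {r : T} {k k' : ℕ}
    (h : Pu I π f args r k) (hk : k ≤ k') : Pu I π f args r k' := fun o => (h o).mono hk

end FunLang

namespace FunLang

open PointerMachine

/-! ### Representation of trees in memory -/

def loadVal (h : Heap) : Val → ℕ → Val
  | .ptr a, f => h.cell a f
  | _, _ => .nil

/-- The value `v` represents the tree in a memory whose records below `n` are the input. -/
def Rep (n : ℕ) (h : Heap) : T → Val → Prop
  | .nil, v => v = .nil
  | .int z, v => v = .int z
  | .real x, v => v = .real x
  | .col c, v => v = .col c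
  | .pt a, v => v = .ptr a ∧ a < n
  | .node x y z, v => ∃ a, v = .ptr a ∧ n ≤ a ∧ a < h.next ∧ Rep n h x (h.cell a 0) ∧
      Rep n h y (h.cell a 1) ∧ Rep n h z (h.cell a 2) ∧ ∀ f, 3 ≤ f → h.cell a f = .nil

/-- The memory `h'` extends `h` up to scratch fields. -/
def Ext (I : Inp) (h h' : Heap) : Prop :=
  h.next ≤ h'.next ∧ ∀ a < h.next, ∀ f, (I.n ≤ a ∨ f ≠ I.sc) → h'.cell a f = h.cell a f

/-- The memory `h'` extends `h`. -/
def XExt (h h' : Heap) : Prop := h.next ≤ h'.next ∧ ∀ a < h.next, h'.cell a = h.cell a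

/-- The input records are intact and the scratch fields contain `μ`. -/
def Good (I : Inp) (h : Heap) (μ : ℕ → T) : Prop :=
  I.n ≤ h.next ∧ ∀ a < I.n, ∀ f, Rep I.n h (I.field μ a f) (h.cell a f)

def RegsRep (I : Inp) (σ : Config) (env : List T) : Prop :=
  ∀ i < env.length, Rep I.n σ.heap (env.getD i .nil) (σ.reg (i + 4))

theorem XExt.ext {I : Inp} {h h' : Heap} (hx : XExt h h') : Ext I h h' :=
  ⟨hx.1, fun a ha f _ => by rw [hx.2 a ha]⟩

theorem XExt.refl (h : Heap) : XExt h h := ⟨le_rfl, fun _ _ => rfl⟩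

theorem XExt.trans {h₁ h₂ h₃ : Heap} (h : XExt h₁ h₂) (h' : XExt h₂ h₃) : XExt h₁ h₃ :=
  ⟨h.1.trans h'.1, fun a ha => (h'.2 a (ha.trans_le h.1)).trans (h.2 a ha)⟩

theorem Ext.trans {I : Inp} {h₁ h₂ h₃ : Heap} (h : Ext I h₁ h₂) (h' : Ext I h₂ h₃) : Ext I h₁ h₃ :=
  ⟨h.1.trans h'.1, fun a ha f hf => (h'.2 a (ha.trans_le h.1) f hf).trans (h.2 a ha f hf)⟩

/-- The records of a tree lie above the input, where `Ext` preserves every field. A pointer into the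
input is represented by its address alone, so overwritten scratch fields do no harm. -/
theorem Rep.mono {I : Inp} {h h' : Heap} (hx : Ext I h h') (t : T) :
    ∀ v, Rep I.n h t v → Rep I.n h' t v := by
  induction t with
  | node x y z ihx ihy ihz =>
    rintro v ⟨a, rfl, hn, ha, h0, h1, h2, h3⟩
    have hc : ∀ f, h'.cell a f = h.cell a f := fun f => hx.2 a ha f (Or.inl hn)
    refine ⟨a, rfl, hn, ha.trans_le hx.1, ?_, ?_, ?_, fun f hf => by rw [hc, h3 f hf]⟩
    · rw [hc]; exact ihx _ h0
    · rw [hc]; exact ihy _ h1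
    · rw [hc]; exact ihz _ h2
  | _ => exact fun v hv => hv

theorem Good.mono {I : Inp} {h h' : Heap} {μ : ℕ → T} (hx : XExt h h') (hg : Good I h μ) :
    Good I h' μ :=
  ⟨hg.1.trans hx.1, fun a ha f => by
    rw [hx.2 a (ha.trans_le hg.1)]; exact (hg.2 a ha f).mono hx.ext⟩

theorem RegsRep.mono {I : Inp} {σ τ : Config} {env : List T} (hx : Ext I σ.heap τ.heap)
    (hr : ∀ r < env.length + 4, τ.reg r = σ.reg r) (h : RegsRep I σ env) : RegsRep I τ env :=
  fun i hi => by rw [hr _ (by omega)]; exact (h i hi).mono hx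

theorem Rep.word (n W : ℕ) (h : Heap) (z : ℤ) : Rep n h (T.word W z) (PointerMachine.word W z) := by
  unfold T.word PointerMachine.word
  split_ifs <;> simp [Rep]

theorem Rep.plus {n W : ℕ} {h : Heap} {s t : T} {v w : Val} (hs : Rep n h s v) (ht : Rep n h t w) :
    Rep n h (s.plus W t) (v.plus W w) := by
  cases s <;> cases t <;> simp only [Rep] at hs ht <;>
    (try obtain ⟨rfl, hs⟩ := hs) <;> (try obtain ⟨rfl, ht⟩ := ht) <;>
    (try obtain ⟨_, rfl, hs⟩ := hs) <;> (try obtain ⟨_, rfl, ht⟩ := ht) <;>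
    simp only [T.plus, Val.plus, Rep.word] <;> simp [Rep]

theorem Rep.minus {n W : ℕ} {h : Heap} {s t : T} {v w : Val} (hs : Rep n h s v) (ht : Rep n h t w) :
    Rep n h (s.minus W t) (v.minus W w) := by
  cases s <;> cases t <;> simp only [Rep] at hs ht <;>
    (try obtain ⟨rfl, hs⟩ := hs) <;> (try obtain ⟨rfl, ht⟩ := ht) <;>
    (try obtain ⟨_, rfl, hs⟩ := hs) <;> (try obtain ⟨_, rfl, ht⟩ := ht) <;>
    simp only [T.minus, Val.minus, Rep.word] <;> simp [Rep]

theorem Rep.le_iff {n : ℕ} {h : Heap} {s t : T} {v w : Val} (hs : Rep n h s v) (ht : Rep n h t w) :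
    v.le w ↔ s.le t := by
  cases s <;> cases t <;> simp only [Rep] at hs ht <;>
    (try obtain ⟨rfl, hs⟩ := hs) <;> (try obtain ⟨rfl, ht⟩ := ht) <;>
    (try obtain ⟨_, rfl, hs⟩ := hs) <;> (try obtain ⟨_, rfl, ht⟩ := ht) <;>
    simp only [T.le, Val.le]

theorem Rep.eq_nil_iff {n : ℕ} {h : Heap} {s : T} {v : Val} (hs : Rep n h s v) :
    v = .nil ↔ s = .nil := by
  cases s <;> simp only [Rep] at hs <;> (try obtain ⟨rfl, hs⟩ := hs) <;>
    (try obtain ⟨_, rfl, hs⟩ := hs) <;> simp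

theorem Rep.look {I : Inp} {h : Heap} {μ : ℕ → T} (hg : Good I h μ) {t : T} {v : Val}
    (ht : Rep I.n h t v) (f : ℕ) : Rep I.n h (I.look μ t f) (loadVal h v f) := by
  cases t with
  | pt a => obtain ⟨rfl, ha⟩ := ht; exact hg.2 a ha f
  | node x y z =>
    obtain ⟨a, rfl, hn, ha, h0, h1, h2, h3⟩ := ht
    match f with
    | 0 => exact h0
    | 1 => exact h1
    | 2 => exact h2
    | f + 3 => exact h3 _ (by omega)
  | _ => simp only [Rep] at ht; subst ht; cases f <;> rfl

/-! ### Straight-line code -/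

theorem exec_load (W x y f : ℕ) (σ : Config) :
    (Instr.load x y f).exec W σ = σ.set x (loadVal σ.heap (σ.reg y) f) := by
  unfold Instr.exec loadVal
  cases h : σ.reg y <;> simp only [h]

theorem set_heap (σ : Config) (x : ℕ) (v : Val) : (σ.set x v).heap = σ.heap := rfl

theorem set_reg_same (σ : Config) (x : ℕ) (v : Val) : (σ.set x v).reg x = v :=
  Function.update_self ..

theorem set_reg_ne (σ : Config) {x y : ℕ} (v : Val) (h : y ≠ x) : (σ.set x v).reg y = σ.reg y :=
  Function.update_of_ne h ..

def blk : List Instr → Cmd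
  | [] => .skip
  | i :: l => .seq (.instr i) (blk l)

def execs (W : ℕ) (l : List Instr) (σ : Config) : Config := l.foldl (fun σ i => i.exec W σ) σ

theorem exec_blk (W : ℕ) (l : List Instr) :
    ∀ σ, Exec W (blk l) σ (l.length + 1) (execs W l σ) := by
  induction l with
  | nil => exact fun σ => .skip σ
  | cons i l ih =>
    intro σ
    have := Exec.seq (.instr i σ) (ih (i.exec W σ))
    rwa [show 1 + (l.length + 1) = (i :: l).length + 1 by simp; omega] at this

def LoopFree : Cmd → Prop
  | .skip => True
  | .instr _ => True
  | .seq p q => LoopFree p ∧ LoopFree q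
  | .ite _ p q => LoopFree p ∧ LoopFree q
  | .loop _ _ => False

/-- A bound on the running time of a program without loops. -/
def csz : Cmd → ℕ
  | .skip => 1
  | .instr _ => 1
  | .seq p q => csz p + csz q
  | .ite _ p q => 1 + csz p + csz q
  | .loop _ _ => 0

/-- Since `csz` counts both branches, the bound depends on the program text only. Every compiled
block is loop-free and thus takes constant time; the only loop is the dispatcher. -/
theorem _root_.PointerMachine.Exec.le_csz {W : ℕ} {p : Cmd} {σ τ : Config} {t : ℕ} (h : Exec W p σ t τ) (hp : LoopFree p) :
    t ≤ csz p := by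
  induction h with
  | skip | instr => exact le_rfl
  | seq _ _ ih ih' => exact Nat.add_le_add (ih hp.1) (ih' hp.2)
  | iteTrue _ _ ih => have := ih hp.1; simp only [csz]; omega
  | iteFalse _ _ ih => have := ih hp.2; simp only [csz]; omega
  | loopDone => exact hp.elim
  | loopStep => exact hp.elim

theorem blk_loopFree (l : List Instr) : LoopFree (blk l) := by
  induction l with
  | nil => trivial
  | cons i l ih => exact ⟨trivial, ih⟩

/-! ### Expressions -/

def Ex.WF (m : ℕ) : Ex → Prop
  | .var i => i < m
  | .nil => True
  | .lit _ => True
  | .get _ e => e.WF m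
  | .add a b => a.WF m ∧ b.WF m
  | .sub a b => a.WF m ∧ b.WF m
  | .mk a b c => a.WF m ∧ b.WF m ∧ c.WF m

/-- The result arrives in register `t`, and the operands use the registers from `t` on like a stack.
Registers below `t`, among them all variables, survive. -/
def compE : Ex → ℕ → Cmd
  | .var i, t => blk [.copy t (i + 4)]
  -- A load through a register that holds no pointer yields `nil`.
  | .nil, t => blk [.lit t 0, .load t t 0]
  | .lit z, t => blk [.lit t z]
  | .get f e, t => .seq (compE e t) (blk [.load t t f])
  | .add a b, t => .seq (compE a t) (.seq (compE b (t + 1)) (blk [.plus t t (t + 1)]))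
  | .sub a b, t => .seq (compE a t) (.seq (compE b (t + 1)) (blk [.minus t t (t + 1)]))
  | .mk a b c, t => .seq (compE a t) (.seq (compE b (t + 1)) (.seq (compE c (t + 2))
      (blk [.new (t + 3), .store (t + 3) 0 t, .store (t + 3) 1 (t + 1), .store (t + 3) 2 (t + 2),
        .copy t (t + 3)])))

theorem compE_loopFree (e : Ex) : ∀ t, LoopFree (compE e t) := by
  induction e <;> intro t <;> simp_all [compE, LoopFree, blk_loopFree]

/-- What the evaluation of an expression does to the configuration. -/
def EvalPost (I : Inp) (t : ℕ) (r : T) (σ τ : Config) : Prop :=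
  XExt σ.heap τ.heap ∧ Rep I.n τ.heap r (τ.reg t) ∧ (∀ i < t, τ.reg i = σ.reg i) ∧ τ.out = σ.out

theorem EvalPost.set {I : Inp} {t : ℕ} {r : T} {v : Val} (σ : Config) (h : Rep I.n σ.heap r v) :
    EvalPost I t r σ (σ.set t v) :=
  ⟨XExt.refl _, by rwa [set_reg_same], fun i hi => set_reg_ne _ _ (by omega), rfl⟩

/-- Evaluation only allocates. The memory grows by `XExt`, scratch fields included, so operands
computed earlier remain represented. -/
theorem compE_spec (I : Inp) (μ : ℕ → T) (env : List T) (e : Ex) :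
    ∀ (t : ℕ) (σ : Config), e.WF env.length → env.length + 4 ≤ t → RegsRep I σ env →
      Good I σ.heap μ → ∃ k τ, Exec I.W (compE e t) σ k τ ∧ EvalPost I t (e.eval I env μ) σ τ := by
  induction e with
  | var i =>
    intro t σ hw ht hr hg
    exact ⟨_, _, exec_blk _ _ _, EvalPost.set _ (hr i hw)⟩
  | nil =>
    intro t σ hw ht hr hg
    refine ⟨_, _, exec_blk _ _ _, ?_⟩
    simp only [execs, List.foldl, exec_load]
    refine ⟨XExt.refl _, ?_, fun i hi => ?_, rfl⟩
    · rw [set_reg_same]; simp [Instr.exec, set_reg_same, loadVal, Ex.eval, Rep]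
    · rw [set_reg_ne _ _ (by omega)]; exact set_reg_ne _ _ (by omega)
  | lit z =>
    intro t σ hw ht hr hg
    exact ⟨_, _, exec_blk _ _ _, EvalPost.set _ (by simp [Rep, Ex.eval])⟩
  | get f e ih =>
    intro t σ hw ht hr hg
    obtain ⟨k, τ, h1, hx, hrep, hreg, hout⟩ := ih t σ hw ht hr hg
    refine ⟨_, _, .seq h1 (exec_blk _ _ _), ?_⟩
    simp only [execs, List.foldl, exec_load]
    refine ⟨hx, ?_, fun i hi => ?_, hout⟩
    · rw [set_reg_same]; exact Rep.look (hg.mono hx) hrep f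
    · rw [set_reg_ne _ _ (by omega), hreg i hi]
  | add a b iha ihb =>
    intro t σ hw ht hr hg
    obtain ⟨k, τ, h1, hx, hrep, hreg, hout⟩ := iha t σ hw.1 ht hr hg
    obtain ⟨k', τ', h1', hx', hrep', hreg', hout'⟩ := ihb (t + 1) τ hw.2 (by omega)
      (hr.mono hx.ext fun i hi => hreg i (by omega)) (hg.mono hx)
    refine ⟨_, _, .seq h1 (.seq h1' (exec_blk _ _ _)), ?_⟩
    simp only [execs, List.foldl, Instr.exec]
    refine ⟨hx.trans hx', ?_, fun i hi => ?_, hout'.trans hout⟩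
    · rw [set_reg_same]
      refine Rep.plus ?_ hrep'
      rw [hreg' t (by omega)]; exact hrep.mono hx'.ext
    · rw [set_reg_ne _ _ (by omega), hreg' i (by omega), hreg i hi]
  | sub a b iha ihb =>
    intro t σ hw ht hr hg
    obtain ⟨k, τ, h1, hx, hrep, hreg, hout⟩ := iha t σ hw.1 ht hr hg
    obtain ⟨k', τ', h1', hx', hrep', hreg', hout'⟩ := ihb (t + 1) τ hw.2 (by omega)
      (hr.mono hx.ext fun i hi => hreg i (by omega)) (hg.mono hx)
    refine ⟨_, _, .seq h1 (.seq h1' (exec_blk _ _ _)), ?_⟩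
    simp only [execs, List.foldl, Instr.exec]
    refine ⟨hx.trans hx', ?_, fun i hi => ?_, hout'.trans hout⟩
    · rw [set_reg_same]
      refine Rep.minus ?_ hrep'
      rw [hreg' t (by omega)]; exact hrep.mono hx'.ext
    · rw [set_reg_ne _ _ (by omega), hreg' i (by omega), hreg i hi]
  | mk a b c iha ihb ihc =>
    intro t σ hw ht hr hg
    obtain ⟨k, τ, h1, hx, hrep, hreg, hout⟩ := iha t σ hw.1 ht hr hg
    have hr₁ : RegsRep I τ env := hr.mono hx.ext fun i hi => hreg i (by omega)
    obtain ⟨k', τ', h1', hx', hrep', hreg', hout'⟩ := ihb (t + 1) τ hw.2.1 (by omega) hr₁ (hg.mono hx)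
    obtain ⟨k'', τ'', h1'', hx'', hrep'', hreg'', hout''⟩ := ihc (t + 2) τ' hw.2.2 (by omega)
      (hr₁.mono hx'.ext fun i hi => hreg' i (by omega)) ((hg.mono hx).mono hx')
    refine ⟨_, _, .seq h1 (.seq h1' (.seq h1'' (exec_blk _ _ _))), ?_⟩
    have hx₂ : XExt τ'.heap τ''.heap := hx''
    set υ := execs I.W _ τ'' with hυ
    have hreg₃ : ∀ i < t, υ.reg i = τ''.reg i := by
      intro i hi
      simp [hυ, execs, Instr.exec, Config.set, Function.update, show i ≠ t by omega,
        show i ≠ t + 3 by omega]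
    have hnext : υ.heap.next = τ''.heap.next + 1 := by
      simp [hυ, execs, Instr.exec, Config.set]
    have hcell : ∀ a < τ''.heap.next, υ.heap.cell a = τ''.heap.cell a := by
      intro a ha
      funext f
      simp [hυ, execs, Instr.exec, Config.set, Function.update, ha.ne]
    have hx₃ : XExt τ''.heap υ.heap := ⟨by omega, hcell⟩
    have hn : I.n ≤ τ''.heap.next := hg.1.trans ((hx.trans (hx'.trans hx'')).1)
    refine ⟨hx.trans (hx'.trans (hx''.trans hx₃)), ?_, fun i hi => ?_, ?_⟩
    · refine ⟨τ''.heap.next, ?_, hn, by omega, ?_, ?_, ?_, ?_⟩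
      · simp [hυ, execs, Instr.exec, Config.set]
      · have : υ.heap.cell τ''.heap.next 0 = τ''.reg t := by
          simp [hυ, execs, Instr.exec, Config.set, Function.update]
        rw [this, hreg'' t (by omega), hreg' t (by omega)]
        exact hrep.mono (hx'.trans (hx''.trans hx₃)).ext
      · have : υ.heap.cell τ''.heap.next 1 = τ''.reg (t + 1) := by
          simp [hυ, execs, Instr.exec, Config.set, Function.update]
        rw [this, hreg'' _ (by omega)]
        exact hrep'.mono (hx''.trans hx₃).ext
      · have : υ.heap.cell τ''.heap.next 2 = τ''.reg (t + 2) := by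
          simp [hυ, execs, Instr.exec, Config.set, Function.update]
        rw [this]
        exact hrep''.mono hx₃.ext
      · intro f hf
        simp [hυ, execs, Instr.exec, Config.set, Function.update, show f ≠ 0 by omega,
          show f ≠ 1 by omega, show f ≠ 2 by omega]
    · rw [hreg₃ i hi, hreg'' i (by omega), hreg' i (by omega), hreg i hi]
    · rw [← hout, ← hout', ← hout'']
      simp [hυ, execs, Instr.exec, Config.set]

def compArgs : List Ex → ℕ → Cmd
  | [], _ => .skip
  | e :: l, t => .seq (compE e t) (compArgs l (t + 1))

theorem compArgs_loopFree (l : List Ex) : ∀ t, LoopFree (compArgs l t) := by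
  induction l with
  | nil => exact fun _ => trivial
  | cons e l ih => exact fun t => ⟨compE_loopFree e t, ih _⟩

theorem compArgs_spec (I : Inp) (μ : ℕ → T) (env : List T) (l : List Ex) :
    ∀ (t : ℕ) (σ : Config), (∀ e ∈ l, e.WF env.length) → env.length + 4 ≤ t → RegsRep I σ env →
      Good I σ.heap μ → ∃ k τ, Exec I.W (compArgs l t) σ k τ ∧ XExt σ.heap τ.heap ∧
        (∀ i < l.length, Rep I.n τ.heap ((l.map (Ex.eval I env μ)).getD i .nil) (τ.reg (t + i))) ∧
        (∀ i < t, τ.reg i = σ.reg i) ∧ τ.out = σ.out := by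
  induction l with
  | nil => exact fun t σ _ _ _ _ => ⟨_, _, .skip σ, XExt.refl _, by simp, fun _ _ => rfl, rfl⟩
  | cons e l ih =>
    intro t σ hw ht hr hg
    obtain ⟨k, τ, h1, hx, hrep, hreg, hout⟩ := compE_spec I μ env e t σ (hw e (by simp)) ht hr hg
    obtain ⟨k', τ', h1', hx', hrep', hreg', hout'⟩ := ih (t + 1) τ
      (fun e' he' => hw e' (by simp [he'])) (by omega)
      (hr.mono hx.ext fun i hi => hreg i (by omega)) (hg.mono hx)
    refine ⟨_, _, .seq h1 h1', hx.trans hx', ?_, fun i hi => ?_, hout'.trans hout⟩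
    · rintro (_ | i) hi
      · rw [Nat.add_zero, hreg' t (by omega)]; exact hrep.mono hx'.ext
      · have := hrep' i (by simpa using hi)
        rwa [show t + 1 + i = t + (i + 1) by omega] at this
    · rw [hreg' i (by omega), hreg i hi]

/-! ### Saving, restoring and moving variables -/

def saveVars (a : ℕ) : ℕ → List Instr
  | 0 => []
  | m + 1 => saveVars a m ++ [.store a (m + 2) (m + 4)]

theorem saveVars_spec (W x a : ℕ) (σ : Config) (hx : σ.reg x = .ptr a) (m : ℕ) :
    (execs W (saveVars x m) σ).reg = σ.reg ∧ (execs W (saveVars x m) σ).out = σ.out ∧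
    (execs W (saveVars x m) σ).heap.next = σ.heap.next ∧
    (∀ b ≠ a, (execs W (saveVars x m) σ).heap.cell b = σ.heap.cell b) ∧
    (∀ f < 2, (execs W (saveVars x m) σ).heap.cell a f = σ.heap.cell a f) ∧
    ∀ i < m, (execs W (saveVars x m) σ).heap.cell a (i + 2) = σ.reg (i + 4) := by
  induction m with
  | zero => simp [saveVars, execs]
  | succ m ih =>
    have e : execs W (saveVars x (m + 1)) σ
        = (Instr.store x (m + 2) (m + 4)).exec W (execs W (saveVars x m) σ) := by
      simp [saveVars, execs]
    rw [e]
    obtain ⟨h1, h2, h3, h4, h5, h6⟩ := ih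
    simp only [Instr.exec, h1, hx]
    refine ⟨trivial, h2, h3, fun b hb => ?_, fun f hf => ?_, fun i hi => ?_⟩
    · rw [Function.update_of_ne hb, h4 b hb]
    · rw [Function.update_self, Function.update_of_ne (by omega), h5 f hf]
    · rw [Function.update_self]
      by_cases him : i = m
      · subst him; rw [Function.update_self]
      · rw [Function.update_of_ne (by omega), h6 i (by omega)]

def restoreVars : ℕ → List Instr
  | 0 => []
  | m + 1 => restoreVars m ++ [.load (m + 4) 1 (m + 2)]

theorem restoreVars_spec (W a : ℕ) (σ : Config) (hx : σ.reg 1 = .ptr a) (m : ℕ) :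
    (execs W (restoreVars m) σ).heap = σ.heap ∧ (execs W (restoreVars m) σ).out = σ.out ∧
    (∀ r < 4, (execs W (restoreVars m) σ).reg r = σ.reg r) ∧
    ∀ i < m, (execs W (restoreVars m) σ).reg (i + 4) = σ.heap.cell a (i + 2) := by
  induction m with
  | zero => simp [restoreVars, execs]
  | succ m ih =>
    have e : execs W (restoreVars (m + 1)) σ
        = (Instr.load (m + 4) 1 (m + 2)).exec W (execs W (restoreVars m) σ) := by
      simp [restoreVars, execs]
    obtain ⟨h1, h2, h3, h4⟩ := ih
    rw [e, exec_load, h1, h3 1 (by omega), hx]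
    refine ⟨h1, h2, fun r hr => ?_, fun i hi => ?_⟩
    · rw [set_reg_ne _ _ (by omega), h3 r hr]
    · by_cases him : i = m
      · subst him; rw [set_reg_same]; rfl
      · rw [set_reg_ne _ _ (by omega), h4 i (by omega)]

def moveArgs (t : ℕ) : ℕ → List Instr
  | 0 => []
  | p + 1 => moveArgs t p ++ [.copy (p + 4) (t + p)]

theorem moveArgs_spec (W t : ℕ) (ht : 4 ≤ t) (σ : Config) (p : ℕ) :
    (execs W (moveArgs t p) σ).heap = σ.heap ∧ (execs W (moveArgs t p) σ).out = σ.out ∧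
    (∀ r, (r < 4 ∨ p + 4 ≤ r) → (execs W (moveArgs t p) σ).reg r = σ.reg r) ∧
    ∀ i < p, (execs W (moveArgs t p) σ).reg (i + 4) = σ.reg (t + i) := by
  induction p with
  | zero => simp [moveArgs, execs]
  | succ p ih =>
    have e : execs W (moveArgs t (p + 1)) σ
        = (Instr.copy (p + 4) (t + p)).exec W (execs W (moveArgs t p) σ) := by
      simp [moveArgs, execs]
    obtain ⟨h1, h2, h3, h4⟩ := ih
    rw [e]
    simp only [Instr.exec]
    refine ⟨h1, h2, fun r hr => ?_, fun i hi => ?_⟩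
    · rw [set_reg_ne _ _ (by omega), h3 r (by omega)]
    · by_cases him : i = p
      · subst him; rw [set_reg_same, h3 _ (by omega)]
      · rw [set_reg_ne _ _ (by omega), h4 i (by omega)]

end FunLang

namespace FunLang

open PointerMachine

/-! ### The compiler

Register `0` holds the label of the current block, register `1` the stack, register `2` the result of the
last call, register `3` is used by the dispatcher, and variable `i` lives in register `i + 4`. A stack frame
holds the label of a continuation in field `0`, the rest of the stack in field `1` and the variables in the
fields from `2` on. -/

def Cond.WF (m : ℕ) : Cond → Prop
  | .isNil e => e.WF m
  | .le a b => a.WF m ∧ b.WF m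

def Code.WF (π : Prog) : ℕ → Code → Prop
  | m, .ret e => e.WF m
  | m, .ite b p q => b.WF m ∧ p.WF π m ∧ q.WF π m
  | m, .bind e k => e.WF m ∧ k.WF π (m + 1)
  | m, .call f args k => f < π.num ∧ args.length = π.ar f ∧ (∀ e ∈ args, e.WF m) ∧ k.WF π (m + 1)
  | m, .setScratch a b k => a.WF m ∧ b.WF m ∧ k.WF π m
  | m, .emit a b k => a.WF m ∧ b.WF m ∧ k.WF π m

/-- The continuations of the calls, each with the length of its environment. -/
def conts : ℕ → Code → List (ℕ × Code)
  | _, .ret _ => []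
  | m, .ite _ p q => conts m p ++ conts m q
  | m, .bind _ k => conts (m + 1) k
  | m, .call _ _ k => (m, k) :: conts (m + 1) k
  | m, .setScratch _ _ k => conts m k
  | m, .emit _ _ k => conts m k

def compCond : Cond → ℕ → Cmd
  | .isNil e, t => .seq (compE e t) (blk [.lit (t + 1) 0, .load (t + 1) (t + 1) 0])
  | .le a b, t => .seq (compE a t) (compE b (t + 1))

def condTest : Cond → ℕ → Test
  | .isNil _, t => .eq t (t + 1)
  | .le _ _, t => .le t (t + 1)

/-- Push a frame and enter function `f` with the `p` arguments in the registers from `m + 4` on. -/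
def enter (m p f l : ℕ) : Cmd :=
  .seq (blk [.new (m + p + 4), .lit (m + p + 5) l, .store (m + p + 4) 0 (m + p + 5),
      .store (m + p + 4) 1 1])
    (.seq (blk (saveVars (m + p + 4) m))
      (.seq (blk [.copy 1 (m + p + 4), .lit 0 f]) (blk (moveArgs (m + 4) p))))

/-- A call ends the block: what follows it is a block of its own, reached through the label stored
in the frame. A return fetches that label from the top frame, which the continuation itself pops. -/
def comp (π : Prog) (sc : ℕ) (lab : ℕ × Code → ℕ) : ℕ → Code → Cmd
  | m, .ret e => .seq (compE e (m + 4)) (blk [.copy 2 (m + 4), .load 0 1 0])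
  | m, .ite b p q => .seq (compCond b (m + 4))
      (.ite (condTest b (m + 4)) (comp π sc lab m p) (comp π sc lab m q))
  | m, .bind e k => .seq (compE e (m + 4)) (comp π sc lab (m + 1) k)
  | m, .call f args k => .seq (compArgs args (m + 4)) (enter m args.length f (lab (m, k)))
  | m, .setScratch a b k => .seq (compE a (m + 4)) (.seq (compE b (m + 5))
      (.seq (blk [.store (m + 4) sc (m + 5)]) (comp π sc lab m k)))
  | m, .emit a b k => .seq (compE a (m + 4)) (.seq (compE b (m + 5))
      (.seq (blk [.emit (m + 4) (m + 5)]) (comp π sc lab m k)))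

/-- Return to a continuation: restore the variables, append the result and pop the frame. -/
def resume (m : ℕ) : Cmd :=
  .seq (blk (restoreVars m)) (blk [.copy (m + 4) 2, .load 1 1 1])

def allConts (π : Prog) : List (ℕ × Code) :=
  (List.range π.num).flatMap fun f => conts (π.ar f) (π.body f)

-- The functions are numbered first, then the continuations. Equal continuations share a label,
-- which is harmless because they compile to the same block.
open Classical in
noncomputable def lab (π : Prog) (c : ℕ × Code) : ℕ := π.num + (allConts π).idxOf c

noncomputable def table (π : Prog) (sc : ℕ) : List Cmd :=
  (List.range π.num).map (fun f => comp π sc (lab π) (π.ar f) (π.body f)) ++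
    (allConts π).map fun c => .seq (resume c.1) (comp π sc (lab π) (c.1 + 1) c.2)

/-- The label is compared with one literal after another; the number of blocks is fixed by the
program, so this takes constant time. -/
def dispatch : List Cmd → ℕ → Cmd
  | [], _ => .skip
  | c :: l, i => .seq (.instr (.lit 3 i)) (.ite (.eq 0 3) c (dispatch l (i + 1)))

/-- The test holds when register `0` contains an integer label and fails on `nil`. A return through
the empty stack loads `nil` and thereby stops the loop. -/
noncomputable def mainLoop (π : Prog) (sc : ℕ) : Cmd := .loop (.le 0 0) (dispatch (table π sc) 0)

theorem comp_loopFree (π : Prog) (sc : ℕ) (lb : ℕ × Code → ℕ) (c : Code) :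
    ∀ m, LoopFree (comp π sc lb m c) := by
  induction c <;> intro m <;>
    simp_all [comp, LoopFree, blk_loopFree, compE_loopFree, compArgs_loopFree, enter]
  case ite b p q _ _ => cases b <;> simp [compCond, LoopFree, compE_loopFree, blk_loopFree]

theorem conts_subset (π : Prog) {f : ℕ} (hf : f < π.num) :
    conts (π.ar f) (π.body f) ⊆ allConts π := fun _ hc =>
  List.mem_flatMap.2 ⟨f, List.mem_range.2 hf, hc⟩

theorem exec_dispatch (W : ℕ) {l : List Cmd} {j : ℕ} {σ τ : Config} {t : ℕ} :
    ∀ {i : ℕ} (hj : j < l.length), σ.reg 0 = .int ((i + j : ℕ) : ℤ) →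
      Exec W l[j] (σ.set 3 (.int ((i + j : ℕ) : ℤ))) t τ →
      Exec W (dispatch l i) σ (2 * (j + 1) + t) τ := by
  induction l generalizing j σ with
  | nil => intro i hj; simp at hj
  | cons c l ih =>
    intro i hj h0 hc
    cases j with
    | zero =>
      have h1 : Test.Holds (.eq 0 3) (σ.set 3 (.int (i : ℤ))) := by
        show (σ.set 3 _).reg 0 = (σ.set 3 _).reg 3
        rw [set_reg_same, set_reg_ne _ _ (by omega), h0]; simp
      have := Exec.seq (W := W) (.instr (.lit 3 i) σ)
        (Exec.iteTrue (p := c) (q := dispatch l (i + 1)) h1 (by simpa [Instr.exec] using hc))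
      rwa [show 1 + (1 + t) = 2 * (0 + 1) + t by ring] at this
    | succ j =>
      have h1 : ¬ Test.Holds (.eq 0 3) (σ.set 3 (.int (i : ℤ))) := by
        show ¬ (σ.set 3 _).reg 0 = (σ.set 3 _).reg 3
        rw [set_reg_same, set_reg_ne _ _ (by omega), h0, Val.int.injEq]; omega
      have e : i + 1 + j = i + (j + 1) := by omega
      have h2 := ih (j := j) (σ := σ.set 3 (.int (i : ℤ))) (i := i + 1) (by simpa using hj)
        (by rw [set_reg_ne _ _ (by omega), h0, e]) (by
          rw [e]
          have : (σ.set 3 (.int (i : ℤ))).set 3 (.int ((i + (j + 1) : ℕ) : ℤ))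
              = σ.set 3 (.int ((i + (j + 1) : ℕ) : ℤ)) := by simp [Config.set]
          rw [this]; simpa using hc)
      have := Exec.seq (W := W) (.instr (.lit 3 i) σ) (Exec.iteFalse (p := c) h1 h2)
      rwa [show 1 + (1 + (2 * (j + 1) + t)) = 2 * (j + 1 + 1) + t by ring] at this

theorem exec_mainLoop {π : Prog} {sc W : ℕ} {σ τ υ : Config} {j t u : ℕ} {c : Cmd}
    (hc : (table π sc)[j]? = some c) (h0 : σ.reg 0 = .int (j : ℤ))
    (h : Exec W c (σ.set 3 (.int (j : ℤ))) t τ) (h' : Exec W (mainLoop π sc) τ u υ) :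
    Exec W (mainLoop π sc) σ (1 + (2 * (j + 1) + t) + u) υ := by
  obtain ⟨hj, rfl⟩ := List.getElem?_eq_some_iff.1 hc
  refine .loopStep ?_ (exec_dispatch W (i := 0) hj (by simpa using h0) (by simpa using h)) h'
  show (σ.reg 0).le (σ.reg 0)
  rw [h0]; exact le_rfl (a := (j : ℤ))

theorem table_fun (π : Prog) (sc : ℕ) {f : ℕ} (hf : f < π.num) :
    (table π sc)[f]? = some (comp π sc (lab π) (π.ar f) (π.body f)) := by
  rw [table, List.getElem?_append_left (by simpa using hf)]
  simp [hf]

theorem table_cont (π : Prog) (sc : ℕ) {c : ℕ × Code} (hc : c ∈ allConts π) :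
    (table π sc)[lab π c]? = some (.seq (resume c.1) (comp π sc (lab π) (c.1 + 1) c.2)) := by
  classical
  have h := List.idxOf_lt_length_of_mem hc
  rw [table, List.getElem?_append_right (by simp [lab])]
  simp only [lab, List.length_map, List.length_range, Nat.add_sub_cancel_left, List.getElem?_map]
  rw [List.getElem?_eq_getElem (by convert h)]
  simp

theorem compCond_spec (I : Inp) (μ : ℕ → T) (env : List T) (b : Cond) (t : ℕ) (σ : Config)
    (hw : b.WF env.length) (ht : env.length + 4 ≤ t) (hr : RegsRep I σ env) (hg : Good I σ.heap μ) :
    ∃ k τ, Exec I.W (compCond b t) σ k τ ∧ XExt σ.heap τ.heap ∧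
      ((condTest b t).Holds τ ↔ b.holds I env μ) ∧ (∀ i < t, τ.reg i = σ.reg i) ∧ τ.out = σ.out := by
  cases b with
  | isNil e =>
    obtain ⟨k, τ, h1, hx, hrep, hreg, hout⟩ := compE_spec I μ env e t σ hw ht hr hg
    refine ⟨_, _, .seq h1 (exec_blk _ _ _), ?_⟩
    simp only [execs, List.foldl, exec_load]
    refine ⟨hx, ?_, fun i hi => ?_, hout⟩
    · simp only [condTest, Test.Holds, set_reg_same]
      rw [set_reg_ne _ _ (by omega)]
      simp only [Instr.exec, set_reg_same, loadVal]
      rw [set_reg_ne _ _ (by omega)]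
      exact hrep.eq_nil_iff
    · rw [set_reg_ne _ _ (by omega)]
      simp only [Instr.exec]
      rw [set_reg_ne _ _ (by omega), hreg i hi]
  | le a c =>
    obtain ⟨k, τ, h1, hx, hrep, hreg, hout⟩ := compE_spec I μ env a t σ hw.1 ht hr hg
    obtain ⟨k', τ', h1', hx', hrep', hreg', hout'⟩ := compE_spec I μ env c (t + 1) τ hw.2 (by omega)
      (hr.mono hx.ext fun i hi => hreg i (by omega)) (hg.mono hx)
    refine ⟨_, _, .seq h1 h1', hx.trans hx', ?_, fun i hi => ?_, hout'.trans hout⟩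
    · simp only [condTest, Test.Holds, Cond.holds]
      exact Rep.le_iff (by rw [hreg' t (by omega)]; exact hrep.mono hx'.ext) hrep'
    · rw [hreg' i (by omega), hreg i hi]

theorem enter_spec (I : Inp) (m p f l : ℕ) (σ : Config) :
    ∃ k τ, Exec I.W (enter m p f l) σ k τ ∧ XExt σ.heap τ.heap ∧ τ.out = σ.out ∧
      τ.reg 0 = .int f ∧ τ.reg 1 = .ptr σ.heap.next ∧ σ.heap.next < τ.heap.next ∧
      (∀ i < p, τ.reg (i + 4) = σ.reg (m + 4 + i)) ∧
      τ.heap.cell σ.heap.next 0 = .int l ∧ τ.heap.cell σ.heap.next 1 = σ.reg 1 ∧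
      ∀ i < m, τ.heap.cell σ.heap.next (i + 2) = σ.reg (i + 4) := by
  refine ⟨_, _, .seq (exec_blk _ _ _) (.seq (exec_blk _ _ _) (.seq (exec_blk _ _ _)
    (exec_blk _ _ _))), ?_⟩
  set σ₁ := execs I.W [.new (m + p + 4), .lit (m + p + 5) l, .store (m + p + 4) 0 (m + p + 5),
      .store (m + p + 4) 1 1] σ with hσ₁
  have a1 : σ₁.reg (m + p + 4) = .ptr σ.heap.next := by
    simp [hσ₁, execs, Instr.exec, Config.set]
  have a2 : ∀ i < m + p + 4, σ₁.reg i = σ.reg i := by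
    intro i hi
    simp [hσ₁, execs, Instr.exec, Config.set, Function.update, show i ≠ m + p + 4 by omega,
      show i ≠ m + p + 5 by omega]
  have a3 : σ₁.heap.next = σ.heap.next + 1 := by simp [hσ₁, execs, Instr.exec, Config.set]
  have a4 : ∀ b < σ.heap.next, σ₁.heap.cell b = σ.heap.cell b := by
    intro b hb
    funext g
    simp [hσ₁, execs, Instr.exec, Config.set, Function.update, hb.ne]
  have a5 : σ₁.heap.cell σ.heap.next 0 = .int l := by
    simp [hσ₁, execs, Instr.exec, Config.set, Function.update]
  have a6 : σ₁.heap.cell σ.heap.next 1 = σ.reg 1 := by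
    simp [hσ₁, execs, Instr.exec, Config.set, Function.update]
  have a7 : σ₁.out = σ.out := by simp [hσ₁, execs, Instr.exec, Config.set]
  obtain ⟨b1, b2, b3, b4, b5, b6⟩ := saveVars_spec I.W (m + p + 4) _ σ₁ a1 m
  set σ₂ := execs I.W (saveVars (m + p + 4) m) σ₁
  set σ₃ := execs I.W [.copy 1 (m + p + 4), .lit 0 f] σ₂ with hσ₃
  have c1 : σ₃.reg 0 = .int f := by simp [hσ₃, execs, Instr.exec, Config.set]
  have c2 : σ₃.reg 1 = .ptr σ.heap.next := by
    simp [hσ₃, execs, Instr.exec, Config.set, Function.update, b1, a1]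
  have c3 : ∀ i, 2 ≤ i → σ₃.reg i = σ₂.reg i := by
    intro i hi
    simp [hσ₃, execs, Instr.exec, Config.set, Function.update, show i ≠ 0 by omega,
      show i ≠ 1 by omega]
  have c4 : σ₃.heap = σ₂.heap := by simp [hσ₃, execs, Instr.exec, Config.set]
  have c5 : σ₃.out = σ₂.out := by simp [hσ₃, execs, Instr.exec, Config.set]
  obtain ⟨d1, d2, d3, d4⟩ := moveArgs_spec I.W (m + 4) (by omega) σ₃ p
  rw [d1, d2, c4, c5, b2, a7]
  refine ⟨⟨by omega, fun b hb => ?_⟩, rfl, ?_, ?_, by omega, fun i hi => ?_, ?_, ?_, fun i hi => ?_⟩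
  · rw [b4 b hb.ne, a4 b hb]
  · rw [d3 0 (by omega), c1]
  · rw [d3 1 (by omega), c2]
  · rw [d4 i hi, c3 _ (by omega), b1, a2 _ (by omega)]
  · rw [b5 0 (by omega), a5]
  · rw [b5 1 (by omega), a6]
  · rw [b6 i hi, a2 _ (by omega)]

theorem resume_spec (I : Inp) (m a : ℕ) (σ : Config) (h1 : σ.reg 1 = .ptr a) :
    ∃ k τ, Exec I.W (resume m) σ k τ ∧ τ.heap = σ.heap ∧ τ.out = σ.out ∧
      τ.reg 1 = σ.heap.cell a 1 ∧ (∀ i < m, τ.reg (i + 4) = σ.heap.cell a (i + 2)) ∧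
      τ.reg (m + 4) = σ.reg 2 := by
  refine ⟨_, _, .seq (exec_blk _ _ _) (exec_blk _ _ _), ?_⟩
  obtain ⟨a1, a2, a3, a4⟩ := restoreVars_spec I.W a σ h1 m
  set σ₁ := execs I.W (restoreVars m) σ
  simp only [execs, List.foldl, exec_load]
  simp only [Instr.exec]
  refine ⟨a1, a2, ?_, fun i hi => ?_, ?_⟩
  · rw [set_reg_same, set_reg_ne _ _ (by omega), a3 1 (by omega), h1, set_heap, a1]; rfl
  · rw [set_reg_ne _ _ (by omega), set_reg_ne _ _ (by omega), a4 i hi]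
  · rw [set_reg_ne _ _ (by omega), set_reg_same, a3 2 (by omega)]

/-! ### The simulation -/

/-- The effect of running code to the end of the enclosing function. -/
structure SimPost (I : Inp) (r : T) (s : S) (σ τ : Config) : Prop where
  good : Good I τ.heap s.mem
  ext : Ext I σ.heap τ.heap
  rep : Rep I.n τ.heap r (τ.reg 2)
  stack : τ.reg 1 = σ.reg 1
  label : τ.reg 0 = loadVal τ.heap (σ.reg 1) 0
  out : τ.out = s.out.map fun p => (Val.col p.1, Val.int p.2)

theorem SimPost.pre {I : Inp} {r : T} {s : S} {σ σ' τ : Config} (h : SimPost I r s σ' τ)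
    (hx : Ext I σ.heap σ'.heap) (hs : σ'.reg 1 = σ.reg 1) : SimPost I r s σ τ :=
  ⟨h.good, hx.trans h.ext, h.rep, h.stack.trans hs, by rw [h.label, hs], h.out⟩

/-- A return hands control back to the main loop, so the run of a function body is not the run of
one command. The conclusion is phrased backwards for this reason: every halting run of the loop from
the state `τ` after the return extends to a run of the current block followed by the loop. Each rule
of `Run` accounts for at most a block, two dispatches and a resumption, which is where `4 * K` comes
from. -/
theorem sim (I : Inp) (π : Prog) (hπ : ∀ f < π.num, (π.body f).WF π (π.ar f)) (K : ℕ)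
    (hK : ∀ c ∈ table π I.sc, csz c ≤ K) (hK' : 2 * (table π I.sc).length + 2 ≤ K)
    {c : Code} {env : List T} {s s' : S} {r : T} {k : ℕ} (hrun : Run I π c env s r s' k) :
    ∀ σ : Config, c.WF π env.length → conts env.length c ⊆ allConts π →
      csz (comp π I.sc (lab π) env.length c) ≤ K → RegsRep I σ env → Good I σ.heap s.mem →
      σ.out = s.out.map (fun p => (Val.col p.1, Val.int p.2)) →
      ∃ τ, SimPost I r s' σ τ ∧ ∀ t υ, Exec I.W (mainLoop π I.sc) τ t υ →
        ∃ t₁ σ₁ t₂, Exec I.W (comp π I.sc (lab π) env.length c) σ t₁ σ₁ ∧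
          Exec I.W (mainLoop π I.sc) σ₁ t₂ υ ∧ t₁ + t₂ ≤ t + 4 * K * k := by
  induction hrun with
  | ret e env s =>
    intro σ hw hc hk hr hg ho
    obtain ⟨k, τ, h1, hx, hrep, hreg, hout⟩ := compE_spec I s.mem env e _ σ hw le_rfl hr hg
    refine ⟨execs I.W [.copy 2 (env.length + 4), .load 0 1 0] τ, ?_, fun t υ hυ => ?_⟩
    · simp only [execs, List.foldl, exec_load]
      simp only [Instr.exec]
      refine ⟨hg.mono hx, hx.ext, ?_, ?_, ?_, ?_⟩
      · simpa [Config.set] using hrep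
      · simp [Config.set, hreg 1 (by omega)]
      · simp [Config.set, hreg 1 (by omega)]
      · exact hout.trans ho
    · have := Exec.seq h1 (exec_blk I.W [.copy 2 (env.length + 4), .load 0 1 0] τ)
      have h2 := this.le_csz (comp_loopFree π I.sc (lab π) (.ret e) env.length)
      have h2' := h2.trans hk
      exact ⟨_, _, _, this, hυ, by omega⟩
  | @iteTrue b p q env s s' r k hb hp ih =>
    intro σ hw hc hk hr hg ho
    simp only [comp, csz] at hk
    obtain ⟨k', τ, h1, hx, htest, hreg, hout⟩ :=
      compCond_spec I s.mem env b _ σ hw.1 le_rfl hr hg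
    obtain ⟨τ', h2, h3⟩ := ih τ hw.2.1 (fun x hx => hc (List.mem_append_left _ hx)) (by omega)
      (hr.mono hx.ext fun i hi => hreg i (by omega)) (hg.mono hx) (hout.trans ho)
    refine ⟨τ', h2.pre hx.ext (hreg _ (by omega)), fun t υ hυ => ?_⟩
    obtain ⟨t₁, σ₁, t₂, h4, h5, h6⟩ := h3 t υ hυ
    have hb' := htest.2 hb
    have hcz := h1.le_csz (by cases b <;> simp [compCond, LoopFree, compE_loopFree, blk_loopFree])
    refine ⟨_, _, _, .seq h1 (.iteTrue hb' h4), h5, ?_⟩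
    have : 4 * K * (k + 1) = 4 * K * k + 4 * K := by ring
    omega
  | @iteFalse b p q env s s' r k hb hp ih =>
    intro σ hw hc hk hr hg ho
    simp only [comp, csz] at hk
    obtain ⟨k', τ, h1, hx, htest, hreg, hout⟩ :=
      compCond_spec I s.mem env b _ σ hw.1 le_rfl hr hg
    obtain ⟨τ', h2, h3⟩ := ih τ hw.2.2 (fun x hx => hc (List.mem_append_right _ hx)) (by omega)
      (hr.mono hx.ext fun i hi => hreg i (by omega)) (hg.mono hx) (hout.trans ho)
    refine ⟨τ', h2.pre hx.ext (hreg _ (by omega)), fun t υ hυ => ?_⟩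
    obtain ⟨t₁, σ₁, t₂, h4, h5, h6⟩ := h3 t υ hυ
    have hb' := mt htest.1 hb
    have hcz := h1.le_csz (by cases b <;> simp [compCond, LoopFree, compE_loopFree, blk_loopFree])
    refine ⟨_, _, _, .seq h1 (.iteFalse hb' h4), h5, ?_⟩
    have : 4 * K * (k + 1) = 4 * K * k + 4 * K := by ring
    omega
  | @bind e c env s s' r k hrun ih =>
    intro σ hw hc hk hr hg ho
    simp only [comp, csz] at hk
    obtain ⟨k', τ, h1, hx, hrep, hreg, hout⟩ := compE_spec I s.mem env e _ σ hw.1 le_rfl hr hg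
    simp only [List.length_append, List.length_singleton] at ih
    obtain ⟨τ', h2, h3⟩ := ih τ hw.2 hc (by omega) (by
      intro i hi
      simp only [List.length_append, List.length_singleton] at hi
      by_cases h : i < env.length
      · rw [List.getD_append _ _ _ _ h, hreg _ (by omega)]; exact (hr i h).mono hx.ext
      · obtain rfl : i = env.length := by omega
        rw [List.getD_append_right _ _ _ _ le_rfl]; simpa using hrep) (hg.mono hx) (hout.trans ho)
    refine ⟨τ', h2.pre hx.ext (hreg _ (by omega)), fun t υ hυ => ?_⟩
    obtain ⟨t₁, σ₁, t₂, h4, h5, h6⟩ := h3 t υ hυ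
    have hcz := h1.le_csz (compE_loopFree _ _)
    refine ⟨_, _, _, .seq h1 h4, h5, ?_⟩
    have : 4 * K * (k + 1) = 4 * K * k + 4 * K := by ring
    omega
  | @call f args c env s s' s'' r r' k k' hf hcont ihf ihc =>
    intro σ hw hc hk hr hg ho
    simp only [comp, csz] at hk
    obtain ⟨hfn, hlen, hwa, hwc⟩ := hw
    obtain ⟨k₁, σ₁, e1, x1, rep1, reg1, out1⟩ :=
      compArgs_spec I s.mem env args _ σ hwa le_rfl hr hg
    obtain ⟨k₂, σ₂, e2, x2, out2, lab2, st2, next2, args2, fr0, fr1, fr2⟩ :=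
      enter_spec I env.length args.length f (lab π (env.length, c)) σ₁
    have hmem : (env.length, c) ∈ allConts π := hc (List.mem_cons_self ..)
    have g2 : Good I σ₂.heap s.mem := (hg.mono x1).mono x2
    set a := σ₁.heap.next with ha
    have han : I.n ≤ a := (hg.mono x1).1
    -- the callee
    have hlt : f < (table π I.sc).length := by
      simp [table]; omega
    have hKf : csz (comp π I.sc (lab π) (π.ar f) (π.body f)) ≤ K := by
      refine hK _ (List.mem_of_getElem? (table_fun π I.sc hfn))
    have hlm : (args.map (Ex.eval I env s.mem)).length = π.ar f := by simpa using hlen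
    rw [hlm] at ihf
    obtain ⟨τ₁, p1, q1⟩ := ihf (σ₂.set 3 (.int (f : ℤ))) (hπ f hfn) (conts_subset π hfn) hKf (by
      intro i hi
      rw [hlm, ← hlen] at hi
      rw [set_heap, set_reg_ne _ _ (by omega), args2 i hi]
      exact (rep1 i hi).mono x2.ext) g2 (out2.trans (out1.trans ho))
    -- the continuation
    have fr : ∀ g, τ₁.heap.cell a g = σ₂.heap.cell a g := fun g =>
      p1.ext.2 a next2 g (Or.inl han)
    have hst : (σ₂.set 3 (.int (f : ℤ))).reg 1 = .ptr a := by
      rw [set_reg_ne _ _ (by omega), st2]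
    have lab3 : τ₁.reg 0 = .int (lab π (env.length, c) : ℤ) := by
      rw [p1.label, hst]
      show τ₁.heap.cell a 0 = _
      rw [fr, fr0]
    have st3 : τ₁.reg 1 = .ptr a := p1.stack.trans hst
    obtain ⟨k₃, σ₃, e3, h3, out3, st4, vars3, res3⟩ :=
      resume_spec I env.length a (τ₁.set 3 (.int (lab π (env.length, c) : ℤ)))
        (by rw [set_reg_ne _ _ (by omega), st3])
    have x3 : Ext I σ.heap τ₁.heap := (x1.ext.trans x2.ext).trans p1.ext
    rw [set_heap] at h3 st4 vars3
    have htc := table_cont π I.sc hmem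
    have hKc := hK _ (List.mem_of_getElem? htc)
    simp only [csz] at hKc
    simp only [List.length_append, List.length_singleton] at ihc
    obtain ⟨τ, p4, q4⟩ := ihc σ₃ hwc
      (fun x hx => hc (List.mem_cons_of_mem _ hx)) (by omega) (by
        intro i hi
        simp only [List.length_append, List.length_singleton] at hi
        rw [h3]
        by_cases h : i < env.length
        · rw [List.getD_append _ _ _ _ h, vars3 i h, fr, fr2 i h, reg1 _ (by omega)]
          exact (hr i h).mono x3
        · obtain rfl : i = env.length := by omega
          rw [List.getD_append_right _ _ _ _ le_rfl, res3, set_reg_ne _ _ (by omega)]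
          simpa using p1.rep) (by rw [h3]; exact p1.good) (out3.trans p1.out)
    refine ⟨τ, p4.pre (by rw [h3]; exact x3) ?_, fun t υ hυ => ?_⟩
    · rw [st4, fr, fr1, reg1 _ (by omega)]
    · obtain ⟨t₁, ρ₁, t₂, i1, i2, i3⟩ := q4 t υ hυ
      -- A call takes two rounds of the main loop, built from the end: this one enters the
      -- continuation, the next one the callee.
      have loop3 := exec_mainLoop htc lab3 (.seq e3 i1) i2
      obtain ⟨t₃, ρ₂, t₄, j1, j2, j3⟩ := q1 _ υ loop3
      have loop2 := exec_mainLoop (table_fun π I.sc hfn) lab2 j1 j2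
      refine ⟨_, _, _, .seq e1 e2, loop2, ?_⟩
      have z1 := (Exec.seq e1 e2).le_csz
        ⟨compArgs_loopFree _ _, by simp [enter, LoopFree, blk_loopFree]⟩
      have z2 := e3.le_csz (by simp [resume, LoopFree, blk_loopFree])
      have z3 : lab π (env.length, c) < (table π I.sc).length := (List.getElem?_eq_some_iff.1 htc).1
      have : 4 * K * (k + k' + 1) = 4 * K * k + 4 * K * k' + 4 * K := by ring
      simp only [csz] at z1
      omega
  | @setScratch e₁ e₂ c env s s' r a k ha hrun ih =>
    intro σ hw hc hk hr hg ho
    simp only [comp, csz] at hk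
    obtain ⟨k₁, τ, h1, hx, hrep, hreg, hout⟩ := compE_spec I s.mem env e₁ _ σ hw.1 le_rfl hr hg
    have hr₁ : RegsRep I τ env := hr.mono hx.ext fun i hi => hreg i (by omega)
    obtain ⟨k₂, τ', h1', hx', hrep', hreg', hout'⟩ := compE_spec I s.mem env e₂ (env.length + 5) τ
      hw.2.1 (by omega) hr₁ (hg.mono hx)
    have hr₂ : RegsRep I τ' env := hr₁.mono hx'.ext fun i hi => hreg' i (by omega)
    have hg₂ : Good I τ'.heap s.mem := (hg.mono hx).mono hx'
    rw [ha] at hrep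
    obtain ⟨hp, han⟩ := hrep
    have hp' : τ'.reg (env.length + 4) = .ptr a := by rw [hreg' _ (by omega), hp]
    set υ₀ := execs I.W [.store (env.length + 4) I.sc (env.length + 5)] τ' with hυ₀
    have s1 : υ₀.reg = τ'.reg := by simp [hυ₀, execs, Instr.exec, hp']
    have s2 : υ₀.out = τ'.out := by simp [hυ₀, execs, Instr.exec, hp']
    have s3 : υ₀.heap.next = τ'.heap.next := by simp [hυ₀, execs, Instr.exec, hp']
    have s4 : ∀ b f, υ₀.heap.cell b f =
        if b = a ∧ f = I.sc then τ'.reg (env.length + 5) else τ'.heap.cell b f := by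
      intro b f
      simp only [hυ₀, execs, List.foldl, Instr.exec, hp', Function.update]
      by_cases hb : b = a
      · subst hb; by_cases hf : f = I.sc <;> simp [hf]
      · simp [hb]
    have s5 : Ext I τ'.heap υ₀.heap := by
      refine ⟨s3.ge, fun b _ f hf => ?_⟩
      rw [s4, if_neg]
      rintro ⟨rfl, rfl⟩
      rcases hf with hf | hf
      · omega
      · exact hf rfl
    have s6 : Good I υ₀.heap (Function.update s.mem a (e₂.eval I env s.mem)) := by
      refine ⟨by rw [s3]; exact hg₂.1, fun b hb f => ?_⟩
      rw [s4]
      by_cases hbf : b = a ∧ f = I.sc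
      · rw [if_pos hbf, hbf.1, hbf.2]
        simp only [Inp.field, if_true, Function.update_self]
        exact hrep'.mono s5
      · rw [if_neg hbf]
        have e : I.field (Function.update s.mem a (e₂.eval I env s.mem)) b f
            = I.field s.mem b f := by
          unfold Inp.field
          split_ifs with hf
          · rw [Function.update_of_ne (fun h => hbf ⟨h, hf⟩)]
          · rfl
        rw [e]; exact (hg₂.2 b hb f).mono s5
    obtain ⟨τ'', h2, h3⟩ := ih υ₀ hw.2.2 hc (by omega)
      (hr₂.mono s5 fun i _ => by rw [s1]) s6 (by rw [s2]; exact hout'.trans (hout.trans ho))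
    refine ⟨τ'', h2.pre ((hx.ext.trans hx'.ext).trans s5) ?_, fun t υ hυ => ?_⟩
    · rw [s1, hreg' _ (by omega), hreg _ (by omega)]
    · obtain ⟨t₁, σ₁, t₂, h4, h5, h6⟩ := h3 t υ hυ
      have z1 := h1.le_csz (compE_loopFree _ _)
      have z2 := h1'.le_csz (compE_loopFree _ _)
      have z3 := (exec_blk I.W [.store (env.length + 4) I.sc (env.length + 5)] τ').le_csz
        (blk_loopFree _)
      refine ⟨_, _, _, .seq h1 (.seq h1' (.seq (exec_blk _ _ _) h4)), h5, ?_⟩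
      have : 4 * K * (k + 1) = 4 * K * k + 4 * K := by ring
      omega
  | @emit e₁ e₂ c env s s' r a k z ha hz hrun ih =>
    intro σ hw hc hk hr hg ho
    simp only [comp, csz] at hk
    obtain ⟨k₁, τ, h1, hx, hrep, hreg, hout⟩ := compE_spec I s.mem env e₁ _ σ hw.1 le_rfl hr hg
    have hr₁ : RegsRep I τ env := hr.mono hx.ext fun i hi => hreg i (by omega)
    obtain ⟨k₂, τ', h1', hx', hrep', hreg', hout'⟩ := compE_spec I s.mem env e₂ (env.length + 5) τ
      hw.2.1 (by omega) hr₁ (hg.mono hx)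
    have hr₂ : RegsRep I τ' env := hr₁.mono hx'.ext fun i hi => hreg' i (by omega)
    rw [ha] at hrep
    rw [hz] at hrep'
    have hp' : τ'.reg (env.length + 4) = .col a := by rw [hreg' _ (by omega)]; exact hrep
    have hq' : τ'.reg (env.length + 5) = .int z := hrep'
    obtain ⟨τ'', h2, h3⟩ := ih (execs I.W [.emit (env.length + 4) (env.length + 5)] τ') hw.2.2 hc
      (by omega) hr₂ ((hg.mono hx).mono hx')
      (by simp [execs, Instr.exec, hp', hq', hout', hout, ho])
    refine ⟨τ'', h2.pre (hx.ext.trans hx'.ext) ?_, fun t υ hυ => ?_⟩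
    · show τ'.reg 1 = σ.reg 1
      rw [hreg' _ (by omega), hreg _ (by omega)]
    · obtain ⟨t₁, σ₁, t₂, h4, h5, h6⟩ := h3 t υ hυ
      have z1 := h1.le_csz (compE_loopFree _ _)
      have z2 := h1'.le_csz (compE_loopFree _ _)
      have z3 := (exec_blk I.W [.emit (env.length + 4) (env.length + 5)] τ').le_csz
        (blk_loopFree _)
      refine ⟨_, _, _, .seq h1 (.seq h1' (.seq (exec_blk _ _ _) h4)), h5, ?_⟩
      have : 4 * K * (k + 1) = 4 * K * k + 4 * K := by ring
      omega

end FunLang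

namespace FunLang

open PointerMachine

/-! ### Complete programs -/

/-- Source and target registers overlap, so the copies run from the highest register downwards. -/
def shiftRegs : ℕ → List Instr
  | 0 => []
  | m + 1 => .copy (m + 4) m :: shiftRegs m

theorem shiftRegs_spec (W m : ℕ) : ∀ σ : Config,
    (execs W (shiftRegs m) σ).heap = σ.heap ∧ (execs W (shiftRegs m) σ).out = σ.out ∧
    (∀ r, m + 4 ≤ r → (execs W (shiftRegs m) σ).reg r = σ.reg r) ∧
    ∀ i < m, (execs W (shiftRegs m) σ).reg (i + 4) = σ.reg i := by
  induction m with
  | zero => simp [shiftRegs, execs]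
  | succ m ih =>
    intro σ
    have e : execs W (shiftRegs (m + 1)) σ
        = execs W (shiftRegs m) (σ.set (m + 4) (σ.reg m)) := rfl
    rw [e]
    obtain ⟨h1, h2, h3, h4⟩ := ih (σ.set (m + 4) (σ.reg m))
    refine ⟨h1, h2, fun r hr => ?_, fun i hi => ?_⟩
    · rw [h3 r (by omega), set_reg_ne _ _ (by omega)]
    · by_cases him : i = m
      · subst him; rw [h3 _ (by omega), set_reg_same]
      · rw [h4 i (by omega), set_reg_ne _ _ (by omega)]

/-- Run the function `f` on the arguments in the registers from `0` on and leave the result in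
register `0`. -/
noncomputable def whole (π : Prog) (sc f : ℕ) : Cmd :=
  .seq (blk (shiftRegs (π.ar f))) (.seq (blk [.lit 0 0, .load 1 0 0, .lit 0 f])
    (.seq (mainLoop π sc) (blk [.copy 0 2])))

theorem exists_le_of_mem {α : Type*} (g : α → ℕ) (l : List α) : ∃ K, ∀ c ∈ l, g c ≤ K := by
  induction l with
  | nil => exact ⟨0, by simp⟩
  | cons a l ih =>
    obtain ⟨K, hK⟩ := ih
    refine ⟨max K (g a), fun c hc => ?_⟩
    rcases List.mem_cons.1 hc with rfl | hc
    · exact le_max_right _ _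
    · exact (hK c hc).trans (le_max_left _ _)

/-- The constant is chosen before the input: it depends on the compiled blocks and the arity only.
-/
theorem exists_exec_whole (π : Prog) (hπ : ∀ f < π.num, (π.body f).WF π (π.ar f)) (sc f : ℕ)
    (hf : f < π.num) : ∃ K, ∀ (I : Inp), I.sc = sc →
      ∀ (env : List T) (s s' : S) (r : T) (k : ℕ) (σ : Config),
      env.length = π.ar f → Ev I π f env s r s' k →
      (∀ i < env.length, Rep I.n σ.heap (env.getD i .nil) (σ.reg i)) → Good I σ.heap s.mem →
      σ.out = s.out.map (fun p => (Val.col p.1, Val.int p.2)) →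
      ∃ t τ, Exec I.W (whole π sc f) σ t τ ∧ t ≤ K * (k + 1) ∧ Good I τ.heap s'.mem ∧
        Ext I σ.heap τ.heap ∧ Rep I.n τ.heap r (τ.reg 0) ∧
        τ.out = s'.out.map fun p => (Val.col p.1, Val.int p.2) := by
  obtain ⟨K₀, hK₀⟩ := exists_le_of_mem csz (table π sc)
  set K := K₀ + 2 * (table π sc).length + 2 with hKdef
  refine ⟨4 * K + (shiftRegs (π.ar f)).length + 20, ?_⟩
  rintro I rfl env s s' r k σ hlen ⟨k', hk', hrun⟩ hr hg ho
  obtain ⟨a1, a2, a3, a4⟩ := shiftRegs_spec I.W (π.ar f) σ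
  set σ₁ := execs I.W (shiftRegs (π.ar f)) σ with hσ₁
  set σ₂ := execs I.W [.lit 0 0, .load 1 0 0, .lit 0 f] σ₁ with hσ₂
  have b1 : σ₂.reg 0 = .int (f : ℤ) := by simp [hσ₂, execs, Instr.exec, Config.set]
  have b2 : σ₂.reg 1 = .nil := by simp [hσ₂, execs, Instr.exec, Config.set]
  have b3 : ∀ i, σ₂.reg (i + 4) = σ₁.reg (i + 4) := by
    intro i; simp [hσ₂, execs, Instr.exec, Config.set]
  have b4 : σ₂.heap = σ.heap := by rw [← a1]; simp [hσ₂, execs, Instr.exec, Config.set]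
  have b5 : σ₂.out = σ.out := by rw [← a2]; simp [hσ₂, execs, Instr.exec, Config.set]
  have htf := table_fun π I.sc hf
  have hlt : f < (table π I.sc).length := (List.getElem?_eq_some_iff.1 htf).1
  obtain ⟨τ, p1, p2⟩ := sim I π hπ K (fun c hc => (hK₀ c hc).trans (by omega)) (by omega) hrun
    (σ₂.set 3 (.int (f : ℤ))) (by rw [hlen]; exact hπ f hf)
    (by rw [hlen]; exact conts_subset π hf)
    (by rw [hlen]; exact (hK₀ _ (List.mem_of_getElem? htf)).trans (by omega)) (by
      intro i hi
      rw [set_reg_ne _ _ (by omega), set_heap, b3, a4 i (by omega), b4]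
      exact hr i hi) (by rw [set_heap, b4]; exact hg) (b5.trans ho)
  -- The stack is initially `nil`, so the outermost return loads `nil` as its label.
  have hτ0 : τ.reg 0 = .nil := by
    rw [p1.label, set_reg_ne _ _ (by omega), b2]; rfl
  have hdone : Exec I.W (mainLoop π I.sc) τ 1 τ := by
    refine .loopDone ?_
    show ¬ (τ.reg 0).le (τ.reg 0)
    rw [hτ0]; simp [Val.le]
  obtain ⟨t₁, ρ, t₂, q1, q2, q3⟩ := p2 1 τ hdone
  rw [hlen] at q1
  have hloop := exec_mainLoop htf b1 q1 q2
  refine ⟨_, _, .seq (exec_blk _ _ _) (.seq (exec_blk _ _ _) (.seq hloop (exec_blk _ _ _))), ?_,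
    p1.good, ?_, ?_, p1.out⟩
  · have e1 : 4 * K * k' ≤ 4 * K * k := Nat.mul_le_mul_left _ hk'
    have e2 : (4 * K + (shiftRegs (π.ar f)).length + 20) * (k + 1)
        = 4 * K * k + 4 * K + ((shiftRegs (π.ar f)).length + 20) * (k + 1) := by ring
    have e3 : (shiftRegs (π.ar f)).length + 20
        ≤ ((shiftRegs (π.ar f)).length + 20) * (k + 1) := Nat.le_mul_of_pos_right _ (by omega)
    simp only [List.length_cons, List.length_nil]
    omega
  · have := p1.ext
    rwa [set_heap, b4] at this
  · have := p1.rep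
    simpa [execs, Instr.exec, Config.set] using this

/-! ### Growth of the memory, determinism and reachable records -/

/-- Scratch fields are the only fields that `Ext` leaves free, and they are `nil` on both sides. -/
theorem Ext.xext {I : Inp} {h h' : Heap} (hx : Ext I h h') (hg : Good I h fun _ => .nil)
    (hg' : Good I h' fun _ => .nil) : XExt h h' := by
  refine ⟨hx.1, fun a ha => funext fun f => ?_⟩
  by_cases hf : I.n ≤ a ∨ f ≠ I.sc
  · exact hx.2 a ha f hf
  · push Not at hf
    obtain ⟨han, rfl⟩ := hf
    have h1 := hg.2 a han I.sc
    have h2 := hg'.2 a han I.sc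
    simp only [Inp.field, if_true, Rep] at h1 h2
    rw [h1, h2]

/-- `AfterQueries` speaks of arbitrary runs of the query program; determinism identifies them with
the runs supplied by the simulation. -/
theorem exec_det {W : ℕ} {p : Cmd} {σ τ τ' : Config} {t t' : ℕ} (h : Exec W p σ t τ)
    (h' : Exec W p σ t' τ') : τ = τ' := by
  induction h generalizing τ' t' with
  | skip | instr => cases h'; rfl
  | seq _ _ ih1 ih2 =>
    cases h' with
    | seq a b => obtain rfl := ih1 a; exact ih2 b
  | iteTrue hb _ ih =>
    cases h' with
    | iteTrue _ a => exact ih a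
    | iteFalse hb' _ => exact absurd hb hb'
  | iteFalse hb _ ih =>
    cases h' with
    | iteTrue hb' _ => exact absurd hb' hb
    | iteFalse _ a => exact ih a
  | loopDone hb =>
    cases h' with
    | loopDone => rfl
    | loopStep hb' => exact absurd hb' hb
  | loopStep hb _ _ ih1 ih2 =>
    cases h' with
    | loopDone hb' => exact absurd hb hb'
    | loopStep _ a b => obtain rfl := ih1 a; exact ih2 b

/-- A step allocates at most one record, so a bound on the construction time is also a bound on the
size. -/
theorem next_le_of_exec {W : ℕ} {p : Cmd} {σ τ : Config} {t : ℕ} (h : Exec W p σ t τ) :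
    τ.heap.next ≤ σ.heap.next + t := by
  induction h with
  | skip => omega
  | instr i σ =>
    cases i <;> simp only [Instr.exec, Config.set] <;> (try split) <;> simp
  | seq _ _ ih1 ih2 => omega
  | iteTrue _ _ ih => omega
  | iteFalse _ _ ih => omega
  | loopDone => omega
  | loopStep _ _ _ ih1 ih2 => omega

/-- Every field of a record that represents a tree again represents a tree, so pointers never lead
out of `h`. In the later memory `h'` the records allocated by queries are thus unreachable. -/
theorem reachable_lt {I : Inp} {h h' : Heap} {μ : ℕ → T} (hg : Good I h μ) (hx : XExt h h') {v : Val}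
    {t : T} (hv : Rep I.n h t v) {b : ℕ} (hb : Reachable h' v b) :
    b < h.next ∧ ∃ u, Rep I.n h u (.ptr b) := by
  have key : ∀ {u : T} {b : ℕ}, Rep I.n h u (.ptr b) → b < h.next := by
    intro u b hu
    cases u <;> simp only [Rep, reduceCtorEq, Val.ptr.injEq] at hu
    · obtain ⟨rfl, hu⟩ := hu; exact hu.trans_le hg.1
    · obtain ⟨a, rfl, _, hu, _⟩ := hu; exact hu
  induction hb with
  | root e => subst e; exact ⟨key hv, _, hv⟩
  | @step a b f _ hc ih =>
    obtain ⟨ha, u, hu⟩ := ih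
    rw [hx.2 a ha] at hc
    have := Rep.look hg hu f
    rw [loadVal, hc] at this
    exact ⟨key this, _, this⟩

theorem sizeAtMost_of_rep {I : Inp} {h h' : Heap} {μ : ℕ → T} (hg : Good I h μ) (hx : XExt h h')
    {v : Val} {t : T} (hv : Rep I.n h t v) {B : ℝ} (hB : (h.next : ℝ) ≤ B) : SizeAtMost h' v B :=
  ⟨Finset.range h.next, fun _ ha => Finset.mem_range.2 (reachable_lt hg hx hv ha).1, by simpa using hB⟩

end FunLang

namespace FunLang

/-! ### The program

Lists are chains of records with the head in field `0` and the tail in field `1`. An entry of a list of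
colour counts is a record with a pointer to the representative point of the colour in field `0`, the tail in
field `1` and the count in field `2`. -/

abbrev hd (e : Ex) : Ex := .get 0 e
abbrev tl (e : Ex) : Ex := .get 1 e
abbrev th (e : Ex) : Ex := .get 2 e
abbrev x0 : Ex := .var 0
abbrev x1 : Ex := .var 1
abbrev x2 : Ex := .var 2
abbrev x3 : Ex := .var 3
abbrev x4 : Ex := .var 4
abbrev x5 : Ex := .var 5
abbrev x6 : Ex := .var 6
abbrev x7 : Ex := .var 7
abbrev x8 : Ex := .var 8
abbrev x9 : Ex := .var 9
abbrev x10 : Ex := .var 10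
abbrev x11 : Ex := .var 11
abbrev cns (a b : Ex) : Ex := .mk a b .nil

def listEx (l : List Ex) : Ex := l.foldr cns .nil

abbrev fHalves : ℕ := 0
abbrev fMerge : ℕ := 1
abbrev fSort : ℕ := 2
abbrev fTree : ℕ := 3
abbrev fSearch (strict : Bool) : ℕ := if strict then 5 else 4
abbrev fRead : ℕ := 6
abbrev fReps : ℕ := 7
abbrev fNumber : ℕ := 8
abbrev fDrop : ℕ := 9
abbrev fPrep : ℕ := 10
abbrev fLen : ℕ := 11
abbrev fPows : ℕ := 12
abbrev fTake : ℕ := 13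
abbrev fBlocks : ℕ := 14
abbrev fPart : ℕ := 15
abbrev fShift : ℕ := 16
abbrev fSplit : ℕ := 17
abbrev fStruct : ℕ := 18
abbrev fDom : ℕ := 19
abbrev fVersions : ℕ := 20
abbrev fIns : ℕ := 21
abbrev fInsOuter : ℕ := 22
abbrev fInsBlock : ℕ := 23
abbrev fInsAll : ℕ := 24
abbrev fBag : ℕ := 25
abbrev fCount : ℕ := 26
abbrev fCollect : ℕ := 27
abbrev fBounds : ℕ := 28
abbrev fAsk : ℕ := 29
abbrev fWalk : ℕ := 30
abbrev fAskDom : ℕ := 31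
abbrev fAskIn : ℕ := 32
abbrev fAskOuter : ℕ := 33
abbrev fAskBlock : ℕ := 34
abbrev fApp : ℕ := 35
abbrev fEmit : ℕ := 36
abbrev fBuild : ℕ := 37
abbrev fQuery : ℕ := 38

/-- `halves l` -/
def cHalves : Code :=
  .ite (.isNil x0) (.ret (.mk .nil .nil .nil))
    (.call fHalves [tl x0] (.ret (.mk (cns (hd x0) (tl x1)) (hd x1) .nil)))

/-- `merge l l'` -/
def cMerge : Code :=
  .ite (.isNil x0) (.ret x1)
    (.ite (.isNil x1) (.ret x0)
      (.ite (.le (hd (hd (hd x0))) (hd (hd (hd x1))))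
        (.call fMerge [tl x0, x1] (.ret (cns (hd x0) x2)))
        (.call fMerge [x0, tl x1] (.ret (cns (hd x1) x2)))))

/-- `sort l` -/
def cSort : Code :=
  .ite (.isNil x0) (.ret x0)
    (.ite (.isNil (tl x0)) (.ret x0)
      (.call fHalves [x0] (.call fSort [hd x1] (.call fSort [tl x1]
        (.call fMerge [x2, x3] (.ret x4))))))

/-- `tree fuel l` -/
def cTree : Code :=
  .ite (.isNil x0) (.ret (.mk .nil x1 .nil))
    (.ite (.isNil x1) (.ret (.mk .nil .nil .nil))
      (.call fTree [tl x0, x1]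
        (.ite (.isNil (tl x2)) (.ret x2)
          (.call fTree [tl x0, tl (tl x2)]
            (.ret (.mk (.mk (hd (tl x2)) (hd x2) (hd x3)) (tl x3) .nil))))))

/-- `search t a default` -/
def cSearch (strict : Bool) : Code :=
  .ite (.isNil x0) (.ret x2)
    (if strict then
      .ite (.le x1 (hd (hd (hd x0))))
        (.call (fSearch true) [tl x0, x1, x2] (.ret x3))
        (.call (fSearch true) [th x0, x1, hd (tl (hd x0))] (.ret x3))
    else
      .ite (.le (hd (hd (hd x0))) x1)
        (.call (fSearch false) [th x0, x1, hd (tl (hd x0))] (.ret x3))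
        (.call (fSearch false) [tl x0, x1, x2] (.ret x3)))

def keysEx (d : ℕ) : Ex := listEx (.get d x0 :: (List.range d).map fun j => .get j x0)

/-- `read p` -/
def cRead (d : ℕ) : Code :=
  .ite (.isNil x0) (.ret .nil)
    (.call fRead [.get (d + 1) x0] (.ret (cns (.mk (keysEx d) .nil x0) x1)))

/-- `reps l c p` -/
def cReps : Code :=
  .ite (.isNil x0) (.ret .nil)
    (.ite (.le (hd (hd (hd x0))) x1)
      (.call fReps [tl x0, x1, x2] (.ret (cns (.mk (tl (hd (hd x0))) .nil x2) x3)))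
      (.call fReps [tl x0, hd (hd (hd x0)), th (hd x0)]
        (.ret (cns (.mk (tl (hd (hd x0))) .nil (th (hd x0))) x3))))

/-- `number l i` -/
def cNumber : Code :=
  .ite (.isNil x0) (.ret .nil)
    (.call fNumber [tl x0, .add x1 (.lit 1)]
      (.ret (cns (.mk (hd (hd x0)) (cns x1 (tl (hd x0))) (th (hd x0))) x2)))

/-- `drop l` -/
def cDrop : Code :=
  .ite (.isNil x0) (.ret .nil)
    (.call fDrop [tl x0] (.ret (cns (.mk (tl (hd (hd x0))) (tl (hd x0)) (th (hd x0))) x1)))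

/-- `prep l fuel` -/
def cPrep : Code :=
  .ite (.isNil (hd (hd x0))) (.ret (.mk x0 .nil .nil))
    (.call fSort [x0] (.call fNumber [x2, .lit 0] (.call fTree [x1, x3] (.call fDrop [x3]
      (.call fPrep [x5, x1] (.ret (.mk (hd x6) (cns (hd x4) (tl x6)) .nil)))))))

/-- `len l` -/
def cLen : Code :=
  .ite (.isNil x0) (.ret (.lit 0)) (.call fLen [tl x0] (.ret (.add x1 (.lit 1))))

/-- `pows w n l` -/
def cPows : Code :=
  .ite (.le x0 x1) (.call fPows [.add x0 x0, x1, cns x0 x2] (.ret x3)) (.ret x2)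

/-- `take l v s` -/
def cTake : Code :=
  .ite (.isNil x0) (.ret (.mk .nil .nil .nil))
    (.ite (.le x1 x2)
      (.call fTake [tl x0, .add x1 x1, x2] (.ret (.mk (cns (hd x0) (hd x3)) (tl x3) .nil)))
      (.ret (.mk .nil x0 .nil)))

/-- `blocks l s` -/
def cBlocks : Code :=
  .ite (.isNil x0) (.ret .nil)
    (.call fTake [x0, .lit 2, x1] (.call fBlocks [tl x2, x1] (.ret (cns (hd x2) x3))))

/-- `part l mid` -/
def cPart : Code :=
  .ite (.isNil x0) (.ret (.mk .nil .nil .nil))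
    (.call fPart [tl x0, x1]
      (.ite (.le x1 (hd (tl (hd x0))))
        (.ret (.mk (hd x2) (cns (hd x0) (tl x2)) .nil))
        (.ret (.mk (cns (hd x0) (hd x2)) (tl x2) .nil))))

/-- `shift l mid` -/
def cShift : Code :=
  .ite (.isNil x0) (.ret .nil)
    (.call fShift [tl x0, x1]
      (.ite (.le x1 (hd (tl (hd x0))))
        (.ret (cns (.mk (cns (.sub (hd (tl (hd x0))) x1) (hd (hd x0))) (tl (tl (hd x0)))
          (th (hd x0))) x2))
        (.ret (cns (.mk (cns (.sub (.sub x1 (hd (tl (hd x0)))) (.lit 1)) (hd (hd x0)))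
          (tl (tl (hd x0))) (th (hd x0))) x2))))

/-- `split l fuel lo ctx` -/
def cSplit : Code :=
  .ite (.isNil x0) (.ret .nil)
    (.ite (.isNil x1) (.ret .nil)
      (.bind (.add x2 (hd x1))
        (.call fPart [x0, x4]
          (.call fSplit [hd x5, tl x1, x2, x3]
            (.call fSplit [tl x5, tl x1, x4, x3]
              (.call fShift [hd x5, x4]
                (.call fShift [tl x5, x4]
                  (.call fStruct [x8, x3]
                    (.call fStruct [x9, x3]
                      (.ret (.mk x4 (.mk x6 x10 .nil) (.mk x7 x11 .nil))))))))))))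

/-- `struct l ctx` -/
def cStruct : Code :=
  .ite (.isNil x0) (.ret .nil)
    (.ite (.isNil (tl (hd x0))) (.call fDom [x0, x1] (.ret x2))
      (.call fSplit [x0, tl x1, .lit 0, x1] (.ret x2)))

/-- `dom l ctx` -/
def cDom : Code :=
  .call fSort [x0] (.call fVersions [x2, .nil, x1] (.call fTree [tl x1, x3] (.ret (hd x4))))

/-- `versions l t ctx` -/
def cVersions : Code :=
  .ite (.isNil x0) (.ret .nil)
    (.call fIns [x1, tl (hd (hd x0)), th (hd x0), x2]
      (.call fVersions [tl x0, x3, x2] (.ret (cns (.mk (hd (hd x0)) (cns x3 .nil) .nil) x4))))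

/-- `ins t keys p ctx` -/
def cIns : Code :=
  .ite (.isNil x1) (.call fBag [x0, x2] (.ret x4))
    (.call fInsOuter [x0, hd x3, hd x1, tl x1, x2, x3] (.ret x4))

/-- `insOuter t blocks k keys p ctx` -/
def cInsOuter : Code :=
  .ite (.isNil x1) (.ret x0)
    (.call fInsBlock [x0, hd x1, tl x1, x2, x3, x4, x5] (.ret x6))

/-- `insBlock t block blocks k keys p ctx` -/
def cInsBlock : Code :=
  .ite (.isNil x1)
    (.call fInsOuter [tl x0, x2, x3, x4, x5, x6] (.ret (.mk (hd x0) x7 .nil)))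
    (.ite (.le (hd x1) x3)
      (.call fInsBlock [tl x0, tl x1, x2, .sub x3 (hd x1), x4, x5, x6] (.ret (.mk (hd x0) x7 .nil)))
      (.call fInsBlock [hd x0, tl x1, x2, x3, x4, x5, x6]
        (.call fInsAll [tl x0, tl x1, x4, x5, x6] (.ret (.mk x7 x8 .nil)))))

/-- `insAll t block keys p ctx` -/
def cInsAll : Code :=
  .ite (.isNil x1) (.call fIns [hd x0, x2, x3, x4] (.ret (.mk x5 (tl x0) .nil)))
    (.call fInsAll [hd x0, tl x1, x2, x3, x4]
      (.call fInsAll [tl x0, tl x1, x2, x3, x4] (.ret (.mk x5 x6 .nil))))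

/-- `bag t p` -/
def cBag : Code :=
  .ite (.isNil x0) (.ret (.mk (.mk x1 .nil (.lit 1)) (.lit 1) (.lit 0)))
    (.ite (.le (.add (th x0) (.lit 1)) (tl x0))
      (.ret (.mk (.mk x1 (hd x0) (.lit 1)) (tl x0) (.add (th x0) (.lit 1))))
      (.call fCount [.mk x1 (hd x0) (.lit 1), .nil]
        (.call fCollect [x2, .nil] (.call fLen [x3] (.ret (.mk x3 x4 (.lit 0)))))))

/-- `count l touched` adds up the counts in the scratch fields. -/
def cCount (sc : ℕ) : Code :=
  .ite (.isNil x0) (.ret x1)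
    (.ite (.isNil (.get sc (hd x0)))
      (.setScratch (hd x0) (th x0) (.call fCount [tl x0, cns (hd x0) x1] (.ret x2)))
      (.setScratch (hd x0) (.add (.get sc (hd x0)) (th x0)) (.call fCount [tl x0, x1] (.ret x2))))

/-- `collect touched l` moves the counts from the scratch fields into a list. -/
def cCollect (sc : ℕ) : Code :=
  .ite (.isNil x0) (.ret x1)
    (.bind (.get sc (hd x0))
      (.setScratch (hd x0) .nil (.call fCollect [tl x0, .mk (hd x0) x1 x2] (.ret x3))))

/-- `bounds trees as bs l` -/
def cBounds : Code :=
  .ite (.isNil x0) (.ret x3)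
    (.call (fSearch true) [hd x0, hd x1, .lit (-1)]
      (.call (fSearch false) [hd x0, hd x2, .lit (-1)]
        (.call fBounds [tl x0, tl x1, tl x2, cns (cns x4 (.add x5 (.lit 1))) x3] (.ret x6))))

/-- `ask t bounds qs l ctx` -/
def cAsk : Code :=
  .ite (.isNil x1) (.call fAskDom [x0, x2, x3, x4] (.ret x5))
    (.call fWalk [x0, hd (hd x1), tl (hd x1), tl x1, x2, x3, x4] (.ret x5))

/-- `walk t lo hi bounds qs l ctx` -/
def cWalk : Code :=
  .ite (.isNil x0) (.ret x5)
    (.ite (.le x2 (hd x0)) (.call fWalk [hd (tl x0), x1, x2, x3, x4, x5, x6] (.ret x7))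
      (.ite (.le (hd x0) x1) (.call fWalk [hd (th x0), x1, x2, x3, x4, x5, x6] (.ret x7))
        (.call fAsk [tl (tl x0), x3, cns (.sub (.sub (hd x0) x1) (.lit 1)) x4, x5, x6]
          (.call fAsk [tl (th x0), x3, cns (.sub x2 (hd x0)) x4, x7, x6] (.ret x8)))))

/-- `askDom t qs l ctx` -/
def cAskDom : Code :=
  .call (fSearch false) [x0, .sub (hd x1) (.lit 1), .nil]
    (.call fAskIn [x4, tl x1, x2, x3] (.ret x5))

/-- `askIn t qs l ctx` -/
def cAskIn : Code :=
  .ite (.isNil x1) (.call fApp [hd x0, x2] (.ret x4))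
    (.call fAskOuter [x0, hd x3, hd x1, tl x1, x2, x3] (.ret x4))

/-- `askOuter t blocks q qs l ctx` -/
def cAskOuter : Code :=
  .ite (.isNil x1) (.ret x4)
    (.call fAskBlock [x0, hd x1, tl x1, x2, x3, x4, x5] (.ret x6))

/-- `askBlock t block blocks q qs l ctx` -/
def cAskBlock : Code :=
  .ite (.isNil x1)
    (.call fAskIn [hd x0, x4, x5, x6] (.call fAskOuter [tl x0, x2, x3, x4, x7, x6] (.ret x8)))
    (.ite (.le (hd x1) x3)
      (.call fAskBlock [tl x0, tl x1, x2, .sub x3 (hd x1), x4, x5, x6] (.ret x7))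
      (.call fAskBlock [hd x0, tl x1, x2, x3, x4, x5, x6] (.ret x7)))

/-- `app l l'` -/
def cApp : Code :=
  .ite (.isNil x0) (.ret x1) (.call fApp [tl x0, .mk (hd x0) x1 (th x0)] (.ret x2))

/-- `emit l` -/
def cEmit (d : ℕ) : Code :=
  .ite (.isNil x0) (.ret .nil)
    (.emit (.get d (hd x0)) (th x0) (.call fEmit [tl x0] (.ret .nil)))

/-- `build p s` -/
def cBuild : Code :=
  .call fRead [x0] (.call fSort [x2] (.call fReps [x3, .nil, .nil] (.call fLen [x4]
    (.call fPows [.lit 1, x5, cns (.lit 0) .nil] (.call fPows [.lit 1, x5, .nil]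
      (.call fBlocks [x7, x1] (.call fPrep [x4, x6] (.call fStruct [hd x9, cns x8 x6]
        (.ret (.mk (tl x9) x10 (cns x8 x6)))))))))))

/-- `query root a₁ … a_d b₁ … b_d` -/
def cQuery (d : ℕ) : Code :=
  .call fBounds [hd x0, listEx ((List.range d).map fun j => .var (j + 1)),
      listEx ((List.range d).map fun j => .var (j + 1 + d)), .nil]
    (.call fAsk [tl x0, .var (2 * d + 1), .nil, .nil, th x0]
      (.call fCount [.var (2 * d + 2), .nil] (.call fCollect [.var (2 * d + 3), .nil]
        (.call fEmit [.var (2 * d + 4)] (.ret .nil)))))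

def body (d : ℕ) : ℕ → Code
  | 0 => cHalves | 1 => cMerge | 2 => cSort | 3 => cTree | 4 => cSearch false | 5 => cSearch true
  | 6 => cRead d | 7 => cReps | 8 => cNumber | 9 => cDrop | 10 => cPrep | 11 => cLen | 12 => cPows
  | 13 => cTake | 14 => cBlocks | 15 => cPart | 16 => cShift | 17 => cSplit | 18 => cStruct
  | 19 => cDom | 20 => cVersions | 21 => cIns | 22 => cInsOuter | 23 => cInsBlock | 24 => cInsAll
  | 25 => cBag | 26 => cCount (d + 2) | 27 => cCollect (d + 2) | 28 => cBounds | 29 => cAsk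
  | 30 => cWalk | 31 => cAskDom | 32 => cAskIn | 33 => cAskOuter | 34 => cAskBlock | 35 => cApp
  | 36 => cEmit d | 37 => cBuild | _ => cQuery d

def arity (d : ℕ) (f : ℕ) : ℕ :=
  ([1, 2, 1, 2, 3, 3, 1, 3, 2, 1, 2, 1, 3, 3, 2, 2, 2, 4, 2, 2, 3, 4, 6, 7, 5, 2, 2, 2, 4, 5, 7, 4, 4,
    6, 7, 2, 1, 2] : List ℕ).getD f (2 * d + 1)

def prog (d : ℕ) : Prog := ⟨39, arity d, body d⟩

theorem listEx_wf {m : ℕ} {l : List Ex} (h : ∀ e ∈ l, e.WF m) : (listEx l).WF m := by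
  induction l with
  | nil => trivial
  | cons e l ih => exact ⟨h e (by simp), ih fun e' he => h e' (by simp [he]), trivial⟩

theorem prog_wf (d : ℕ) : ∀ f < (prog d).num, ((prog d).body f).WF (prog d) ((prog d).ar f) := by
  intro f hf
  have h1 : (listEx ((List.range d).map fun j => .var (j + 1))).WF (2 * d + 1) :=
    listEx_wf (by simp [Ex.WF]; omega)
  have h2 : (listEx ((List.range d).map fun j => .var (j + 1 + d))).WF (2 * d + 1) :=
    listEx_wf (by simp [Ex.WF]; omega)
  have hf' : f < 39 := hf
  have hk2 : (keysEx d).WF 2 := listEx_wf (by simp [Ex.WF])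
  interval_cases f
  all_goals
    simp [prog, body, arity, Code.WF, Cond.WF, Ex.WF, cHalves, cMerge, cSort, cTree, cSearch, cRead, cReps,
      cNumber, cDrop, cPrep, cLen, cPows, cTake, cBlocks, cPart, cShift, cSplit, cStruct, cDom, cVersions,
      cIns, cInsOuter, cInsBlock, cInsAll, cBag, cCount, cCollect, cBounds, cAsk, cWalk, cAskDom, cAskIn,
      cAskOuter, cAskBlock, cApp, cEmit, cBuild, cQuery, hk2, h1, h2,
      fHalves, fMerge, fSort, fTree, fSearch, fRead, fReps, fNumber, fDrop, fPrep, fLen, fPows, fTake, fBlocks, fPart, fShift, fSplit, fStruct, fDom, fVersions, fIns, fInsOuter, fInsBlock, fInsAll, fBag, fCount, fCollect, fBounds, fAsk, fWalk, fAskDom, fAskIn, fAskOuter, fAskBlock, fApp, fEmit]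

end FunLang

namespace FunLang

/-! ### Correctness of the list functions -/

attribute [simp] wp Cond.holds Ex.eval

@[simp] theorem look_node_zero (I : Inp) (μ : ℕ → T) (x y z : T) : I.look μ (.node x y z) 0 = x := rfl

@[simp] theorem look_node_one (I : Inp) (μ : ℕ → T) (x y z : T) : I.look μ (.node x y z) 1 = y := rfl

@[simp] theorem look_node_two (I : Inp) (μ : ℕ → T) (x y z : T) : I.look μ (.node x y z) 2 = z := rfl

@[simp] theorem look_nil (I : Inp) (μ : ℕ → T) (f : ℕ) : I.look μ .nil f = .nil := by
  cases f <;> rfl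

@[simp] theorem look_pt (I : Inp) (μ : ℕ → T) (a f : ℕ) : I.look μ (.pt a) f = I.field μ a f := rfl

/-- The list `l`, whose elements are encoded by `e`. -/
def encs {α : Type*} (e : α → T) : List α → T
  | [] => .nil
  | x :: l => .node (e x) (encs e l) .nil

@[simp] theorem encs_nil {α : Type*} (e : α → T) : encs e [] = .nil := rfl

@[simp] theorem encs_cons {α : Type*} (e : α → T) (x : α) (l : List α) :
    encs e (x :: l) = .node (e x) (encs e l) .nil := rfl

theorem encs_map {α β : Type*} (e : β → T) (f : α → β) (l : List α) :
    encs e (l.map f) = encs (fun x => e (f x)) l := by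
  induction l with
  | nil => rfl
  | cons x l ih => simp [ih]

theorem plus_int {W : ℕ} {a b : ℤ} (h : |a + b| ≤ W) : T.plus W (.int a) (.int b) = .int (a + b) :=
  if_pos h

theorem minus_int {W : ℕ} {a b : ℤ} (h : |a - b| ≤ W) : T.minus W (.int a) (.int b) = .int (a - b) :=
  if_pos h

variable {α : Type*} (I : Inp) (d : ℕ) (e : α → T)

/-- The two halves swap roles at each element, so the list is dealt out alternately and no length
has to be computed. -/
theorem halves_spec (l : List α) : ∃ l₁ l₂,
    Pu I (prog d) fHalves [encs e l] (.node (encs e l₁) (encs e l₂) .nil) (3 * l.length + 2) ∧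
      (l₁ ++ l₂).Perm l ∧ l₁.length = (l.length + 1) / 2 ∧ l₂.length = l.length / 2 := by
  induction l with
  | nil =>
    refine ⟨[], [], fun o => ev_of_wp ?_, by simp, by simp, by simp⟩
    change wp I (prog d) cHalves _ _ _
    simp [cHalves]
  | cons x l ih =>
    obtain ⟨l₁, l₂, h, hp, h1, h2⟩ := ih
    refine ⟨x :: l₂, l₁, fun o => ev_of_wp ?_, ?_, ?_, ?_⟩
    · change wp I (prog d) cHalves _ _ _
      simp [cHalves]
      refine ⟨_, _, _, h o, ?_⟩
      simp
      omega
    · exact (List.perm_append_comm.trans hp).cons x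
    · simp; omega
    · simp; omega

theorem T.le_trans {a b c : T} (h : a.le b) (h' : b.le c) : a.le c := by
  cases a <;> cases b <;> simp only [T.le] at h <;> cases c <;> simp only [T.le] at h' ⊢ <;>
    exact _root_.le_trans h h'

variable {I e} {key : α → T} (hkey : ∀ μ x, I.look μ (I.look μ (e x) 0) 0 = key x)
include hkey

/-- `T.le` is total only among values of one kind, whence the hypothesis that keys of the two lists
are comparable. -/
theorem merge_spec (l₁ : List α) : ∀ l₂ : List α,
    l₁.Pairwise (fun x y => (key x).le (key y)) → l₂.Pairwise (fun x y => (key x).le (key y)) →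
    (∀ x ∈ l₁, ∀ y ∈ l₂, (key x).le (key y) ∨ (key y).le (key x)) → ∃ l : List α,
    Pu I (prog d) fMerge [encs e l₁, encs e l₂] (encs e l) (5 * (l₁.length + l₂.length) + 3) ∧
      l.Perm (l₁ ++ l₂) ∧ l.Pairwise (fun x y => (key x).le (key y)) := by
  induction l₁ with
  | nil =>
    intro l₂ _ h2 _
    refine ⟨l₂, fun o => ev_of_wp ?_, by simp, h2⟩
    change wp I (prog d) cMerge _ _ _
    simp [cMerge]
  | cons x l₁ ih₁ =>
    intro l₂
    induction l₂ with
    | nil =>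
      intro h1 _ _
      refine ⟨x :: l₁, fun o => ev_of_wp ?_, by simp, h1⟩
      change wp I (prog d) cMerge _ _ _
      simp [cMerge]
    | cons y l₂ ih₂ =>
      intro h1 h2 htot
      rw [List.pairwise_cons] at h1 h2
      by_cases hxy : (key x).le (key y)
      · obtain ⟨l, h, hp, hs⟩ := ih₁ (y :: l₂) h1.2 (List.pairwise_cons.2 h2)
          (fun a ha b hb => htot a (by simp [ha]) b hb)
        refine ⟨x :: l, fun o => ev_of_wp ?_, by simpa using hp.cons x, ?_⟩
        · change wp I (prog d) cMerge _ _ _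
          simp [cMerge, hkey, hxy]
          refine ⟨_, _, _, h o, ?_⟩
          simp
          omega
        · refine List.pairwise_cons.2 ⟨fun z hz => ?_, hs⟩
          have hz' := hp.mem_iff.1 hz
          simp only [List.mem_append, List.mem_cons] at hz'
          rcases hz' with hz' | rfl | hz'
          · exact h1.1 z hz'
          · exact hxy
          · exact T.le_trans hxy (h2.1 z hz')
      · obtain ⟨l, h, hp, hs⟩ := ih₂ (List.pairwise_cons.2 h1) h2.2
          (fun a ha b hb => htot a ha b (by simp [hb]))
        have hyx : (key y).le (key x) := (htot x (by simp) y (by simp)).resolve_left hxy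
        refine ⟨y :: l, fun o => ev_of_wp ?_, ?_, ?_⟩
        · change wp I (prog d) cMerge _ _ _
          simp [cMerge, hkey, hxy]
          simp at h
          refine ⟨_, _, _, h o, ?_⟩
          simp
          omega
        · exact (hp.cons y).trans (List.perm_middle (l₁ := x :: l₁)).symm
        · refine List.pairwise_cons.2 ⟨fun z hz => ?_, hs⟩
          have hz' := hp.mem_iff.1 hz
          simp only [List.mem_append, List.mem_cons] at hz'
          rcases hz' with (rfl | hz') | hz'
          · exact hyx
          · exact T.le_trans hyx (h1.1 z hz')
          · exact h2.1 z hz'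

/-- Merge sort with recursion depth at most `h`; each level of the recursion is charged `20` per
element. -/
theorem sort_spec (h : ℕ) : ∀ l : List α, l.length ≤ 2 ^ h →
    (∀ x ∈ l, ∀ y ∈ l, (key x).le (key y) ∨ (key y).le (key x)) → ∃ l' : List α,
    Pu I (prog d) fSort [encs e l] (encs e l') (20 * l.length * (h + 1) + 3) ∧
      l'.Perm l ∧ l'.Pairwise (fun x y => (key x).le (key y)) := by
  induction h with
  | zero =>
    intro l hl _
    refine ⟨l, fun o => ev_of_wp ?_, .refl _, ?_⟩
    · change wp I (prog d) cSort _ _ _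
      match l, hl with
      | [], _ => simp [cSort]
      | [x], _ => simp [cSort]
    · match l, hl with
      | [], _ => simp
      | [x], _ => simp
  | succ h ih =>
    intro l hl htot
    match l, hl, htot with
    | [], _, _ =>
      refine ⟨[], fun o => ev_of_wp ?_, .refl _, by simp⟩
      change wp I (prog d) cSort _ _ _
      simp [cSort]
    | [x], _, _ =>
      refine ⟨[x], fun o => ev_of_wp ?_, .refl _, by simp⟩
      change wp I (prog d) cSort _ _ _
      simp [cSort]
    | x :: y :: l, hl, htot =>
      obtain ⟨l₁, l₂, hh, hp, h1, h2⟩ := halves_spec I d e (x :: y :: l)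
      have m1 : ∀ z ∈ l₁, z ∈ x :: y :: l := fun z hz => hp.mem_iff.1 (List.mem_append_left _ hz)
      have m2 : ∀ z ∈ l₂, z ∈ x :: y :: l := fun z hz => hp.mem_iff.1 (List.mem_append_right _ hz)
      obtain ⟨s₁, r1, p1, q1⟩ := ih l₁ (by rw [pow_succ] at hl; omega)
        (fun a ha b hb => htot a (m1 a ha) b (m1 b hb))
      obtain ⟨s₂, r2, p2, q2⟩ := ih l₂ (by rw [pow_succ] at hl; omega)
        (fun a ha b hb => htot a (m2 a ha) b (m2 b hb))
      obtain ⟨l', r3, p3, q3⟩ := merge_spec d hkey s₁ s₂ q1 q2 (fun a ha b hb =>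
        htot a (m1 a (p1.mem_iff.1 ha)) b (m2 b (p2.mem_iff.1 hb)))
      refine ⟨l', fun o => ev_of_wp ?_, (p3.trans (p1.append p2)).trans hp, q3⟩
      change wp I (prog d) cSort _ _ _
      simp [cSort]
      simp only [encs_cons] at hh
      refine ⟨_, _, _, hh o, ?_⟩
      simp
      refine ⟨_, _, _, r1 o, ?_⟩
      refine ⟨_, _, _, r2 o, ?_⟩
      refine ⟨_, _, _, r3 o, ?_⟩
      simp
      intro k₁ hk₁ k₂ hk₂ k₃ hk₃ k₄ hk₄
      rw [p1.length_eq, p2.length_eq] at hk₁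
      have hlen : l₁.length + l₂.length = l.length + 2 := by simpa using hp.length_eq
      have e1 : 20 * l₁.length * (h + 1) + 20 * l₂.length * (h + 1)
          = 20 * (l.length + 2) * (h + 1) := by rw [← hlen]; ring
      have e2 : 20 * (l.length + 1 + 1) * (h + 1 + 1)
          = 20 * (l.length + 2) * (h + 1) + 20 * (l.length + 2) := by ring
      simp only [List.length_cons] at h1 h2
      omega

end FunLang

namespace FunLang

/-! ### Search trees -/

/-- The tree `t` of height at most `h` lists the elements of `l` in order. -/
inductive Bst {α : Type*} (e : α → T) : ℕ → T → List α → Prop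
  | nil (h : ℕ) : Bst e h .nil []
  | node {h : ℕ} {t₁ t₂ : T} {l₁ l₂ : List α} (x : α) :
      Bst e h t₁ l₁ → Bst e h t₂ l₂ → Bst e (h + 1) (.node (e x) t₁ t₂) (l₁ ++ x :: l₂)

theorem Bst.succ {α : Type*} {e : α → T} {h : ℕ} {t : T} {l : List α} (hb : Bst e h t l) :
    Bst e (h + 1) t l := by
  induction hb with
  | nil h => exact .nil _
  | node x _ _ ih1 ih2 => exact .node x ih1 ih2

/-- The list `fuel` serves as a unary height. With height `h` the call consumes `2 ^ h - 1` elements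
unless the list ends earlier, and it returns the rest, so the tree is built in one pass. Unused
height is charged only if the list runs out; otherwise the consumed elements pay for everything. -/
theorem tree_spec {α β : Type*} (I : Inp) (d : ℕ) (e : α → T) (e' : β → T) (fuel : List β) :
    ∀ l : List α, ∃ t l₁ l₂, Pu I (prog d) fTree [encs e' fuel, encs e l] (.node t (encs e l₂) .nil)
        (10 * l₁.length + 3 + 5 * (if l₂ = [] then fuel.length else 0)) ∧
      l = l₁ ++ l₂ ∧ Bst e fuel.length t l₁ ∧ (l₂ ≠ [] → l₁.length + 1 = 2 ^ fuel.length) := by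
  induction fuel with
  | nil =>
    intro l
    refine ⟨.nil, [], l, fun o => ev_of_wp ?_, rfl, .nil _, by simp⟩
    change wp I (prog d) cTree _ _ _
    simp [cTree]
  | cons w fuel ih =>
    intro l
    cases l with
    | nil =>
      refine ⟨.nil, [], [], fun o => ev_of_wp ?_, rfl, .nil _, by simp⟩
      change wp I (prog d) cTree _ _ _
      simp [cTree]
    | cons x l =>
      obtain ⟨t, l₁, l₂, h1, hl, hb, hn⟩ := ih (x :: l)
      cases l₂ with
      | nil =>
        refine ⟨t, l₁, [], fun o => ev_of_wp ?_, hl, ?_, by simp⟩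
        · change wp I (prog d) cTree _ _ _
          simp [cTree]
          refine ⟨_, _, _, h1 o, ?_⟩
          simp
          omega
        · exact hb.succ
      | cons y l₂ =>
        obtain ⟨t', l₃, l₄, h2, hl', hb', hn'⟩ := ih l₂
        refine ⟨.node (e y) t t', l₁ ++ y :: l₃, l₄, fun o => ev_of_wp ?_, ?_, .node y hb hb', ?_⟩
        · change wp I (prog d) cTree _ _ _
          simp [cTree]
          refine ⟨_, _, _, h1 o, ?_⟩
          simp
          refine ⟨_, _, _, h2 o, ?_⟩
          simp
          intro k₁ hk₁ k₂ hk₂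
          split_ifs at hk₁ ⊢ <;> omega
        · rw [hl, hl']; simp
        · intro h
          have a1 := hn (by simp)
          have a2 := hn' h
          simp only [List.length_append, List.length_cons, pow_succ]
          omega

/-- The predicate `p` holds on an initial segment. The fold that forgets its accumulator picks the
payload of the last element with `p`, or the default if there is none. A step to the right replaces
the default by the payload of the node. -/
theorem search_spec {α : Type*} (I : Inp) (d : ℕ) {e : α → T} {key pay : α → T}
    (hkey : ∀ μ x, I.look μ (I.look μ (e x) 0) 0 = key x)
    (hpay : ∀ μ x, I.look μ (I.look μ (e x) 1) 0 = pay x) (strict : Bool) (a : T) (p : α → Prop)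
    [DecidablePred p]
    (hp : ∀ x, p x ↔ if strict then ¬ a.le (key x) else (key x).le a) {h : ℕ} {t : T} {l : List α}
    (hb : Bst e h t l) : l.Pairwise (fun x y => p y → p x) → ∀ acc,
      Pu I (prog d) (fSearch strict) [t, a, acc] ((l.filter p).foldl (fun _ x => pay x) acc)
        (4 * h + 2) := by
  induction hb with
  | nil h =>
    intro _ acc o
    refine ev_of_wp ?_
    cases strict
    · change wp I (prog d) (cSearch false) _ _ _
      simp [cSearch]
    · change wp I (prog d) (cSearch true) _ _ _
      simp [cSearch]
  | @node h t₁ t₂ l₁ l₂ x _ _ ih1 ih2 =>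
    intro hs acc o
    rw [List.pairwise_append, List.pairwise_cons] at hs
    obtain ⟨hs1, ⟨hx2, hs2⟩, hx1⟩ := hs
    refine ev_of_wp ?_
    by_cases hpx : p x
    · have e1 : (l₁ ++ x :: l₂).filter p = l₁ ++ x :: l₂.filter p := by
        rw [List.filter_append, List.filter_cons_of_pos (by simpa using hpx), List.filter_eq_self.2]
        intro a ha
        simpa using hx1 a ha x (by simp) hpx
      rw [e1, List.foldl_append, List.foldl_cons]
      have hpx' := (hp x).1 hpx
      have := ih2 hs2 (pay x) o
      cases strict
      · simp at hpx'
        change wp I (prog d) (cSearch false) _ _ _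
        simp [cSearch, hkey, hpay, hpx']
        exact ⟨_, _, _, this, by simp; omega⟩
      · simp at hpx'
        change wp I (prog d) (cSearch true) _ _ _
        simp [cSearch, hkey, hpay, hpx']
        exact ⟨_, _, _, this, by simp; omega⟩
    · have e1 : (l₁ ++ x :: l₂).filter p = l₁.filter p := by
        have e2 : l₂.filter p = [] :=
          List.filter_eq_nil_iff.2 fun a ha => by simpa using mt (hx2 a ha) hpx
        rw [List.filter_append, List.filter_cons_of_neg (by simpa using hpx), e2, List.append_nil]
      rw [e1]
      have hpx' := mt (hp x).2 hpx
      have := ih1 hs1 acc o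
      cases strict
      · simp at hpx'
        change wp I (prog d) (cSearch false) _ _ _
        simp [cSearch, hkey, hpay, hpx']
        exact ⟨_, _, _, this, by simp; omega⟩
      · simp at hpx'
        change wp I (prog d) (cSearch true) _ _ _
        simp [cSearch, hkey, hpay, hpx']
        exact ⟨_, _, _, this, by simp; omega⟩

/-! ### Lists of counts -/

def encE : List (ℕ × ℤ) → T
  | [] => .nil
  | (a, m) :: l => .node (.pt a) (encE l) (.int m)

@[simp] theorem encE_nil : encE [] = .nil := rfl

@[simp] theorem encE_cons (x : ℕ × ℤ) (l : List (ℕ × ℤ)) :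
    encE (x :: l) = .node (.pt x.1) (encE l) (.int x.2) := rfl

/-- The sum of the counts of `a`. -/
def tot (l : List (ℕ × ℤ)) (a : ℕ) : ℤ := (l.map fun x => if x.1 = a then x.2 else 0).sum

@[simp] theorem tot_nil (a : ℕ) : tot [] a = 0 := rfl

theorem tot_cons (x : ℕ × ℤ) (l : List (ℕ × ℤ)) (a : ℕ) :
    tot (x :: l) a = (if x.1 = a then x.2 else 0) + tot l a := by
  simp [tot]

theorem tot_append (l l' : List (ℕ × ℤ)) (a : ℕ) : tot (l ++ l') a = tot l a + tot l' a := by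
  simp [tot]

theorem tot_reverse (l : List (ℕ × ℤ)) (a : ℕ) : tot l.reverse a = tot l a := by
  simp [tot, List.sum_reverse]

theorem tot_nonneg {l : List (ℕ × ℤ)} (hl : ∀ x ∈ l, 0 < x.2) (a : ℕ) : 0 ≤ tot l a := by
  induction l with
  | nil => simp
  | cons x l ih =>
    rw [tot_cons]
    have h1 := ih fun y hy => hl y (by simp [hy])
    have h2 := hl x (by simp)
    split_ifs <;> omega

/-- The scratch fields that hold the counts `c`. -/
noncomputable def memOf (c : ℕ → ℤ) (a : ℕ) : T := if c a = 0 then .nil else .int (c a)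

theorem memOf_zero : (memOf fun _ => 0) = fun _ => .nil := by
  funext a; simp [memOf]

section

variable (I : Inp) (d : ℕ)

theorem len_spec {α : Type*} (e : α → T) (l : List α) (hW : l.length ≤ I.W) :
    Pu I (prog d) fLen [encs e l] (.int l.length) (3 * l.length + 2) := by
  induction l with
  | nil =>
    intro o
    refine ev_of_wp ?_
    change wp I (prog d) cLen _ _ _
    simp [cLen]
  | cons x l ih =>
    intro o
    simp only [List.length_cons] at hW
    refine ev_of_wp ?_
    change wp I (prog d) cLen _ _ _
    simp [cLen]
    refine ⟨_, _, _, ih (by omega) o, ?_⟩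
    have : |((l.length : ℤ) + 1)| ≤ I.W := by rw [abs_of_nonneg (by positivity)]; exact_mod_cast hW
    simp [plus_int this]
    omega

theorem lenE_spec (l : List (ℕ × ℤ)) (hW : l.length ≤ I.W) :
    Pu I (prog d) fLen [encE l] (.int l.length) (3 * l.length + 2) := by
  induction l with
  | nil =>
    intro o
    refine ev_of_wp ?_
    change wp I (prog d) cLen _ _ _
    simp [cLen]
  | cons x l ih =>
    intro o
    simp only [List.length_cons] at hW
    refine ev_of_wp ?_
    change wp I (prog d) cLen _ _ _
    simp [cLen]
    refine ⟨_, _, _, ih (by omega) o, ?_⟩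
    have : |((l.length : ℤ) + 1)| ≤ I.W := by rw [abs_of_nonneg (by positivity)]; exact_mod_cast hW
    simp [plus_int this]
    omega

theorem app_spec (l : List (ℕ × ℤ)) : ∀ l' : List (ℕ × ℤ),
    Pu I (prog d) fApp [encE l, encE l'] (encE (l.reverse ++ l')) (3 * l.length + 2) := by
  induction l with
  | nil =>
    intro l' o
    refine ev_of_wp ?_
    change wp I (prog d) cApp _ _ _
    simp [cApp]
  | cons x l ih =>
    intro l' o
    refine ev_of_wp ?_
    change wp I (prog d) cApp _ _ _
    have := ih (x :: l') o
    simp at this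
    simp [cApp]
    refine ⟨_, _, _, this, ?_⟩
    simp
    omega

variable {I d} (hsc : I.sc = d + 2)
include hsc

/-- Invariant: the scratch fields hold `c`, with zero stored as `nil`, and `ts` lists the support of
`c` without repetition. Counts are positive, so a field once touched never returns to zero and
`isNil` detects exactly the first visit. -/
theorem count_spec (l : List (ℕ × ℤ)) : ∀ (ts : List ℕ) (c : ℕ → ℤ), (∀ x ∈ l, 0 < x.2) →
    (∀ a, 0 ≤ c a) → (∀ a, c a + tot l a ≤ I.W) → ts.Nodup → (∀ a, a ∈ ts ↔ c a ≠ 0) →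
    ∃ ts' : List ℕ, ts'.Nodup ∧ (∀ a, a ∈ ts' ↔ c a + tot l a ≠ 0) ∧
      ts'.length ≤ ts.length + l.length ∧ ∀ o,
      Ev I (prog d) fCount [encE l, encs T.pt ts] ⟨memOf c, o⟩ (encs T.pt ts')
        ⟨memOf fun a => c a + tot l a, o⟩ (5 * l.length + 2) := by
  induction l with
  | nil =>
    intro ts c _ _ _ hn ht
    refine ⟨ts, hn, by simpa using ht, by simp, fun o => ev_of_wp ?_⟩
    change wp I (prog d) (cCount (d + 2)) _ _ _
    simp [cCount]
  | cons x l ih =>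
    intro ts c hl hc hW hn ht
    obtain ⟨b, m⟩ := x
    have hm : 0 < m := hl (b, m) (by simp)
    have hl' : ∀ x ∈ l, 0 < x.2 := fun x hx => hl x (by simp [hx])
    set c' : ℕ → ℤ := Function.update c b (c b + m) with hc'
    have e1 : ∀ a, c' a + tot l a = c a + tot ((b, m) :: l) a := by
      intro a
      rw [tot_cons, hc']
      by_cases h : b = a
      · subst h; simp; ring
      · simp [h, Function.update_of_ne (Ne.symm h)]
    have e2 : memOf c' = Function.update (memOf c) b (.int (c b + m)) := by
      funext a
      by_cases h : a = b
      · subst h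
        have := hc a
        have h0 : c a + m ≠ 0 := by omega
        simp [memOf, hc', h0]
      · simp [memOf, hc', h]
    have hc0 : ∀ a, 0 ≤ c' a := by
      intro a
      by_cases h : a = b
      · subst h; have := hc a; simp [hc']; omega
      · simp [hc', h, hc a]
    have hmem : I.field (memOf c) b (d + 2) = memOf c b := by simp [Inp.field, hsc]
    by_cases hb : c b = 0
    · have hbt : b ∉ ts := fun h => (ht b).1 h hb
      obtain ⟨ts', h1, h2, h3, h4⟩ := ih (b :: ts) c' hl' hc0 (fun a => by rw [e1]; exact hW a)
        (List.nodup_cons.2 ⟨hbt, hn⟩) (by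
          intro a
          by_cases h : a = b
          · subst h; simp [hc', hb]; omega
          · simp [hc', h, ht a])
      refine ⟨ts', h1, fun a => by rw [h2, e1], by simp at h3 ⊢; omega, fun o => ev_of_wp ?_⟩
      change wp I (prog d) (cCount (d + 2)) _ _ _
      have h4 := h4 o
      simp only [e1, e2, hb, zero_add] at h4
      have hnil : memOf c b = .nil := by simp [memOf, hb]
      simp [cCount, hmem, hnil]
      exact ⟨_, _, _, h4, by simp; omega⟩
    · obtain ⟨ts', h1, h2, h3, h4⟩ := ih ts c' hl' hc0 (fun a => by rw [e1]; exact hW a) hn (by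
          intro a
          by_cases h : a = b
          · subst h; have := hc a; simp [hc', ht, hb]; omega
          · simp [hc', h, ht a])
      refine ⟨ts', h1, fun a => by rw [h2, e1], by simp at h3 ⊢; omega, fun o => ev_of_wp ?_⟩
      change wp I (prog d) (cCount (d + 2)) _ _ _
      have h4 := h4 o
      simp only [e1, e2] at h4
      have hint : memOf c b = .int (c b) := by simp [memOf, hb]
      have hbd : |c b + m| ≤ I.W := by
        have h5 := hW b
        have h6 := tot_nonneg hl' b
        rw [tot_cons] at h5
        have := hc b
        simp only [if_true] at h5
        rw [abs_of_nonneg (by omega)]; omega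
      simp [cCount, hmem, hint, plus_int hbd]
      exact ⟨_, _, _, h4, by simp; omega⟩

/-- Each touched field is cleared as it is read, so all scratch fields are empty at the end.
Counting followed by collecting thus acts like a pure function. -/
theorem collect_spec (ts : List ℕ) : ∀ (l : List (ℕ × ℤ)) (c : ℕ → ℤ), ts.Nodup →
    (∀ a, a ∈ ts ↔ c a ≠ 0) → ∀ o,
      Ev I (prog d) fCollect [encs T.pt ts, encE l] ⟨memOf c, o⟩
        (encE ((ts.map fun a => (a, c a)).reverse ++ l)) ⟨fun _ => .nil, o⟩ (5 * ts.length + 2) := by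
  induction ts with
  | nil =>
    intro l c _ ht o
    have : memOf c = fun _ => .nil := by
      funext a
      have := ht a
      simp at this
      simp [memOf, this]
    refine ev_of_wp ?_
    change wp I (prog d) (cCollect (d + 2)) _ _ _
    simp [cCollect, this]
  | cons b ts ih =>
    intro l c hn ht o
    rw [List.nodup_cons] at hn
    have hb : c b ≠ 0 := (ht b).1 (by simp)
    have h := ih ((b, c b) :: l) (Function.update c b 0) hn.2 (by
      intro a
      by_cases h : a = b
      · subst h; simp [hn.1]
      · have := ht a; simp [h] at this; simp [h, this]) o
    have e1 : memOf (Function.update c b 0) = Function.update (memOf c) b .nil := by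
      funext a
      by_cases h : a = b
      · subst h; simp [memOf]
      · simp [memOf, h]
    have e2 : (ts.map fun a => (a, Function.update c b 0 a)) = ts.map fun a => (a, c a) :=
      List.map_congr_left fun a ha => by
        rw [Function.update_of_ne]; rintro rfl; exact hn.1 ha
    rw [e1, e2] at h
    have hint : memOf c b = .int (c b) := by simp [memOf, hb]
    refine ev_of_wp ?_
    change wp I (prog d) (cCollect (d + 2)) _ _ _
    simp [cCollect, Inp.field, hsc, hint]
    simp at h
    exact ⟨_, _, _, h, by simp; omega⟩

/-- Adding up the counts of each point. -/
theorem aggregate_spec (l : List (ℕ × ℤ)) (hl : ∀ x ∈ l, 0 < x.2) (hW : ∀ a, tot l a ≤ I.W) :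
    ∃ (ts : List ℕ) (es : List (ℕ × ℤ)),
      (∀ o, Ev I (prog d) fCount [encE l, .nil] ⟨fun _ => .nil, o⟩ (encs T.pt ts) ⟨memOf (tot l), o⟩
        (5 * l.length + 2)) ∧
      (∀ o, Ev I (prog d) fCollect [encs T.pt ts, .nil] ⟨memOf (tot l), o⟩ (encE es)
        ⟨fun _ => .nil, o⟩ (5 * l.length + 2)) ∧
      es.Nodup ∧ (es.map Prod.fst).Nodup ∧ (∀ x, x ∈ es ↔ x.2 = tot l x.1 ∧ 0 < x.2) ∧
      (∀ a, tot es a = tot l a) ∧ es.length ≤ l.length := by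
  obtain ⟨ts, h1, h2, h3, h4⟩ := count_spec hsc l [] (fun _ => 0) hl (by simp) (by simpa using hW)
    List.nodup_nil (by simp)
  simp only [zero_add] at h2 h4
  rw [memOf_zero] at h4
  have h5 := collect_spec hsc ts [] (tot l) h1 h2
  have e1 : (((ts.map fun a => (a, tot l a)).reverse ++ []).map Prod.fst) = ts.reverse := by
    simp [Function.comp_def]
  have hmem : ∀ x, x ∈ ((ts.map fun a => (a, tot l a)).reverse ++ []) ↔
      x.2 = tot l x.1 ∧ 0 < x.2 := by
    rintro ⟨a, m⟩
    simp only [List.append_nil, List.mem_reverse, List.mem_map, Prod.mk.injEq, h2]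
    have := tot_nonneg hl a
    constructor
    · rintro ⟨b, hb, rfl, rfl⟩; exact ⟨rfl, by omega⟩
    · rintro ⟨rfl, h⟩; exact ⟨a, by omega, rfl, rfl⟩
  have hnd : (((ts.map fun a => (a, tot l a)).reverse ++ []).map Prod.fst).Nodup := by
    rw [e1]; exact List.nodup_reverse.2 h1
  refine ⟨ts, _, h4, fun o => (h5 o).mono (by simp at h3; omega), ?_, hnd, hmem, fun a => ?_,
    by simpa using h3⟩
  · exact List.Nodup.of_map _ hnd
  · rw [List.append_nil, tot_reverse]
    -- Each point of nonzero total occurs exactly once in `ts`, so at most one term of the sum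
    -- survives.
    have h6 : tot l a = 0 ∨ a ∈ ts := by
      rw [h2]; exact eq_or_ne _ _
    clear h4 h5 e1 hmem hnd h3 h2
    simp only [tot, List.map_map, Function.comp_def]
    induction ts with
    | nil =>
      rcases h6 with h6 | h6
      · simpa [tot] using h6.symm
      · simp at h6
    | cons b ts ih =>
      rw [List.nodup_cons] at h1
      simp only [List.map_cons, List.sum_cons]
      by_cases hba : b = a
      · subst hba
        have : (ts.map fun x => if x = b then
            (l.map fun x_1 => if x_1.1 = x then x_1.2 else 0).sum else 0).sum = 0 := by
          refine List.sum_eq_zero fun z hz => ?_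
          obtain ⟨y, hy, rfl⟩ := List.mem_map.1 hz
          rw [if_neg]; rintro rfl; exact h1.1 hy
        simp [this]
      · rw [if_neg hba, zero_add]
        exact ih h1.2 (by simpa [Ne.symm hba] using h6)

theorem emit_spec (κ : ℕ → ℕ) (es : List (ℕ × ℤ)) (hκ : ∀ x ∈ es, I.cell x.1 d = .col (κ x.1)) :
    ∀ o, Ev I (prog d) fEmit [encE es] ⟨fun _ => .nil, o⟩ .nil
      ⟨fun _ => .nil, (es.map fun x => (κ x.1, x.2)).reverse ++ o⟩ (4 * es.length + 2) := by
  induction es with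
  | nil =>
    intro o
    refine ev_of_wp ?_
    change wp I (prog d) (cEmit d) _ _ _
    simp [cEmit]
  | cons x es ih =>
    intro o
    have h1 := ih (fun y hy => hκ y (by simp [hy])) ((κ x.1, x.2) :: o)
    have h2 := hκ x (by simp)
    have h3 : d ≠ I.sc := by omega
    refine ev_of_wp ?_
    change wp I (prog d) (cEmit d) _ _ _
    simp [cEmit, Inp.field, h3, h2]
    exact ⟨_, _, _, h1, by simp; omega⟩

end

end FunLang

namespace FunLang

/-! ### The persistent dominance structure -/

open Classical

/-- A point in the dominance structure: its remaining keys and the representative of its colour. -/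
abbrev X : Type := List ℤ × ℕ

/-- The representatives of the points dominated by `qs`. -/
noncomputable def ans (qs : List ℤ) (M : Multiset X) : Multiset ℕ :=
  (M.filter fun p => List.Forall₂ (· < ·) p.1 qs).map Prod.snd

theorem ans_add (qs : List ℤ) (M M' : Multiset X) : ans qs (M + M') = ans qs M + ans qs M' := by
  simp [ans]

@[simp] theorem ans_zero (qs : List ℤ) : ans qs 0 = 0 := by simp [ans]

/-- The list `es` of positive counts describes the multiset `M` with at most `L` entries per colour. -/
def Ent (L : ℕ) (es : List (ℕ × ℤ)) (M : Multiset ℕ) : Prop :=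
  (∀ x ∈ es, 0 < x.2) ∧ (∀ a, tot es a = M.count a) ∧ es.length ≤ L * M.toFinset.card

theorem Ent.nil (L : ℕ) : Ent L [] 0 := ⟨by simp, by simp, by simp⟩

/-- Both colour sets lie in that of the union, so the lengths may be measured against the larger set
and the factors add. In this way the length of a query answer stays proportional to the number of
reported colours. -/
theorem Ent.append {L L' : ℕ} {es es' : List (ℕ × ℤ)} {M M' : Multiset ℕ} (h : Ent L es M)
    (h' : Ent L' es' M') : Ent (L + L') (es ++ es') (M + M') := by
  refine ⟨fun x hx => ?_, fun a => ?_, ?_⟩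
  · rcases List.mem_append.1 hx with hx | hx
    · exact h.1 x hx
    · exact h'.1 x hx
  · rw [tot_append, h.2.1, h'.2.1]; push_cast [Multiset.count_add]; rfl
  · have h1 : M.toFinset.card ≤ (M + M').toFinset.card :=
      Finset.card_le_card (by simp)
    have h2 : M'.toFinset.card ≤ (M + M').toFinset.card :=
      Finset.card_le_card (by simp)
    rw [List.length_append, add_mul]
    exact add_le_add (h.2.2.trans (Nat.mul_le_mul_left _ h1)) (h'.2.2.trans (Nat.mul_le_mul_left _ h2))

theorem Ent.reverse {L : ℕ} {es : List (ℕ × ℤ)} {M : Multiset ℕ} (h : Ent L es M) :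
    Ent L es.reverse M :=
  ⟨fun x hx => h.1 x (by simpa using hx), fun a => by rw [tot_reverse, h.2.1], by simpa using h.2.2⟩

abbrev noMem : ℕ → T := fun _ => .nil

/-- The tree `t` is a bag with contents `M` and potential `φ`. -/
def Bag (t : T) (M : Multiset ℕ) (φ : ℕ) : Prop :=
  (t = .nil ∧ M = 0 ∧ φ = 0) ∨
  ∃ (es : List (ℕ × ℤ)) (b p : ℕ), t = .node (encE es) (.int b) (.int p) ∧ es.length = b + p ∧ p ≤ b ∧
    b ≤ M.toFinset.card ∧ (∀ x ∈ es, 0 < x.2) ∧ (∀ a, tot es a = M.count a) ∧ φ = 26 * p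

section

variable (I : Inp)

/-- A block of the dominance structure: `M` are the points in the block, `S` the points to the left of it
in the enclosing block. -/
def Block (R : T → Multiset X → ℕ → Prop) (O : ℤ → T → Multiset (ℤ × X) → ℕ → Prop) :
    List ℤ → ℤ → T → Multiset (ℤ × X) → Multiset X → ℕ → Prop
  | [], lo, t, M, S, φ => ∃ φ₁ φ₂, φ = φ₁ + φ₂ ∧ R (I.look noMem t 0) S φ₁ ∧ O lo (I.look noMem t 1) M φ₂
  | w :: ws, lo, t, M, S, φ => ∃ φ₁ φ₂, φ = φ₁ + φ₂ ∧
      Block R O ws lo (I.look noMem t 0) (M.filter (·.1 < lo + w)) S φ₁ ∧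
      Block R O ws (lo + w) (I.look noMem t 1) (M.filter (lo + w ≤ ·.1))
        (S + (M.filter (·.1 < lo + w)).map Prod.snd) φ₂

/-- One trie level per block of bits; `lo` is the value of the bits read so far. Once the bits are
exhausted nothing is stored: the remaining points agree in the key, and a strict query never
separates them. -/
def Outer (R : T → Multiset X → ℕ → Prop) :
    List (List ℤ) → ℤ → T → Multiset (ℤ × X) → ℕ → Prop
  | [], _, _, _, φ => φ = 0
  | b :: bs, lo, t, M, φ => Block I R (Outer R bs) b lo t M 0 φ

def uncons (p : X) : ℤ × X := (p.1.headD 0, (p.1.tail, p.2))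

/-- The tree `t` is a dominance structure in `j` dimensions for the points `M`, with potential `φ`. -/
def DomRep (bl : List (List ℤ)) : ℕ → T → Multiset X → ℕ → Prop
  | 0, t, M, φ => Bag t (M.map Prod.snd) φ
  | j + 1, t, M, φ => Outer I (DomRep bl j) bl 0 t (M.map uncons) φ

/-- Every field of `nil` reads as `nil`, so `nil` represents the empty structure of any shape.
Subtrees come into being only when a point enters them. -/
theorem Block.zero {R : T → Multiset X → ℕ → Prop} {O : ℤ → T → Multiset (ℤ × X) → ℕ → Prop}
    (hR : R .nil 0 0) (hO : ∀ lo, O lo .nil 0 0) (ws : List ℤ) :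
    ∀ lo, Block I R O ws lo .nil 0 0 0 := by
  induction ws with
  | nil => exact fun lo => ⟨0, 0, rfl, by simpa using hR, by simpa using hO lo⟩
  | cons w ws ih => exact fun lo => ⟨0, 0, rfl, by simpa using ih lo, by simpa using ih (lo + w)⟩

theorem Outer.zero {R : T → Multiset X → ℕ → Prop} (hR : R .nil 0 0) (bs : List (List ℤ)) :
    ∀ lo, Outer I R bs lo .nil 0 0 := by
  induction bs with
  | nil => exact fun lo => rfl
  | cons b bs ih => exact fun lo => Block.zero I hR ih b lo

theorem DomRep.zero (bl : List (List ℤ)) (j : ℕ) : DomRep I bl j .nil 0 0 := by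
  induction j with
  | zero => exact Or.inl ⟨rfl, rfl, rfl⟩
  | succ j ih => simpa [DomRep] using Outer.zero I ih bl 0

/-- Each width exceeds the sum of the following widths by one. -/
def Bin : List ℤ → Prop
  | [] => True
  | w :: ws => w = ws.sum + 1 ∧ 0 ≤ ws.sum ∧ Bin ws

theorem card_filter_split (M : Multiset (ℤ × X)) (a : ℤ) :
    (M.filter (·.1 < a)).card + (M.filter (a ≤ ·.1)).card = M.card := by
  conv_rhs => rw [← Multiset.filter_add_not (fun p : ℤ × X => p.1 < a) M]
  simp [not_lt]

variable (d : ℕ) (bl : List (List ℤ)) (fu : List ℤ)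

def ctx : T := .node (encs (encs .int) bl) (encs .int fu) .nil

variable {I d bl fu}

/-! ### Insertion and its amortised cost -/

section insert

variable {R : T → Multiset X → ℕ → Prop} {O : ℤ → T → Multiset (ℤ × X) → ℕ → Prop} {p : X} {K Y : ℕ}
  (hR : ∀ t S φ, S.card < I.W → R t S φ → ∃ t' φ' c,
    Pu I (prog d) fIns [t, encs .int p.1, .pt p.2, ctx bl fu] t' c ∧ R t' (p ::ₘ S) φ' ∧ c + φ' ≤ φ + K)
include hR

/-- Every one of the `2 ^ ws.length` leaves below receives `p` in its prefix structure, at amortised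
cost `K` each. The `4` on the left is reserved for the parent node, and with it the induction
closes. -/
theorem insAll_spec (ws : List ℤ) : ∀ lo t M S φ, S.card + M.card < I.W →
    Block I R O ws lo t M S φ → ∃ t' φ' c,
      Pu I (prog d) fInsAll [t, encs .int ws, encs .int p.1, .pt p.2, ctx bl fu] t' c ∧
      Block I R O ws lo t' M (p ::ₘ S) φ' ∧ c + φ' + 4 ≤ φ + 2 ^ ws.length * (K + 7) := by
  induction ws with
  | nil =>
    rintro lo t M S φ hW ⟨φ₁, φ₂, rfl, h1, h2⟩
    obtain ⟨t', φ', c, r1, r2, r3⟩ := hR _ _ _ (by omega) h1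
    refine ⟨.node t' (I.look noMem t 1) .nil, φ' + φ₂, c + 3, fun o => ev_of_wp ?_,
      ⟨φ', φ₂, rfl, r2, h2⟩, ?_⟩
    · change wp I (prog d) cInsAll _ _ _
      simp [cInsAll]
      exact ⟨_, _, _, r1 o, by simp⟩
    · simp; omega
  | cons w ws ih =>
    rintro lo t M S φ hW ⟨φ₁, φ₂, rfl, h1, h2⟩
    have hc := card_filter_split M (lo + w)
    obtain ⟨t₁, φ₁', c₁, r1, r2, r3⟩ := ih _ _ _ _ _ (by omega) h1
    obtain ⟨t₂, φ₂', c₂, r1', r2', r3'⟩ := ih _ _ _ _ _ (by simp; omega) h2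
    refine ⟨.node t₁ t₂ .nil, φ₁' + φ₂', c₁ + c₂ + 4, fun o => ev_of_wp ?_,
      ⟨φ₁', φ₂', rfl, r2, by simpa using r2'⟩, ?_⟩
    · change wp I (prog d) cInsAll _ _ _
      simp [cInsAll]
      refine ⟨_, _, _, r1 o, _, _, _, r1' o, by simp; omega⟩
    · simp only [List.length_cons, pow_succ]
      have : 2 ^ ws.length * 2 * (K + 7) = 2 ^ ws.length * (K + 7) + 2 ^ ws.length * (K + 7) := by ring
      omega

/-- If the next bit is `1`, the point is not to the left of any leaf of the left half, which stays
unchanged. If it is `0`, the point is to the left of every leaf of the right half, and `insAll`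
updates all of them. The halves updated along the path have fewer than `2 ^ ws.length` leaves
altogether. -/
theorem insBlock_spec {bs : List (List ℤ)} {k : ℤ}
    (hO : ∀ lo t M φ, M.card < I.W → lo ≤ k → k ≤ lo + bs.flatten.sum → k - lo ≤ I.W → O lo t M φ →
      ∃ t' φ' c, Pu I (prog d) fInsOuter [t, encs (encs .int) bs, .int (k - lo), encs .int p.1, .pt p.2,
        ctx bl fu] t' c ∧ O lo t' ((k, p) ::ₘ M) φ' ∧ c + φ' ≤ φ + Y)
    (ws : List ℤ) : ∀ lo t M S φ, S.card + M.card < I.W → Bin (ws ++ bs.flatten) → lo ≤ k →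
      k ≤ lo + (ws ++ bs.flatten).sum → k - lo ≤ I.W → Block I R O ws lo t M S φ → ∃ t' φ' c,
      Pu I (prog d) fInsBlock [t, encs .int ws, encs (encs .int) bs, .int (k - lo), encs .int p.1, .pt p.2,
        ctx bl fu] t' c ∧ Block I R O ws lo t' ((k, p) ::ₘ M) S φ' ∧
      c + φ' ≤ φ + Y + 2 ^ ws.length * (K + 15) := by
  induction ws with
  | nil =>
    rintro lo t M S φ hW _ hk hk' hkW ⟨φ₁, φ₂, rfl, h1, h2⟩
    obtain ⟨t', φ', c, r1, r2, r3⟩ := hO _ _ _ _ (by omega) hk hk' hkW h2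
    refine ⟨.node (I.look noMem t 0) t' .nil, φ₁ + φ', c + 3, fun o => ev_of_wp ?_,
      ⟨φ₁, φ', rfl, h1, r2⟩, ?_⟩
    · change wp I (prog d) cInsBlock _ _ _
      simp [cInsBlock]
      exact ⟨_, _, _, r1 o, by simp⟩
    · simp; omega
  | cons w ws ih =>
    rintro lo t M S φ hW ⟨hw, hs0, hbin⟩ hk hk' hkW ⟨φ₁, φ₂, rfl, h1, h2⟩
    have hc := card_filter_split M (lo + w)
    simp only [List.cons_append, List.sum_cons] at hk'
    have hw : w = (ws ++ bs.flatten).sum + 1 := hw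
    have hs0 : 0 ≤ (ws ++ bs.flatten).sum := hs0
    have hpow : 2 ^ (w :: ws).length * (K + 15) =
        2 ^ ws.length * (K + 15) + (2 ^ ws.length * (K + 7) + 2 ^ ws.length * 8) := by
      simp only [List.length_cons, pow_succ]; ring
    have hpos : 1 ≤ 2 ^ ws.length := Nat.one_le_two_pow
    by_cases hwk : w ≤ k - lo
    · obtain ⟨t', φ', c, r1, r2, r3⟩ := ih (lo + w) _ _ _ _ (by simp; omega) hbin (by omega)
        (by omega) (by omega) h2
      have hsub : T.minus I.W (.int (k - lo)) (.int w) = .int (k - (lo + w)) := by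
        rw [minus_int]
        · congr 1; ring
        · rw [abs_of_nonneg (by omega)]; omega
      refine ⟨.node (I.look noMem t 0) t' .nil, φ₁ + φ', c + 4, fun o => ev_of_wp ?_, ?_, ?_⟩
      · change wp I (prog d) cInsBlock _ _ _
        simp [cInsBlock, T.le, hwk, hsub]
        exact ⟨_, _, _, r1 o, by simp⟩
      · refine ⟨φ₁, φ', rfl, ?_, ?_⟩
        · simpa [Multiset.filter_cons_of_neg, show ¬ k < lo + w by omega] using h1
        · simpa [Multiset.filter_cons_of_neg, show ¬ k < lo + w by omega,
            show lo + w ≤ k by omega] using r2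
      · omega
    · obtain ⟨t₁, φ₁', c₁, r1, r2, r3⟩ := ih lo _ _ _ _ (by omega) hbin hk (by omega) (by omega) h1
      obtain ⟨t₂, φ₂', c₂, r1', r2', r3'⟩ := insAll_spec hR ws _ _ _ _ _ (by simp; omega) h2
      refine ⟨.node t₁ t₂ .nil, φ₁' + φ₂', c₁ + c₂ + 5, fun o => ev_of_wp ?_, ?_, ?_⟩
      · change wp I (prog d) cInsBlock _ _ _
        simp [cInsBlock, T.le, hwk]
        exact ⟨_, _, _, r1 o, _, _, _, r1' o, by simp; omega⟩
      · refine ⟨φ₁', φ₂', rfl, ?_, ?_⟩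
        · simpa [show k < lo + w by omega] using r2
        · simpa [show k < lo + w by omega, show ¬ lo + w ≤ k by omega] using r2'
      · omega

/-- `G` bounds the number of leaves of a block. The program carries only the remainder `k - lo`,
whose bits are those of the blocks still to come. -/
theorem insOuter_spec {G : ℕ} {k : ℤ} (bs : List (List ℤ)) : (∀ b ∈ bs, 2 ^ b.length ≤ G) →
    Bin bs.flatten → ∀ lo t M φ, M.card < I.W → lo ≤ k → k ≤ lo + bs.flatten.sum → k - lo ≤ I.W →
    Outer I R bs lo t M φ → ∃ t' φ' c,
      Pu I (prog d) fInsOuter [t, encs (encs .int) bs, .int (k - lo), encs .int p.1, .pt p.2,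
        ctx bl fu] t' c ∧ Outer I R bs lo t' ((k, p) ::ₘ M) φ' ∧
      c + φ' ≤ φ + (bs.length * (G * (K + 18)) + 2) := by
  induction bs with
  | nil =>
    intro _ _ lo t M φ _ _ _ _ h
    refine ⟨t, φ, 2, fun o => ev_of_wp ?_, h, by simp; omega⟩
    change wp I (prog d) cInsOuter _ _ _
    simp [cInsOuter]
  | cons b bs ih =>
    intro hG hbin lo t M φ hW hk hk' hkW h
    have hbin' : Bin bs.flatten := by
      clear hk' h hG
      rw [List.flatten_cons] at hbin
      induction b with
      | nil => exact hbin
      | cons w b ihb => exact ihb hbin.2.2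
    have hO := ih (fun b' hb' => hG b' (by simp [hb'])) hbin'
    obtain ⟨t', φ', c, r1, r2, r3⟩ := insBlock_spec hR hO b lo t M 0 φ (by simpa using hW) hbin hk hk'
      hkW h
    refine ⟨t', φ', c + 3, fun o => ev_of_wp ?_, r2, ?_⟩
    · change wp I (prog d) cInsOuter _ _ _
      simp [cInsOuter]
      exact ⟨_, _, _, r1 o, by simp⟩
    · have hG1 := hG b (by simp)
      have hG0 : 1 ≤ G := Nat.one_le_two_pow.trans hG1
      have e1 : 2 ^ b.length * (K + 15) ≤ G * (K + 15) := Nat.mul_le_mul_right _ hG1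
      have e2 : (b :: bs).length * (G * (K + 18)) = bs.length * (G * (K + 18)) + G * (K + 15) + 3 * G := by
        simp only [List.length_cons]; ring
      omega

end insert

/-- Of the entries, `b` were merged at the last rebuilding and `p ≤ b` are new. A rebuilding happens
only when `p = b`, on a list of `2 * p + 1` entries. Counting, collecting and measuring cost `5 + 5
+ 3` per entry, so about `26 * p` in all, which the potential pays. -/
theorem bag_spec (hsc : I.sc = d + 2) {t : T} {M : Multiset ℕ} {φ a : ℕ} (hW : M.card < I.W)
    (h : Bag t M φ) : ∃ t' φ' c, Pu I (prog d) fBag [t, .pt a] t' c ∧ Bag t' (a ::ₘ M) φ' ∧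
      c + φ' ≤ φ + 38 := by
  rcases h with ⟨rfl, rfl, rfl⟩ | ⟨es, b, p, rfl, hlen, hpb, hb, hpos, htot, rfl⟩
  · refine ⟨.node (encE [(a, 1)]) (.int 1) (.int 0), 0, 2, fun o => ev_of_wp ?_, Or.inr ?_, by omega⟩
    · change wp I (prog d) cBag _ _ _
      simp [cBag]
    · refine ⟨[(a, 1)], 1, 0, by simp, by simp, by simp, by simp, by simp, fun b => ?_, rfl⟩
      simp [tot_cons, Multiset.count_singleton, eq_comm]
  · have hbM : b ≤ M.card := hb.trans (Multiset.toFinset_card_le M)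
    have hpos' : ∀ x ∈ (a, (1 : ℤ)) :: es, 0 < x.2 := by
      intro x hx
      rcases List.mem_cons.1 hx with rfl | hx
      · simp
      · exact hpos x hx
    have htot' : ∀ c, tot ((a, 1) :: es) c = (a ::ₘ M).count c := by
      intro c
      rw [tot_cons, htot, Multiset.count_cons]
      by_cases h : a = c
      · subst h; simp; ring
      · simp [h, Ne.symm h]
    have hplus : T.plus I.W (.int p) (.int 1) = .int ((p + 1 : ℕ) : ℤ) := by
      rw [plus_int]
      · push_cast; rfl
      · rw [abs_of_nonneg (by positivity)]; omega
    by_cases hc : p + 1 ≤ b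
    · have hc' : (p : ℤ) + 1 ≤ b := by exact_mod_cast hc
      refine ⟨.node (encE ((a, 1) :: es)) (.int b) (.int ((p + 1 : ℕ) : ℤ)), 26 * (p + 1), 3,
        fun o => ev_of_wp ?_, Or.inr ⟨_, b, p + 1, rfl, by simp; omega, hc, ?_, hpos', htot', rfl⟩,
        by omega⟩
      · change wp I (prog d) cBag _ _ _
        simp [cBag, hplus, T.le, hc']
      · refine hb.trans (Finset.card_le_card ?_)
        simp
    · have hc' : ¬ (p : ℤ) + 1 ≤ b := by exact_mod_cast hc
      obtain ⟨ts, es', h1, h2, _, hnd, hmem, htt, hle⟩ := aggregate_spec hsc ((a, 1) :: es) hpos' (by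
        intro c
        rw [htot']
        have := Multiset.count_le_card c (a ::ₘ M)
        rw [Multiset.card_cons] at this
        exact_mod_cast this.trans hW)
      -- After merging, the representatives in the list are distinct, so there are at most as many
      -- entries as colours. The bound on `b` persists because later insertions only add colours.
      have hcard : es'.length ≤ (a ::ₘ M).toFinset.card := by
        have e : es'.length = (es'.map Prod.fst).toFinset.card := by
          rw [List.toFinset_card_of_nodup hnd, List.length_map]
        rw [e]
        refine Finset.card_le_card fun c hc => ?_
        rw [List.mem_toFinset, List.mem_map] at hc
        obtain ⟨x, hx, rfl⟩ := hc
        have h3 := (hmem x).1 hx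
        rw [htot'] at h3
        rw [Multiset.mem_toFinset, ← Multiset.count_pos]
        omega
      have hcard' : (a ::ₘ M).toFinset.card ≤ M.card + 1 := by
        simpa using Multiset.toFinset_card_le (a ::ₘ M)
      refine ⟨.node (encE es') (.int es'.length) (.int 0), 0, 26 * p + 38,
        fun o => ev_of_wp ?_, Or.inr ⟨es', es'.length, 0, rfl, rfl, by omega, hcard, fun x hx =>
          ((hmem x).1 hx).2, fun c => by rw [htt, htot'], rfl⟩, by omega⟩
      change wp I (prog d) cBag _ _ _
      have h1 := h1 o
      simp only [encE_cons] at h1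
      simp [cBag, hplus, T.le, hc']
      refine ⟨_, _, _, h1, _, _, _, h2 o, _, _, _, lenE_spec I d es' (by omega) o, ?_⟩
      simp at hle ⊢
      omega

/-- The amortized cost of an insertion. -/
def insCost (NB G : ℕ) : ℕ → ℕ
  | 0 => 41
  | j + 1 => NB * (G * (insCost NB G j + 18)) + 5

theorem ins_spec (hsc : I.sc = d + 2) {G : ℕ} (hG : ∀ b ∈ bl, 2 ^ b.length ≤ G) (hbin : Bin bl.flatten)
    (hVW : bl.flatten.sum ≤ I.W) (j : ℕ) : ∀ (p : X), p.1.length = j →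
      (∀ k ∈ p.1, 0 ≤ k ∧ k ≤ bl.flatten.sum) → ∀ t M φ, M.card < I.W → DomRep I bl j t M φ →
      ∃ t' φ' c, Pu I (prog d) fIns [t, encs .int p.1, .pt p.2, ctx bl fu] t' c ∧
        DomRep I bl j t' (p ::ₘ M) φ' ∧ c + φ' ≤ φ + insCost bl.length G j := by
  induction j with
  | zero =>
    rintro ⟨ks, a⟩ hlen _ t M φ hW h
    obtain rfl : ks = [] := by simpa using hlen
    obtain ⟨t', φ', c, r1, r2, r3⟩ := bag_spec hsc (a := a) (by simpa using hW) h
    refine ⟨t', φ', c + 3, fun o => ev_of_wp ?_, by simpa [DomRep] using r2, by simp [insCost]; omega⟩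
    change wp I (prog d) cIns _ _ _
    simp [cIns]
    exact ⟨_, _, _, r1 o, by simp⟩
  | succ j ih =>
    rintro ⟨ks, a⟩ hlen hks t M φ hW h
    cases ks with
    | nil => simp at hlen
    | cons k ks =>
      have hk := hks k (by simp)
      obtain ⟨t', φ', c, r1, r2, r3⟩ := insOuter_spec (p := (ks, a)) (K := insCost bl.length G j)
        (k := k) (ih (ks, a) (by simpa using hlen) (fun k' hk' => hks k' (by simp [hk']))) bl hG hbin 0 t
        (M.map uncons) φ (by simpa using hW) hk.1 (by simpa using hk.2) (by simpa using hk.2.trans hVW) h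
      refine ⟨t', φ', c + 3, fun o => ev_of_wp ?_, by simpa [DomRep, uncons] using r2,
        by simp only [insCost]; omega⟩
      change wp I (prog d) cIns _ _ _
      have := r1 o
      rw [sub_zero] at this
      simp [cIns, ctx]
      exact ⟨_, _, _, this, by simp⟩

end

end FunLang

namespace FunLang

open Classical

/-! ### Queries of the dominance structure -/

section

variable {I : Inp} {d : ℕ} {bl : List (List ℤ)} {fu : List ℤ}

section ask

variable {R : T → Multiset X → ℕ → Prop} {O : ℤ → T → Multiset (ℤ × X) → ℕ → Prop} {V : X → Prop}
  {qs : List ℤ} {A L Y L' : ℕ}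
  (hR : ∀ t S φ, R t S φ → (∀ p ∈ S, V p) → ∀ acc, ∃ es,
    Pu I (prog d) fAskIn [t, encs .int qs, encE acc, ctx bl fu] (encE (es ++ acc)) (A + 3 * es.length) ∧
      Ent L es (ans qs S))
include hR

/-- The leaf that contains `q` suffices: all points of the block with smaller key are either to the
left of this leaf, hence in its prefix structure, or inside the leaf, where the next block decides.
So there is one query in the remaining keys per block. -/
theorem askBlock_spec {bs : List (List ℤ)} {q : ℤ}
    (hO : ∀ lo t M φ, lo ≤ q → q ≤ lo + bs.flatten.sum → q - lo ≤ I.W → O lo t M φ →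
      (∀ p ∈ M, lo ≤ p.1 ∧ V p.2) → ∀ acc, ∃ es,
      Pu I (prog d) fAskOuter [t, encs (encs .int) bs, .int (q - lo), encs .int qs, encE acc, ctx bl fu]
        (encE (es ++ acc)) (Y + 3 * es.length) ∧
        Ent L' es (ans qs ((M.filter (·.1 < q)).map Prod.snd)))
    (ws : List ℤ) : ∀ lo t M S φ, Bin (ws ++ bs.flatten) → lo ≤ q →
      q ≤ lo + (ws ++ bs.flatten).sum → q - lo ≤ I.W → Block I R O ws lo t M S φ →
      (∀ p ∈ M, lo ≤ p.1 ∧ V p.2) → (∀ p ∈ S, V p) → ∀ acc, ∃ es,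
      Pu I (prog d) fAskBlock [t, encs .int ws, encs (encs .int) bs, .int (q - lo), encs .int qs, encE acc,
        ctx bl fu] (encE (es ++ acc)) (A + Y + 4 + 4 * ws.length + 3 * es.length) ∧
        Ent (L + L') es (ans qs (S + (M.filter (·.1 < q)).map Prod.snd)) := by
  induction ws with
  | nil =>
    rintro lo t M S φ _ hq hq' hqW ⟨φ₁, φ₂, rfl, h1, h2⟩ hM hS acc
    obtain ⟨es₁, r1, r2⟩ := hR _ _ _ h1 hS acc
    obtain ⟨es₂, r3, r4⟩ := hO _ _ _ _ hq hq' hqW h2 hM (es₁ ++ acc)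
    refine ⟨es₂ ++ es₁, fun o => ev_of_wp ?_, ?_⟩
    · change wp I (prog d) cAskBlock _ _ _
      simp [cAskBlock]
      exact ⟨_, _, _, r1 o, _, _, _, r3 o, by simp; omega⟩
    · rw [ans_add, add_comm, add_comm (ans qs S)]
      exact r4.append r2
  | cons w ws ih =>
    rintro lo t M S φ ⟨hw, hs0, hbin⟩ hq hq' hqW ⟨φ₁, φ₂, rfl, h1, h2⟩ hM hS acc
    simp only [List.cons_append, List.sum_cons] at hq'
    have hw : w = (ws ++ bs.flatten).sum + 1 := hw
    have hs0 : 0 ≤ (ws ++ bs.flatten).sum := hs0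
    by_cases hwq : w ≤ q - lo
    · obtain ⟨es, r1, r2⟩ := ih (lo + w) _ _ _ _ hbin (by omega) (by omega) (by omega) h2
        (fun p hp => ⟨(Multiset.mem_filter.1 hp).2, (hM p (Multiset.mem_filter.1 hp).1).2⟩)
        (fun p hp => by
          rcases Multiset.mem_add.1 hp with hp | hp
          · exact hS p hp
          · obtain ⟨p', hp', rfl⟩ := Multiset.mem_map.1 hp
            exact (hM p' (Multiset.mem_filter.1 hp').1).2) acc
      have hsub : T.minus I.W (.int (q - lo)) (.int w) = .int (q - (lo + w)) := by
        rw [minus_int]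
        · congr 1; ring
        · rw [abs_of_nonneg (by omega)]; omega
      refine ⟨es, fun o => ev_of_wp ?_, ?_⟩
      · change wp I (prog d) cAskBlock _ _ _
        simp [cAskBlock, T.le, hwq, hsub]
        exact ⟨_, _, _, r1 o, by simp; omega⟩
      · have e : (M.filter (·.1 < lo + w)).map Prod.snd +
            ((M.filter (lo + w ≤ ·.1)).filter (·.1 < q)).map Prod.snd =
            (M.filter (·.1 < q)).map Prod.snd := by
          rw [← Multiset.map_add, Multiset.filter_filter]
          congr 1
          have e1 : M.filter (·.1 < lo + w) = (M.filter (·.1 < q)).filter (·.1 < lo + w) := by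
            rw [Multiset.filter_filter]
            exact Multiset.filter_congr fun p _ => ⟨fun h => ⟨h, by omega⟩, fun h => h.1⟩
          have e2 : M.filter (fun p => p.1 < q ∧ lo + w ≤ p.1) =
              (M.filter (·.1 < q)).filter (fun p => ¬ p.1 < lo + w) := by
            rw [Multiset.filter_filter]
            exact Multiset.filter_congr fun p _ => ⟨fun h => ⟨by omega, h.1⟩, fun h => ⟨h.2, by omega⟩⟩
          rw [e1, e2, Multiset.filter_add_not]
        rwa [add_assoc, e] at r2
    · obtain ⟨es, r1, r2⟩ := ih lo _ _ _ _ hbin hq (by omega) hqW h1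
        (fun p hp => hM p (Multiset.mem_filter.1 hp).1) hS acc
      refine ⟨es, fun o => ev_of_wp ?_, ?_⟩
      · change wp I (prog d) cAskBlock _ _ _
        simp [cAskBlock, T.le, hwq]
        exact ⟨_, _, _, r1 o, by simp; omega⟩
      · rw [Multiset.filter_filter] at r2
        have e : M.filter (·.1 < q) = M.filter fun p => p.1 < q ∧ p.1 < lo + w :=
          Multiset.filter_congr fun p _ => ⟨fun h => ⟨h, by omega⟩, fun h => h.1⟩
        rwa [e]

theorem askOuter_spec {q : ℤ} (bs : List (List ℤ)) : Bin bs.flatten → ∀ lo t M φ, lo ≤ q →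
    q ≤ lo + bs.flatten.sum → q - lo ≤ I.W → Outer I R bs lo t M φ → (∀ p ∈ M, lo ≤ p.1 ∧ V p.2) →
    ∀ acc, ∃ es,
      Pu I (prog d) fAskOuter [t, encs (encs .int) bs, .int (q - lo), encs .int qs, encE acc, ctx bl fu]
        (encE (es ++ acc)) (bs.length * (A + 7) + 4 * bs.flatten.length + 2 + 3 * es.length) ∧
        Ent (bs.length * L) es (ans qs ((M.filter (·.1 < q)).map Prod.snd)) := by
  induction bs with
  | nil =>
    intro _ lo t M φ hq hq' _ _ hM acc
    refine ⟨[], fun o => ev_of_wp ?_, ?_⟩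
    · change wp I (prog d) cAskOuter _ _ _
      simp [cAskOuter]
    -- With no bits left `q = lo`, and no key is below `lo`.
    · have : M.filter (·.1 < q) = 0 := Multiset.filter_eq_nil.2 fun p hp => by
        have := (hM p hp).1
        simp at hq'
        omega
      simpa [this] using Ent.nil 0
  | cons b bs ih =>
    intro hbin lo t M φ hq hq' hqW h hM acc
    have hbin' : Bin bs.flatten := by
      clear hq' h
      rw [List.flatten_cons] at hbin
      induction b with
      | nil => exact hbin
      | cons w b ihb => exact ihb hbin.2.2
    obtain ⟨es, r1, r2⟩ := askBlock_spec hR (ih hbin') b lo t M 0 φ hbin hq hq' hqW h hM (by simp) acc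
    refine ⟨es, fun o => ev_of_wp ?_, ?_⟩
    · change wp I (prog d) cAskOuter _ _ _
      simp [cAskOuter]
      refine ⟨_, _, _, r1 o, ?_⟩
      simp
      intro k hk
      have : (bs.length + 1) * (A + 7) = bs.length * (A + 7) + A + 7 := by ring
      omega
    · rw [zero_add] at r2
      convert r2 using 1
      simp only [List.length_cons]; ring

end ask

/-- The cost of a query apart from the output, and the number of entries for a colour. -/
def askCost (NB H : ℕ) : ℕ → ℕ
  | 0 => 5
  | j + 1 => NB * (askCost NB H j + 7) + 4 * H + 5

theorem ans_uncons {q : ℤ} {qs : List ℤ} {j : ℕ} {M : Multiset X} (hM : ∀ p ∈ M, p.1.length = j + 1) :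
    ans qs (((M.map uncons).filter (·.1 < q)).map Prod.snd) = ans (q :: qs) M := by
  unfold ans
  simp only [Multiset.filter_map, Multiset.map_map, Multiset.filter_filter]
  have : M.filter (fun a => ((fun p : X => List.Forall₂ (· < ·) p.1 qs) ∘ Prod.snd ∘ uncons) a ∧
      ((fun p : ℤ × X => p.1 < q) ∘ uncons) a) = M.filter fun p => List.Forall₂ (· < ·) p.1 (q :: qs) := by
    refine Multiset.filter_congr fun p hp => ?_
    obtain ⟨ks, a⟩ := p
    cases ks with
    | nil => simpa using hM _ hp
    | cons k ks => simp [uncons, and_comm]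
  rw [this]
  rfl

/-- Each key multiplies the number of entries per colour by the number of blocks. The factor `2`
stems from the bags, whose length `b + p` is at most `2 * b`. -/
theorem askIn_spec (hbin : Bin bl.flatten) (hVW : bl.flatten.sum ≤ I.W) (j : ℕ) : ∀ qs : List ℤ,
    qs.length = j → (∀ q ∈ qs, 0 ≤ q ∧ q ≤ bl.flatten.sum) → ∀ t M φ, DomRep I bl j t M φ →
    (∀ p ∈ M, p.1.length = j ∧ ∀ k ∈ p.1, 0 ≤ k) → ∀ acc, ∃ es,
    Pu I (prog d) fAskIn [t, encs .int qs, encE acc, ctx bl fu] (encE (es ++ acc))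
      (askCost bl.length bl.flatten.length j + 3 * es.length) ∧
      Ent (bl.length ^ j * 2) es (ans qs M) := by
  induction j with
  | zero =>
    intro qs hqs _ t M φ h hM acc
    obtain rfl : qs = [] := by simpa using hqs
    have hans : ans [] M = M.map Prod.snd := by
      unfold ans
      rw [Multiset.filter_eq_self.2]
      intro p hp
      simpa using (hM p hp).1
    rw [hans]
    rcases h with ⟨rfl, h, _⟩ | ⟨es, b, p, rfl, hlen, hpb, hb, hpos, htot, -⟩
    · refine ⟨[], fun o => ev_of_wp ?_, by rw [h]; exact Ent.nil _⟩
      change wp I (prog d) cAskIn _ _ _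
      simp [cAskIn]
      exact ⟨_, _, _, app_spec I d [] acc o, by simp [askCost]; omega⟩
    · refine ⟨es.reverse, fun o => ev_of_wp ?_, ?_⟩
      · change wp I (prog d) cAskIn _ _ _
        simp [cAskIn]
        exact ⟨_, _, _, app_spec I d es acc o, by simp [askCost]; omega⟩
      · refine Ent.reverse ⟨hpos, htot, ?_⟩
        simp; omega
  | succ j ih =>
    intro qs hqs hq t M φ h hM acc
    cases qs with
    | nil => simp at hqs
    | cons q qs =>
      have hq0 := hq q (by simp)
      have hR := ih qs (by simpa using hqs) (fun q' hq' => hq q' (by simp [hq']))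
      obtain ⟨es, r1, r2⟩ := askOuter_spec (V := fun p : X => p.1.length = j ∧ ∀ k ∈ p.1, 0 ≤ k)
        (q := q) hR bl hbin 0 t (M.map uncons) φ hq0.1 (by simpa using hq0.2)
        (by simpa using hq0.2.trans hVW) h (by
          intro p hp
          obtain ⟨⟨ks, a⟩, hp', rfl⟩ := Multiset.mem_map.1 hp
          have := hM _ hp'
          cases ks with
          | nil => simp at this
          | cons k ks => simpa [uncons, and_left_comm, and_assoc] using this) acc
      refine ⟨es, fun o => ev_of_wp ?_, ?_⟩
      · change wp I (prog d) cAskIn _ _ _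
        have := r1 o
        rw [sub_zero] at this
        simp [cAskIn, ctx]
        exact ⟨_, _, _, this, by simp [askCost]; omega⟩
      · rw [ans_uncons fun p hp => (hM p hp).1] at r2
        convert r2 using 1
        ring

end

end FunLang

namespace FunLang

open Classical

/-! ### All versions of the dominance structure -/

theorem encs_congr {α β : Type*} {e : α → T} {e' : β → T} (f : α → β) {l : List α}
    (h : ∀ x ∈ l, e x = e' (f x)) : encs e l = encs e' (l.map f) := by
  induction l with
  | nil => rfl
  | cons x l ih => simp [h x (by simp), ih fun y hy => h y (by simp [hy])]

/-- A point whose first dominance key is split off. -/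
def encD (x : ℤ × X) : T := .node (.node (.int x.1) (encs .int x.2.1) .nil) .nil (.pt x.2.2)

def encV (v : ℤ × List ℤ × T) : T := .node (.node (.int v.1) (encs .int v.2.1) .nil) (.node v.2.2 .nil .nil) .nil

section

variable {I : Inp} {d : ℕ} {bl : List (List ℤ)} {fu : List ℤ}

/-- Insertion copies the path it changes, so all versions coexist. Only the newest version is ever
extended, hence the amortised bounds telescope along the sequence. The last version with first key
below `q` contains exactly the points with first key below `q`. -/
theorem versions_spec (hsc : I.sc = d + 2) {G : ℕ} (hG : ∀ b ∈ bl, 2 ^ b.length ≤ G)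
    (hbin : Bin bl.flatten) (hVW : bl.flatten.sum ≤ I.W) (j : ℕ) (l : List (ℤ × X)) :
    ∀ t M φ, DomRep I bl j t M φ →
    (∀ x ∈ l, x.2.1.length = j ∧ ∀ k ∈ x.2.1, 0 ≤ k ∧ k ≤ bl.flatten.sum) → M.card + l.length ≤ I.W →
    l.Pairwise (fun x y => x.1 ≤ y.1) → ∃ vs,
      Pu I (prog d) fVersions [encs encD l, t, ctx bl fu] (encs encV vs)
        (φ + l.length * (insCost bl.length G j + 4) + 2) ∧
      vs.length = l.length ∧ vs.Pairwise (fun x y => x.1 ≤ y.1) ∧ (∀ z, (∀ x ∈ l, z ≤ x.1) → ∀ v ∈ vs, z ≤ v.1) ∧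
      ∀ q, ∃ φ', DomRep I bl j ((vs.filter (·.1 < q)).foldl (fun _ v => v.2.2) t)
        (M + ((l.filter (·.1 < q)).map Prod.snd : List X)) φ' := by
  induction l with
  | nil =>
    intro t M φ h _ _ _
    refine ⟨[], fun o => ev_of_wp ?_, rfl, by simp, by simp, fun q => ⟨φ, by simpa using h⟩⟩
    change wp I (prog d) cVersions _ _ _
    simp [cVersions]
  | cons x l ih =>
    intro t M φ h hl hW hs
    rw [List.pairwise_cons] at hs
    simp only [List.length_cons] at hW
    have hx := hl x (by simp)
    obtain ⟨t', φ', c, r1, r2, r3⟩ := ins_spec (fu := fu) hsc hG hbin hVW j x.2 hx.1 hx.2 t M φ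
      (by omega) h
    obtain ⟨vs, h1, h2, h3, h4, h5⟩ := ih t' _ φ' r2 (fun y hy => hl y (by simp [hy]))
      (by simp; omega) hs.2
    refine ⟨(x.1, x.2.1, t') :: vs, fun o => ev_of_wp ?_, by simp [h2],
      List.pairwise_cons.2 ⟨h4 x.1 hs.1, h3⟩, ?_, fun q => ?_⟩
    · change wp I (prog d) cVersions _ _ _
      simp [cVersions, encD]
      refine ⟨_, _, _, r1 o, _, _, _, h1 o, ?_⟩
      simp
      intro k₁ hk₁ k₂ hk₂
      refine ⟨rfl, ?_⟩
      have : (l.length + 1) * (insCost bl.length G j + 4) =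
        l.length * (insCost bl.length G j + 4) + insCost bl.length G j + 4 := by ring
      omega
    · intro z hz v hv
      rcases List.mem_cons.1 hv with rfl | hv
      · exact hz x (by simp)
      · exact h4 z (fun y hy => hz y (by simp [hy])) v hv
    · by_cases hq : x.1 < q
      · obtain ⟨φ₁, h6⟩ := h5 q
        refine ⟨φ₁, ?_⟩
        simp only [hq, decide_true, List.filter_cons_of_pos, List.foldl_cons, List.map_cons]
        rw [← Multiset.cons_coe, Multiset.add_cons, ← Multiset.cons_add]
        exact h6
      · refine ⟨φ, ?_⟩
        have e1 : vs.filter (·.1 < q) = [] := List.filter_eq_nil_iff.2 fun v hv => by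
          have := h4 x.1 hs.1 v hv
          simp; omega
        have e2 : l.filter (·.1 < q) = [] := List.filter_eq_nil_iff.2 fun v hv => by
          have := hs.1 v hv
          simp; omega
        simpa [hq, e1, e2] using h

/-- The search in `nil` returns its default `nil`, which is also the empty structure in the other
keys. -/
theorem askDom_nil (hbin : Bin bl.flatten) (hVW : bl.flatten.sum < I.W) {j : ℕ} (q : ℤ) (qs : List ℤ)
    (hqs : qs.length = j) (hq : ∀ k ∈ q :: qs, 0 ≤ k ∧ k ≤ bl.flatten.sum) (acc : List (ℕ × ℤ)) :
    Pu I (prog d) fAskDom [.nil, encs .int (q :: qs), encE acc, ctx bl fu] (encE acc)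
      (askCost bl.length bl.flatten.length j + 5) := by
  obtain ⟨es, r1, r2⟩ := askIn_spec (fu := fu) (d := d) hbin hVW.le j qs hqs (fun k hk => hq k (by simp [hk]))
    .nil 0 0 (DomRep.zero I bl j) (by simp) acc
  obtain rfl : es = [] := by
    have := r2.2.2
    simpa using this
  have hs : Pu I (prog d) (fSearch false) [.nil, .int (q - 1), .nil] .nil 2 := by
    intro o
    refine ev_of_wp ?_
    change wp I (prog d) (cSearch false) _ _ _
    simp [cSearch]
  have hq0 := hq q (by simp)
  have hsub : T.minus I.W (.int q) (.int 1) = .int (q - 1) := minus_int (by rw [abs_le]; omega)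
  intro o
  refine ev_of_wp ?_
  change wp I (prog d) cAskDom _ _ _
  simp [cAskDom, hsub]
  refine ⟨_, _, _, hs o, _, _, _, r1 o, by simp; omega⟩

/-- The sweep over the first key reduces dominance in `j + 1` keys to a search for a version and
dominance in `j` keys. -/
theorem dom_spec (hsc : I.sc = d + 2) {G : ℕ} (hG : ∀ b ∈ bl, 2 ^ b.length ≤ G)
    (hbin : Bin bl.flatten) (hVW : bl.flatten.sum < I.W) (j : ℕ) (l : List (ℤ × X)) (hl0 : l ≠ [])
    (hl : ∀ x ∈ l, x.2.1.length = j ∧ ∀ k ∈ x.2.1, 0 ≤ k ∧ k ≤ bl.flatten.sum) (hW : l.length ≤ I.W)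
    (hfu : l.length < 2 ^ fu.length) : ∃ t,
      Pu I (prog d) fDom [encs encD l, ctx bl fu] t
        ((25 * fu.length + insCost bl.length G j + 50) * l.length) ∧
      ∀ (q : ℤ) (qs : List ℤ), qs.length = j → (∀ k ∈ q :: qs, 0 ≤ k ∧ k ≤ bl.flatten.sum) → ∀ acc, ∃ es,
        Pu I (prog d) fAskDom [t, encs .int (q :: qs), encE acc, ctx bl fu] (encE (es ++ acc))
          (askCost bl.length bl.flatten.length j + 4 * fu.length + 5 + 3 * es.length) ∧
        Ent (bl.length ^ j * 2) es (ans qs ((l.filter (·.1 < q)).map Prod.snd : List X)) := by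
  obtain ⟨l', r1, hp, hs⟩ := sort_spec (I := I) (e := encD) (key := fun x => .int x.1) d
    (fun _ _ => rfl) fu.length l hfu.le (fun x _ y _ => le_total x.1 y.1)
  have hlen := hp.length_eq
  obtain ⟨vs, r2, h2, h3, -, h5⟩ := versions_spec (I := I) (d := d) (fu := fu) hsc hG hbin hVW.le j l' .nil
    0 0 (DomRep.zero I bl j) (fun x hx => hl x (hp.mem_iff.1 hx)) (by simp; omega) hs
  obtain ⟨t, v₁, v₂, r3, hv, hb, hn⟩ := tree_spec I d encV T.int fu vs
  -- The height given by `fu` suffices for all versions, so none is left over.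
  have hv2 : v₂ = [] := by
    by_contra hne
    have := hn hne
    have h6 : vs.length = v₁.length + v₂.length := by rw [hv]; simp
    have := List.length_pos_iff.2 hne
    omega
  subst hv2
  rw [List.append_nil] at hv
  subst hv
  refine ⟨t, fun o => ev_of_wp ?_, fun q qs hqs hq acc => ?_⟩
  · change wp I (prog d) cDom _ _ _
    have r2' := r2 o
    simp [cDom, ctx] at r2' ⊢
    refine ⟨_, _, _, r1 o, _, _, _, r2', _, _, _, r3 o, ?_⟩
    simp
    intro k₁ hk₁ k₂ hk₂ k₃ hk₃
    have hpos : 1 ≤ l.length := List.length_pos_iff.2 hl0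
    have e1 : (25 * fu.length + insCost bl.length G j + 50) * l.length =
      20 * l.length * (fu.length + 1) + 5 * (fu.length * l.length) +
        l.length * (insCost bl.length G j + 4) + 26 * l.length := by ring
    have e2 : fu.length ≤ fu.length * l.length := Nat.le_mul_of_pos_right _ hpos
    rw [hlen] at hk₂ h2
    omega
  · have hq0 := hq q (by simp)
    have hsub : T.minus I.W (.int q) (.int 1) = .int (q - 1) := minus_int (by rw [abs_le]; omega)
    -- Keys are integers, so the strict bound `q` is searched for as the weak bound `q - 1`.
    have hs := search_spec I d (e := encV) (key := fun v => .int v.1) (pay := fun v => v.2.2)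
      (fun _ _ => rfl) (fun _ _ => rfl) false (.int (q - 1)) (fun v => v.1 < q)
      (fun v => by simp [T.le]) hb (h3.imp fun h h' => by omega) .nil
    obtain ⟨φ', h6⟩ := h5 q
    rw [zero_add] at h6
    obtain ⟨es, r4, r5⟩ := askIn_spec (fu := fu) (d := d) hbin hVW.le j qs hqs
      (fun k hk => hq k (by simp [hk])) _ _ _ h6 (by
        intro p hp'
        rw [Multiset.mem_coe, List.mem_map] at hp'
        obtain ⟨x, hx, rfl⟩ := hp'
        have := hl x (hp.mem_iff.1 (List.mem_filter.1 hx).1)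
        exact ⟨this.1, fun k hk => (this.2 k hk).1⟩) acc
    refine ⟨es, fun o => ev_of_wp ?_, ?_⟩
    · change wp I (prog d) cAskDom _ _ _
      simp [cAskDom, hsub]
      refine ⟨_, _, _, hs o, _, _, _, r4 o, by simp; omega⟩
    · have e : (((l.filter (·.1 < q)).map Prod.snd : List X) : Multiset X) =
          ((l'.filter (·.1 < q)).map Prod.snd : List X) :=
        Multiset.coe_eq_coe.2 ((hp.symm.filter _).map _)
      rwa [e]

end

end FunLang

namespace FunLang

open Classical

/-! ### The range tree -/

/-- A point with its dominance keys, its remaining ranks and the representative of its colour. -/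
abbrev El : Type := List ℤ × List ℤ × ℕ

def encEl (x : El) : T := .node (encs .int x.1) (encs .int x.2.1) (.pt x.2.2)

/-- A point whose first rank is split off. -/
def encR (x : ℤ × El) : T :=
  .node (encs .int x.2.1) (.node (.int x.1) (encs .int x.2.2.1) .nil) (.pt x.2.2.2)

def encB (b : ℤ × ℤ) : T := .node (.int b.1) (.int b.2) .nil

/-- The point `x` is dominated by `qs` and lies within the bounds `bs`. -/
def Hit (bs : List (ℤ × ℤ)) (qs : List ℤ) (x : El) : Prop :=
  List.Forall₂ (· < ·) x.1 qs ∧ List.Forall₂ (fun b r => b.1 < r ∧ r < b.2) bs x.2.1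

noncomputable def sel (bs : List (ℤ × ℤ)) (qs : List ℤ) (l : List El) : List ℕ :=
  (l.filter (Hit bs qs ·)).map (·.2.2)

theorem sel_cons (bs : List (ℤ × ℤ)) (qs : List ℤ) (x : El) (l : List El) :
    sel bs qs (x :: l) = if Hit bs qs x then x.2.2 :: sel bs qs l else sel bs qs l := by
  unfold sel
  split_ifs with h <;> simp [h]

def unsplit (x : ℤ × El) : El := (x.2.1, x.1 :: x.2.2.1, x.2.2.2)

/-- The new key is the distance from the splitting point. The value `mid` belongs to the right part,
so on the left the distance is reduced by one, and both sides start at `0`. -/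
noncomputable def shifted (mid : ℤ) (x : ℤ × El) : El :=
  (if mid ≤ x.1 then (x.1 - mid) :: x.2.1 else (mid - x.1 - 1) :: x.2.1, x.2.2)

theorem sel_filter {bs : List (ℤ × ℤ)} {qs : List ℤ} {l : List (ℤ × El)} (p : ℤ × El → Prop)
    [DecidablePred p] (h : ∀ x ∈ l, ¬ p x → ¬ Hit bs qs (unsplit x)) :
    sel bs qs ((l.filter (p ·)).map unsplit) = sel bs qs (l.map unsplit) := by
  induction l with
  | nil => rfl
  | cons x l ih =>
    have ih := ih fun y hy => h y (by simp [hy])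
    have hx := h x (by simp)
    by_cases hp : p x
    · simp [hp, sel_cons, ih]
    · simp [hp, sel_cons, ih, hx hp]

/-- If `a < mid < b`, the lower bound is void on the right of `mid` and the upper bound is void on
its left. On either side the other condition is an upper bound on the shifted key. -/
theorem sel_cross {a b mid : ℤ} (ha : a < mid) (hb : mid < b) (bs : List (ℤ × ℤ)) (qs : List ℤ)
    (l : List (ℤ × El)) :
    (sel ((a, b) :: bs) qs (l.map unsplit)).Perm
      (sel bs ((b - mid) :: qs) ((l.filter (mid ≤ ·.1)).map (shifted mid)) ++
        sel bs ((mid - a - 1) :: qs) ((l.filter (·.1 < mid)).map (shifted mid))) := by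
  induction l with
  | nil => exact .refl _
  | cons x l ih =>
    by_cases hx : mid ≤ x.1
    · have e : Hit bs ((b - mid) :: qs) (shifted mid x) ↔ Hit ((a, b) :: bs) qs (unsplit x) := by
        simp only [Hit, shifted, unsplit, hx, if_true, List.forall₂_cons]
        constructor
        · rintro ⟨⟨h1, h2⟩, h3⟩; exact ⟨h2, ⟨by omega, by omega⟩, h3⟩
        · rintro ⟨h2, ⟨h1, h4⟩, h3⟩; exact ⟨⟨by omega, h2⟩, h3⟩
      rw [List.filter_cons_of_pos (by simpa using hx), List.filter_cons_of_neg (by simpa using hx)]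
      simp only [List.map_cons, sel_cons, e]
      split_ifs
      · exact ih.cons _
      · exact ih
    · have e : Hit bs ((mid - a - 1) :: qs) (shifted mid x) ↔ Hit ((a, b) :: bs) qs (unsplit x) := by
        simp only [Hit, shifted, unsplit, hx, if_false, List.forall₂_cons]
        constructor
        · rintro ⟨⟨h1, h2⟩, h3⟩; exact ⟨h2, ⟨by omega, by omega⟩, h3⟩
        · rintro ⟨h2, ⟨h1, h4⟩, h3⟩; exact ⟨⟨by omega, h2⟩, h3⟩
      rw [List.filter_cons_of_neg (by simpa using hx), List.filter_cons_of_pos (by simpa using hx)]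
      simp only [List.map_cons, sel_cons, e]
      split_ifs
      · exact (ih.cons _).trans List.perm_middle.symm
      · exact ih

/-- The widths of the levels of the range tree. -/
def fuel : ℕ → List ℤ
  | 0 => []
  | g + 1 => ((2 ^ g / 2 : ℕ) : ℤ) :: fuel g

theorem length_fuel (g : ℕ) : (fuel g).length = g := by
  induction g with
  | zero => rfl
  | succ g ih => simp [fuel, ih]

section

variable {I : Inp} {d : ℕ}

theorem part_spec (mid : ℤ) (l : List (ℤ × El)) :
    Pu I (prog d) fPart [encs encR l, .int mid]
      (.node (encs encR (l.filter (·.1 < mid))) (encs encR (l.filter (mid ≤ ·.1))) .nil)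
      (4 * l.length + 2) := by
  induction l with
  | nil =>
    intro o
    refine ev_of_wp ?_
    change wp I (prog d) cPart _ _ _
    simp [cPart]
  | cons x l ih =>
    intro o
    refine ev_of_wp ?_
    change wp I (prog d) cPart _ _ _
    by_cases hx : mid ≤ x.1
    · have h2 : ¬ x.1 < mid := by omega
      simp [cPart, hx, h2]
      exact ⟨_, _, _, ih o, by simp [encR, T.le, hx]; omega⟩
    · have h2 : x.1 < mid := by omega
      simp [cPart, hx, h2]
      exact ⟨_, _, _, ih o, by simp [encR, T.le, hx]; omega⟩

theorem shift_spec {mid : ℤ} (h0 : 0 ≤ mid) (hm : mid ≤ I.W) (l : List (ℤ × El))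
    (hl : ∀ x ∈ l, 0 ≤ x.1 ∧ x.1 ≤ I.W) :
    Pu I (prog d) fShift [encs encR l, .int mid] (encs encEl (l.map (shifted mid)))
      (4 * l.length + 2) := by
  induction l with
  | nil =>
    intro o
    refine ev_of_wp ?_
    change wp I (prog d) cShift _ _ _
    simp [cShift]
  | cons x l ih =>
    intro o
    have hx := hl x (by simp)
    have ih := ih fun y hy => hl y (by simp [hy])
    refine ev_of_wp ?_
    change wp I (prog d) cShift _ _ _
    by_cases hx' : mid ≤ x.1
    · have e : T.minus I.W (.int x.1) (.int mid) = .int (x.1 - mid) := minus_int (by rw [abs_le]; omega)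
      simp [cShift]
      refine ⟨_, _, _, ih o, ?_⟩
      simp [encR, encEl, shifted, T.le, hx', e]
      omega
    · have e : T.minus I.W (.int mid) (.int x.1) = .int (mid - x.1) := minus_int (by rw [abs_le]; omega)
      have e' : T.minus I.W (.int (mid - x.1)) (.int 1) = .int (mid - x.1 - 1) :=
        minus_int (by rw [abs_le]; omega)
      simp [cShift]
      refine ⟨_, _, _, ih o, ?_⟩
      simp [encR, encEl, shifted, T.le, hx', e, e']
      omega

variable {bl : List (List ℤ)} {fu : List ℤ}

/-- The lower end `-1` stands for a query that starts below all points. With these limits `mid - a -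
1` and `b - mid` are again keys between `0` and `V` at the node where the interval is split. -/
def OkBounds (V : ℤ) (b : ℤ × ℤ) : Prop := -1 ≤ b.1 ∧ b.1 ≤ V ∧ 0 ≤ b.2 ∧ b.2 ≤ V

variable (I d bl fu) in
/-- The tree `t` answers queries with `j` bounds and `c` dominance keys about the points `l`. -/
def Asks (j c A L : ℕ) (t : T) (l : List El) : Prop :=
  ∀ bs qs, bs.length = j → qs.length = c → (∀ b ∈ bs, OkBounds bl.flatten.sum b) →
    (∀ q ∈ qs, 0 ≤ q ∧ q ≤ bl.flatten.sum) → ∀ acc, ∃ es,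
    Pu I (prog d) fAsk [t, encs encB bs, encs .int qs, encE acc, ctx bl fu] (encE (es ++ acc))
      (A + 3 * es.length) ∧ Ent L es (sel bs qs l)

-- The predicate `p` restricts the intervals that can arrive at a node, namely those on one side of
-- the splitting value of its parent. This matters at the bottom, where the answer of `nil` is right
-- only for such intervals.
variable (I d bl fu) in
def Walks (j c A L : ℕ) (p : ℤ → ℤ → Prop) (t : T) (l : List (ℤ × El)) : Prop :=
  ∀ a b bs qs, p a b → bs.length = j → qs.length = c → (∀ b' ∈ (a, b) :: bs, OkBounds bl.flatten.sum b') →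
    (∀ q ∈ qs, 0 ≤ q ∧ q ≤ bl.flatten.sum) → ∀ acc, ∃ es,
    Pu I (prog d) fWalk [t, .int a, .int b, encs encB bs, encs .int qs, encE acc, ctx bl fu]
      (encE (es ++ acc)) (A + 3 * es.length) ∧ Ent L es (sel ((a, b) :: bs) qs (l.map unsplit))

theorem walks_nil {j c A L : ℕ} {p : ℤ → ℤ → Prop} {l : List (ℤ × El)}
    (h : ∀ a b, p a b → ∀ x ∈ l, ¬ (a < x.1 ∧ x.1 < b)) : Walks I d bl fu j c (A + 2) L p .nil l := by
  intro a b bs qs hp _ _ _ _ acc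
  refine ⟨[], fun o => ev_of_wp ?_, ?_⟩
  · change wp I (prog d) cWalk _ _ _
    simp [cWalk]
  · have : sel ((a, b) :: bs) qs (l.map unsplit) = [] := by
      rw [← sel_filter (fun _ => False)]
      · simp [sel]
      · intro x hx _ hh
        have := hh.2
        simp only [unsplit, List.forall₂_cons] at this
        exact h a b hp x hx this.1
    rw [this]
    exact Ent.nil _

def nodeT (mid : ℤ) (t₁ t₂ s₁ s₂ : T) : T := .node (.int mid) (.node t₁ s₁ .nil) (.node t₂ s₂ .nil)

/-- An interval on one side of `mid` descends; any other is split here, and the walk ends. Thus only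
two substructures are asked on the whole path, and a further level adds the constant `5` instead of
another multiple of `A`. -/
theorem walks_node (hVW : bl.flatten.sum < I.W) {j c A A' L : ℕ} {mid : ℤ} {t₁ t₂ s₁ s₂ : T}
    {l : List (ℤ × El)} (hm0 : 0 ≤ mid) (hmV : mid ≤ bl.flatten.sum) (hA : 2 * A + 2 ≤ A')
    (h1 : Walks I d bl fu j c A' (L + L) (fun _ b => b ≤ mid) t₁ (l.filter (·.1 < mid)))
    (h2 : Walks I d bl fu j c A' (L + L) (fun a _ => mid ≤ a) t₂ (l.filter (mid ≤ ·.1)))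
    (h3 : Asks I d bl fu j (c + 1) A L s₁ ((l.filter (·.1 < mid)).map (shifted mid)))
    (h4 : Asks I d bl fu j (c + 1) A L s₂ ((l.filter (mid ≤ ·.1)).map (shifted mid))) (p : ℤ → ℤ → Prop) :
    Walks I d bl fu j c (A' + 5) (L + L) p (nodeT mid t₁ t₂ s₁ s₂) l := by
  intro a b bs qs _ hj hc hb hq acc
  obtain ⟨b1, b2, b3, b4⟩ := hb (a, b) (by simp)
  by_cases hbm : b ≤ mid
  · obtain ⟨es, r1, r2⟩ := h1 a b bs qs hbm hj hc hb hq acc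
    refine ⟨es, fun o => ev_of_wp ?_, ?_⟩
    · change wp I (prog d) cWalk _ _ _
      simp [cWalk, nodeT, T.le, hbm]
      exact ⟨_, _, _, r1 o, by simp; omega⟩
    · rwa [sel_filter (fun x => x.1 < mid)] at r2
      intro x _ hx hh
      have := hh.2
      simp only [unsplit, List.forall₂_cons] at this
      omega
  by_cases ham : mid ≤ a
  · obtain ⟨es, r1, r2⟩ := h2 a b bs qs ham hj hc hb hq acc
    refine ⟨es, fun o => ev_of_wp ?_, ?_⟩
    · change wp I (prog d) cWalk _ _ _
      simp [cWalk, nodeT, T.le, hbm, ham]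
      exact ⟨_, _, _, r1 o, by simp; omega⟩
    · rwa [sel_filter (fun x => mid ≤ x.1)] at r2
      intro x _ hx hh
      have := hh.2
      simp only [unsplit, List.forall₂_cons] at this
      omega
  obtain ⟨es₁, r1, r2⟩ := h3 bs ((mid - a - 1) :: qs) hj (by simp [hc]) (fun b' hb' => hb b' (by simp [hb']))
    (by simp only [List.mem_cons, forall_eq_or_imp]; exact ⟨by omega, hq⟩) acc
  obtain ⟨es₂, r3, r4⟩ := h4 bs ((b - mid) :: qs) hj (by simp [hc]) (fun b' hb' => hb b' (by simp [hb']))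
    (by simp only [List.mem_cons, forall_eq_or_imp]; exact ⟨by omega, hq⟩) (es₁ ++ acc)
  have e1 : T.minus I.W (.int mid) (.int a) = .int (mid - a) := minus_int (by rw [abs_le]; omega)
  have e2 : T.minus I.W (.int (mid - a)) (.int 1) = .int (mid - a - 1) := minus_int (by rw [abs_le]; omega)
  have e3 : T.minus I.W (.int b) (.int mid) = .int (b - mid) := minus_int (by rw [abs_le]; omega)
  refine ⟨es₂ ++ es₁, fun o => ev_of_wp ?_, ?_⟩
  · change wp I (prog d) cWalk _ _ _
    simp [cWalk, nodeT, T.le, hbm, ham, e1, e2, e3]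
    exact ⟨_, _, _, r1 o, _, _, _, r3 o, by simp; omega⟩
  · rw [Multiset.coe_eq_coe.2 (sel_cross (not_le.1 ham) (not_le.1 hbm) bs qs l), ← Multiset.coe_add]
    exact r4.append r2

/-- The points of the structures with `j` remaining ranks. -/
def OkEl (V : ℤ) (j c : ℕ) (x : El) : Prop :=
  x.1.length = c ∧ x.2.1.length = j ∧ (∀ k ∈ x.1, 0 ≤ k ∧ k ≤ V) ∧ ∀ k ∈ x.2.1, 0 ≤ k ∧ k ≤ V

/-- Each point enters one substructure per level, so a range tree multiplies the construction cost
by the number of levels. A node at level `g > 0` covers `2 ^ (g - 1)` ranks. The last width is `0`: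
at a node with a single rank `mid = lo`, so its points go to the right substructure and can still be
found. -/
theorem split_spec (hVW : bl.flatten.sum < I.W) {j c A L B m : ℕ}
    (hS : ∀ l : List El, (∀ x ∈ l, OkEl bl.flatten.sum j (c + 1) x) → l.length ≤ m → ∃ t,
      Pu I (prog d) fStruct [encs encEl l, ctx bl fu] t (B * l.length + 2) ∧
        Asks I d bl fu j (c + 1) A L t l) (g : ℕ) :
    ∀ (lo : ℤ) (l : List (ℤ × El)), 0 ≤ lo → lo + 2 ^ (g - 1) ≤ bl.flatten.sum + 1 →
      (∀ x ∈ l, lo ≤ x.1 ∧ x.1 < lo + 2 ^ (g - 1) ∧ OkEl bl.flatten.sum j c x.2) → l.length ≤ m → ∃ t,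
      Pu I (prog d) fSplit [encs encR l, encs .int (fuel g), .int lo, ctx bl fu] t
        (g * (B + 32) * l.length + 3) ∧
      Walks I d bl fu j c (2 * A + 2 + 5 * g) (L + L)
        (fun a b => g = 0 → ∀ x ∈ l, ¬ (a < x.1 ∧ x.1 < b)) t l := by
  induction g with
  | zero =>
    intro lo l _ _ _ _
    refine ⟨.nil, fun o => ev_of_wp ?_, ?_⟩
    · change wp I (prog d) cSplit _ _ _
      simp [cSplit, fuel]
    · exact walks_nil (A := 2 * A) fun a b h => h rfl
  | succ g ih =>
    intro lo l hlo hlo' hl hm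
    cases l with
    | nil =>
      refine ⟨.nil, fun o => ev_of_wp ?_, ?_⟩
      · change wp I (prog d) cSplit _ _ _
        simp [cSplit]
      · have := walks_nil (I := I) (d := d) (bl := bl) (fu := fu) (j := j) (c := c)
          (A := 2 * A + 5 * (g + 1)) (L := L + L) (p := fun a b => g + 1 = 0 → ∀ x ∈ ([] : List (ℤ × El)),
            ¬ (a < x.1 ∧ x.1 < b)) (l := []) (by simp)
        convert this using 1
        omega
    | cons y l =>
      set L₀ := y :: l with hL₀
      clear_value L₀
      have hne : L₀ ≠ [] := by simp [hL₀]
      have hpos := List.length_pos_iff.2 hne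
      set mid : ℤ := lo + ((2 ^ g / 2 : ℕ) : ℤ) with hmid
      have hg2 : ((2 : ℤ) ^ (g + 1 - 1)) = 2 ^ g := by simp
      rw [hg2] at hlo' hl
      -- The first case is the level of single ranks, the second the halving of an interval of `2 ^
      -- g` ranks.
      have hw : (mid = lo ∧ g = 0) ∨ (mid = lo + 2 ^ (g - 1) ∧ mid + 2 ^ (g - 1) = lo + 2 ^ g ∧ g ≠ 0) := by
        rcases g with _ | g
        · left; simp [hmid]
        · right
          have : (2 : ℕ) ^ (g + 1) / 2 = 2 ^ g := by rw [pow_succ]; simp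
          rw [this] at hmid
          push_cast at hmid
          simp only [Nat.add_sub_cancel]
          exact ⟨hmid, by rw [hmid, pow_succ]; ring, by simp⟩
      have hp1 : (0 : ℤ) < 2 ^ (g - 1) := by positivity
      have hp2 : (0 : ℤ) < 2 ^ g := by positivity
      have hg0 : g = 0 → (2 : ℤ) ^ g = 1 ∧ (2 : ℤ) ^ (g - 1) = 1 := by rintro rfl; simp
      have hm1 : (L₀.filter (·.1 < mid)).length ≤ L₀.length := List.length_filter_le _ _
      have hm2 : (L₀.filter (mid ≤ ·.1)).length ≤ L₀.length := List.length_filter_le _ _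
      have hm12 : (L₀.filter (·.1 < mid)).length + (L₀.filter (mid ≤ ·.1)).length = L₀.length := by
        clear hL₀ hl hm hne hpos hm1 hm2
        induction L₀ with
        | nil => rfl
        | cons x l ih =>
          by_cases hx : x.1 < mid
          · have : ¬ mid ≤ x.1 := by omega
            simp [hx, this]; omega
          · have : mid ≤ x.1 := by omega
            simp [hx, this]; omega
      have mem1 : ∀ x ∈ L₀.filter (·.1 < mid), x ∈ L₀ ∧ x.1 < mid := fun x hx => by simpa using hx
      have mem2 : ∀ x ∈ L₀.filter (mid ≤ ·.1), x ∈ L₀ ∧ mid ≤ x.1 := fun x hx => by simpa using hx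
      obtain ⟨t₁, r1, w1⟩ := ih lo (L₀.filter (·.1 < mid)) hlo (by
          rcases hw with ⟨_, h0⟩ | ⟨_, _, _⟩
          · have := hg0 h0; omega
          · omega) (fun x hx => by
          obtain ⟨ha, hb⟩ := mem1 x hx
          obtain ⟨h1, h2, h3⟩ := hl x ha
          exact ⟨h1, by omega, h3⟩) (by omega)
      obtain ⟨t₂, r2, w2⟩ := ih mid (L₀.filter (mid ≤ ·.1)) (by omega) (by
          rcases hw with ⟨_, h0⟩ | ⟨_, _, _⟩
          · have := hg0 h0; omega
          · omega) (fun x hx => by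
          obtain ⟨ha, hb⟩ := mem2 x hx
          obtain ⟨h1, h2, h3⟩ := hl x ha
          refine ⟨hb, ?_, h3⟩
          rcases hw with ⟨_, h0⟩ | ⟨_, _, _⟩
          · have := hg0 h0; omega
          · omega) (by omega)
      have hmV : mid ≤ bl.flatten.sum := by
        rcases hw with ⟨_, h0⟩ | ⟨_, _, _⟩ <;> omega
      have hok : ∀ x ∈ L₀, OkEl bl.flatten.sum j (c + 1) (shifted mid x) := by
        intro x hx
        obtain ⟨h1, h2, h3, h4, h5, h6⟩ := hl x hx
        refine ⟨?_, h4, ?_, h6⟩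
        · unfold shifted; split_ifs <;> simp [h3]
        · unfold shifted
          split_ifs
          · simp only [List.mem_cons, forall_eq_or_imp]; exact ⟨by omega, h5⟩
          · simp only [List.mem_cons, forall_eq_or_imp]; exact ⟨by omega, h5⟩
      obtain ⟨s₁, r3, a1⟩ := hS ((L₀.filter (·.1 < mid)).map (shifted mid)) (by
          simp only [List.mem_map]; rintro _ ⟨x, hx, rfl⟩; exact hok x (mem1 x hx).1)
        (by simp; omega)
      obtain ⟨s₂, r4, a2⟩ := hS ((L₀.filter (mid ≤ ·.1)).map (shifted mid)) (by
          simp only [List.mem_map]; rintro _ ⟨x, hx, rfl⟩; exact hok x (mem2 x hx).1)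
        (by simp; omega)
      have hWl : ∀ x ∈ L₀, 0 ≤ x.1 ∧ x.1 ≤ I.W := fun x hx => by
        obtain ⟨h1, h2, -⟩ := hl x hx
        omega
      have hpl : T.plus I.W (.int lo) (.int ((2 ^ g / 2 : ℕ) : ℤ)) = .int mid :=
        plus_int (by rw [← hmid, abs_le]; omega)
      refine ⟨nodeT mid t₁ t₂ s₁ s₂, fun o => ev_of_wp ?_, ?_⟩
      · have hnn : encs encR L₀ ≠ .nil := by rw [hL₀]; simp
        have hpl' : T.plus I.W (.int lo) (.int (2 ^ g / 2)) = .int mid := by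
          rw [← hpl]; push_cast; rfl
        change wp I (prog d) cSplit _ _ _
        simp [cSplit, fuel, hnn, hpl']
        refine ⟨_, _, _, part_spec mid L₀ o, _, _, _, r1 o, _, _, _, r2 o, _, _, _,
          shift_spec (by omega) (by omega) _ (fun x hx => hWl x (mem1 x hx).1) o, _, _, _,
          shift_spec (by omega) (by omega) _ (fun x hx => hWl x (mem2 x hx).1) o, _, _, _,
          r3 o, _, _, _, r4 o, ?_⟩
        simp [nodeT]
        intro k₁ hk₁ k₂ hk₂ k₃ hk₃ k₄ hk₄ k₅ hk₅ k₆ hk₆ k₇ hk₇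
        have e1 : (g + 1) * (B + 32) * L₀.length = g * (B + 32) * L₀.length + B * L₀.length
          + 32 * L₀.length := by ring
        rw [e1, ← hm12]
        set m₁ := (L₀.filter (·.1 < mid)).length
        set m₂ := (L₀.filter (mid ≤ ·.1)).length
        have e2 : g * (B + 32) * (m₁ + m₂) = g * (B + 32) * m₁ + g * (B + 32) * m₂ := by ring
        have e3 : B * (m₁ + m₂) = B * m₁ + B * m₂ := by ring
        rw [e2, e3]
        omega
      · have := walks_node (A' := 2 * A + 2 + 5 * g) hVW (by omega) hmV (by omega)
          (fun a b bs qs hab => w1 a b bs qs (fun h0 x hx => by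
            have := (mem1 x hx)
            have := (hl x this.1).1
            rcases hw with ⟨_, _⟩ | ⟨_, _, h⟩
            · omega
            · exact absurd h0 h))
          (fun a b bs qs hab => w2 a b bs qs (fun h0 x hx => by
            have := (mem2 x hx)
            have := (hl x this.1).2.1
            rcases hw with ⟨_, _⟩ | ⟨_, _, h⟩
            · have := hg0 h0; omega
            · exact absurd h0 h)) a1 a2
          (fun a b => g + 1 = 0 → ∀ x ∈ L₀, ¬ (a < x.1 ∧ x.1 < b))
        convert this using 1
        ring

def structCost (F K : ℕ) : ℕ → ℕ
  | 0 => 25 * F + K + 54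
  | j + 1 => F * (structCost F K j + 32) + 5

def asksCost (F A : ℕ) : ℕ → ℕ
  | 0 => A + 4 * F + 8
  | j + 1 => 2 * asksCost F A j + 5 * F + 5

theorem asks_zero {c A L : ℕ} {t : T} {l : List El}
    (h : ∀ (q : ℤ) (qs : List ℤ), qs.length = c → (∀ k ∈ q :: qs, 0 ≤ k ∧ k ≤ bl.flatten.sum) → ∀ acc, ∃ es,
        Pu I (prog d) fAskDom [t, encs .int (q :: qs), encE acc, ctx bl fu] (encE (es ++ acc))
          (A + 3 * es.length) ∧ Ent L es (sel [] (q :: qs) l)) :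
    Asks I d bl fu 0 (c + 1) (A + 3) L t l := by
  intro bs qs hbs hqs _ hq acc
  obtain rfl : bs = [] := by simpa using hbs
  cases qs with
  | nil => simp at hqs
  | cons q qs =>
    obtain ⟨es, r1, r2⟩ := h q qs (by simpa using hqs) hq acc
    refine ⟨es, fun o => ev_of_wp ?_, r2⟩
    change wp I (prog d) cAsk _ _ _
    simp [cAsk]
    exact ⟨_, _, _, r1 o, by simp; omega⟩

theorem asks_succ {j c A L : ℕ} {t : T} {l : List (ℤ × El)}
    (h : Walks I d bl fu j c A L (fun _ _ => True) t l) :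
    Asks I d bl fu (j + 1) c (A + 3) L t (l.map unsplit) := by
  intro bs qs hbs hqs hb hq acc
  cases bs with
  | nil => simp at hbs
  | cons b bs =>
    obtain ⟨es, r1, r2⟩ := h b.1 b.2 bs qs trivial (by simpa using hbs) hqs hb hq acc
    refine ⟨es, fun o => ev_of_wp ?_, r2⟩
    change wp I (prog d) cAsk _ _ _
    simp [cAsk, encB]
    exact ⟨_, _, _, r1 o, by simp; omega⟩

/-- A range tree turns one rank into one dominance key, so `j + c` is constant. Without ranks there
are `m + 1` keys, one for the sweep and `m` for the persistent structure. Each rank doubles the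
number of substructures asked, hence `2 ^ j`. -/
theorem struct_spec (hsc : I.sc = d + 2) {G H m n : ℕ} (hG : ∀ b ∈ bl, 2 ^ b.length ≤ G)
    (hbin : Bin bl.flatten) (hVW : bl.flatten.sum < I.W) (hfu : fu = fuel (H + 1))
    (hH : bl.flatten.sum + 1 = 2 ^ H) (hn : n < 2 ^ (H + 1)) (hnW : n ≤ I.W) (j : ℕ) :
    ∀ c, j + c = m + 1 → ∀ l : List El, (∀ x ∈ l, OkEl bl.flatten.sum j c x) → l.length ≤ n → ∃ t,
      Pu I (prog d) fStruct [encs encEl l, ctx bl fu] t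
        (structCost (H + 1) (insCost bl.length G m) j * l.length + 2) ∧
      Asks I d bl fu j c (asksCost (H + 1) (askCost bl.length bl.flatten.length m) j)
        (2 ^ j * (bl.length ^ m * 2)) t l := by
  have hF : fu.length = H + 1 := by rw [hfu, length_fuel]
  induction j with
  | zero =>
    rintro c hc l hl hln
    obtain rfl : c = m + 1 := by omega
    have hrk : ∀ x ∈ l, x.2.1 = [] := fun x hx => List.length_eq_zero_iff.1 (hl x hx).2.1
    cases l with
    | nil =>
      refine ⟨.nil, fun o => ev_of_wp ?_, asks_zero (A := askCost bl.length bl.flatten.length m + 4 * (H + 1) + 5)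
        fun q qs hqs hq acc => ⟨[], ?_, by simpa [sel] using Ent.nil _⟩⟩
      · change wp I (prog d) cStruct _ _ _
        simp [cStruct]
      · exact (askDom_nil hbin hVW q qs hqs hq acc).mono (by simp)
    | cons y l =>
      set l₀ := y :: l with hl₀
      set f : El → ℤ × X := fun x => (x.1.headD 0, x.1.tail, x.2.2) with hf
      have hcons : ∀ x ∈ l₀, ∃ k ks, x = (k :: ks, [], x.2.2) ∧ ks.length = m ∧
          ∀ k' ∈ k :: ks, 0 ≤ k' ∧ k' ≤ bl.flatten.sum := by
        rintro ⟨ks, rs, a⟩ hx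
        have h1 := hrk _ hx
        obtain ⟨h2, _, h3, _⟩ := hl _ hx
        simp only at h1 h2 h3
        cases ks with
        | nil => simp at h2
        | cons k ks => exact ⟨k, ks, by rw [h1], by simpa using h2, h3⟩
      have hD : encs encEl l₀ = encs encD (l₀.map f) := encs_congr f fun x hx => by
        obtain ⟨k, ks, h, -⟩ := hcons x hx
        rw [h]; rfl
      obtain ⟨t, r1, r2⟩ := dom_spec (I := I) (d := d) (fu := fu) hsc hG hbin hVW m (l₀.map f)
        (by simp [hl₀]) (by
          simp only [List.mem_map]
          rintro _ ⟨x, hx, rfl⟩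
          obtain ⟨k, ks, h, h1, h2⟩ := hcons x hx
          rw [h]
          exact ⟨h1, fun k' hk' => h2 k' (List.mem_cons_of_mem _ hk')⟩)
        (by simp; omega) (by rw [List.length_map, hF]; omega)
      refine ⟨t, fun o => ev_of_wp ?_, asks_zero (A := askCost bl.length bl.flatten.length m + 4 * (H + 1) + 5)
        fun q qs hqs hq acc => ?_⟩
      · have hy : y.2.1 = [] := hrk y (by simp [hl₀])
        have hne : encs encEl l₀ ≠ .nil := by simp [hl₀]
        have hh : I.look (fun _ => .nil) (I.look (fun _ => .nil) (encs encEl l₀) 0) 1 = .nil := by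
          simp [hl₀, encEl, hy]
        have r1 := r1 o
        rw [← hD, hF] at r1
        change wp I (prog d) cStruct _ _ _
        simp [cStruct, hne, hh]
        refine ⟨_, _, _, r1, ?_⟩
        simp [structCost]
        intro k hk
        have e1 : (25 * (H + 1) + insCost bl.length G m + 54) * l₀.length =
          (25 * (H + 1) + insCost bl.length G m + 50) * l₀.length + 4 * l₀.length := by ring
        have e2 : 1 ≤ l₀.length := by simp [hl₀]
        omega
      · obtain ⟨es, r3, r4⟩ := r2 q qs hqs hq acc
        refine ⟨es, r3.mono (by rw [hF]), ?_⟩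
        have e : ((sel [] (q :: qs) l₀ : List ℕ) : Multiset ℕ) =
            ans qs (((l₀.map f).filter (·.1 < q)).map Prod.snd : List X) := by
          unfold ans sel
          simp only [Multiset.filter_coe, Multiset.map_coe, List.filter_map, List.map_map, List.filter_filter]
          congr 2
          refine List.filter_congr fun x hx => ?_
          obtain ⟨k, ks, h, -⟩ := hcons x hx
          rw [h]
          rw [Bool.eq_iff_iff]
          simp [Hit, hf, and_comm]
          exact and_congr decide_eq_true_iff.symm decide_eq_true_iff.symm
        rw [e]
        simpa using r4
  | succ j ih =>
    rintro c hc l hl hln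
    have hS := ih (c + 1) (by omega)
    cases l with
    | nil =>
      refine ⟨.nil, fun o => ev_of_wp ?_, ?_⟩
      · change wp I (prog d) cStruct _ _ _
        simp [cStruct]
      · have := asks_succ (walks_nil (I := I) (d := d) (bl := bl) (fu := fu) (j := j) (c := c)
          (A := 2 * asksCost (H + 1) (askCost bl.length bl.flatten.length m) j + 5 * (H + 1))
          (L := 2 ^ (j + 1) * (bl.length ^ m * 2)) (p := fun _ _ => True) (l := []) (by simp))
        simpa [asksCost] using this
    | cons y l =>
      set l₀ := y :: l with hl₀
      set f : El → ℤ × El := fun x => (x.2.1.headD 0, x.1, x.2.1.tail, x.2.2) with hf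
      have hcons : ∀ x ∈ l₀, ∃ k ks, x = (x.1, k :: ks, x.2.2) ∧ 0 ≤ k ∧ k ≤ bl.flatten.sum ∧
          OkEl bl.flatten.sum j c (x.1, ks, x.2.2) := by
        rintro ⟨ks, rs, a⟩ hx
        obtain ⟨h2, h1, h3, h4⟩ := hl _ hx
        simp only at h1 h2 h3 h4
        cases rs with
        | nil => simp at h1
        | cons k rs =>
          have hk := h4 k (by simp)
          exact ⟨k, rs, rfl, hk.1, hk.2, h2, by simpa using h1, h3,
            fun k' hk' => h4 k' (List.mem_cons_of_mem _ hk')⟩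
      have hD : encs encEl l₀ = encs encR (l₀.map f) := encs_congr f fun x hx => by
        obtain ⟨k, ks, h, -⟩ := hcons x hx
        rw [h]; rfl
      have hU : (l₀.map f).map unsplit = l₀ := by
        rw [List.map_map]
        conv_rhs => rw [← List.map_id l₀]
        refine List.map_congr_left fun x hx => ?_
        obtain ⟨k, ks, h, -⟩ := hcons x hx
        rw [h]; rfl
      obtain ⟨t, r1, r2⟩ := split_spec hVW (m := n) (fu := fu) (d := d) hS (H + 1) 0 (l₀.map f) le_rfl
        (by rw [zero_add, hH, Nat.add_sub_cancel]) (by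
          simp only [List.mem_map]
          rintro _ ⟨x, hx, rfl⟩
          obtain ⟨k, ks, h, h1, h2, h3⟩ := hcons x hx
          rw [h]
          exact ⟨h1, by simp only [hf, List.headD_cons, Nat.add_sub_cancel]; omega, h3⟩) (by simpa using hln)
      refine ⟨t, fun o => ev_of_wp ?_, ?_⟩
      · obtain ⟨k, ks, h, -⟩ := hcons y (by simp [hl₀])
        have hne : encs encEl l₀ ≠ .nil := by simp [hl₀]
        have hh : I.look (fun _ => .nil) (I.look (fun _ => .nil) (encs encEl l₀) 0) 1 ≠ .nil := by
          simp only [hl₀, encs_cons, look_node_zero]; rw [h]; simp [encEl]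
        have r1 := r1 o
        rw [← hD, ← hfu] at r1
        change wp I (prog d) cStruct _ _ _
        have e0 : I.look (fun _ => .nil) (ctx bl fu) 1 = encs T.int fu := rfl
        simp [cStruct, hne, hh, e0]
        refine ⟨_, _, _, r1, ?_⟩
        simp [structCost]
        intro k hk
        have e1 : ((H + 1) * (structCost (H + 1) (insCost bl.length G m) j + 32) + 5) * l₀.length =
          (H + 1) * (structCost (H + 1) (insCost bl.length G m) j + 32) * l₀.length + 5 * l₀.length := by ring
        have e2 : 1 ≤ l₀.length := by simp [hl₀]
        omega
      · have h1 : Walks I d bl fu j c (2 * asksCost (H + 1) (askCost bl.length bl.flatten.length m) j + 2 +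
            5 * (H + 1)) (2 ^ j * (bl.length ^ m * 2) + 2 ^ j * (bl.length ^ m * 2)) (fun _ _ => True) t
            (l₀.map f) := fun a b bs qs _ => r2 a b bs qs (by simp)
        have h2 := asks_succ h1
        rw [hU] at h2
        convert h2 using 1
        · simp only [asksCost]; ring
        · ring

end

end FunLang

namespace FunLang

open Classical

/-! ### Preparation of the points -/

theorem listEx_eval (I : Inp) (env : List T) (μ : ℕ → T) (l : List Ex) :
    (listEx l).eval I env μ = encs id (l.map (Ex.eval I env μ)) := by
  induction l with
  | nil => rfl
  | cons e l ih => simp only [listEx, List.foldr_cons] at ih ⊢; simp [ih]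

/-- The point `a` with the coordinates `ks`, the ranks `rs`, and the representative `ρ a`. -/
def enc (ρ : ℕ → ℕ) (ks : List (ℕ → ℝ)) (rs : List (ℕ → ℤ)) (a : ℕ) : T :=
  .node (encs T.real (ks.map (· a))) (encs T.int (rs.map (· a))) (.pt (ρ a))

def encC (κ : ℕ → ℕ) (ks : List (ℕ → ℝ)) (a : ℕ) : T :=
  .node (.node (.col (κ a)) (encs T.real (ks.map (· a))) .nil) .nil (.pt a)

section

variable {I : Inp} {d : ℕ}

theorem read_spec {κ : ℕ → ℕ} {x : ℕ → ℕ → ℝ} (hsc : I.sc = d + 2)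
    (hx : ∀ a < I.n, ∀ j < d, I.cell a j = .real (x j a)) (hκ : ∀ a < I.n, I.cell a d = .col (κ a))
    (hl : ∀ a < I.n, I.cell a (d + 1) = if a + 1 < I.n then .pt (a + 1) else .nil) (m : ℕ) :
    ∀ a, a + m = I.n → Pu I (prog d) fRead [if a < I.n then .pt a else .nil]
      (encs (encC κ ((List.range d).map x)) (List.range' a m)) (3 * m + 2) := by
  induction m with
  | zero =>
    intro a ha o
    refine ev_of_wp ?_
    change wp I (prog d) (cRead d) _ _ _
    have : ¬ a < I.n := by omega
    simp [cRead, this]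
  | succ m ih =>
    intro a ha o
    have han : a < I.n := by omega
    refine ev_of_wp ?_
    change wp I (prog d) (cRead d) _ _ _
    have e1 : I.field (fun _ => .nil) a (d + 1) = if a + 1 < I.n then .pt (a + 1) else .nil := by
      rw [Inp.field, if_neg (by omega), hl a han]
    have e2 : I.field (fun _ => .nil) a d = .col (κ a) := by
      rw [Inp.field, if_neg (by omega), hκ a han]
    have e3 : (List.range d).map (fun j => I.field (fun _ => .nil) a j) =
        ((List.range d).map fun j => x j a).map T.real := by
      rw [List.map_map]
      refine List.map_congr_left fun j hj => ?_
      have := List.mem_range.1 hj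
      rw [Inp.field, if_neg (by omega), hx a han j this]
      rfl
    simp [cRead, han, e1]
    refine ⟨_, _, _, ih (a + 1) (by omega) o, ?_⟩
    simp only [keysEx, listEx_eval, List.map_cons, List.map_map, Function.comp_def]
    refine fun k hk => ⟨?_, trivial, by omega⟩
    simp [List.range'_succ, encC]
    refine ⟨e2, ?_⟩
    rw [e3, encs_map]
    rfl

/-- In a list sorted by colour each colour occupies a run, and its first point becomes the
representative. Colours cannot serve as addresses, so it is this point that provides the counter of
its colour. -/
theorem reps_spec {κ : ℕ → ℕ} {ks : List (ℕ → ℝ)} {N : ℕ} (l : List ℕ) : ∀ c p, κ p = c → p < N →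
    (∀ a ∈ l, c ≤ κ a ∧ a < N) → l.Pairwise (fun a b => κ a ≤ κ b) → ∃ σ : ℕ → ℕ, σ c = p ∧
      (∀ a ∈ l, κ (σ (κ a)) = κ a ∧ σ (κ a) < N) ∧
      Pu I (prog d) fReps [encs (encC κ ks) l, .col c, .pt p] (encs (enc (fun a => σ (κ a)) ks []) l)
        (4 * l.length + 2) := by
  induction l with
  | nil =>
    intro c p _ _ _ _
    refine ⟨fun _ => p, rfl, by simp, fun o => ev_of_wp ?_⟩
    change wp I (prog d) cReps _ _ _
    simp [cReps]
  | cons a l ih =>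
    intro c p hcp hp hl hs
    rw [List.pairwise_cons] at hs
    have ha := hl a (by simp)
    by_cases h : κ a ≤ c
    · have hac : κ a = c := by omega
      obtain ⟨σ, h1, h2, h3⟩ := ih c p hcp hp (fun b hb => hl b (by simp [hb])) hs.2
      refine ⟨σ, h1, ?_, fun o => ev_of_wp ?_⟩
      · simp only [List.mem_cons, forall_eq_or_imp]
        exact ⟨by rw [hac, h1]; exact ⟨hcp, hp⟩, h2⟩
      · change wp I (prog d) cReps _ _ _
        simp [cReps, encC, T.le, h]
        exact ⟨_, _, _, h3 o, by simp [enc, hac, h1]; omega⟩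
    · obtain ⟨σ, h1, h2, h3⟩ := ih (κ a) a rfl ha.2 (fun b hb => ⟨hs.1 b hb, (hl b (by simp [hb])).2⟩) hs.2
      -- All later colours exceed `c`, so the value at `c` can be prescribed afterwards.
      have hne : ∀ b ∈ a :: l, Function.update σ c p (κ b) = σ (κ b) := by
        intro b hb
        rw [Function.update_of_ne]
        rcases List.mem_cons.1 hb with rfl | hb
        · omega
        · have := hs.1 b hb; omega
      refine ⟨Function.update σ c p, by simp, ?_, fun o => ev_of_wp ?_⟩
      · intro b hb
        rw [hne b hb]
        rcases List.mem_cons.1 hb with rfl | hb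
        · rw [h1]; exact ⟨rfl, ha.2⟩
        · exact h2 b hb
      · have e : encs (enc (fun a => Function.update σ c p (κ a)) ks []) l =
            encs (enc (fun a => σ (κ a)) ks []) l := by
          conv_rhs => rw [← List.map_id l]
          exact encs_congr id fun b hb => by simp [enc, hne b (by simp [hb])]
        change wp I (prog d) cReps _ _ _
        simp [cReps, encC, T.le, h]
        exact ⟨_, _, _, h3 o, by simp [enc, hne a (by simp), h1]; exact fun k hk => ⟨e.symm, by omega⟩⟩

theorem reps_start_spec {κ : ℕ → ℕ} {ks : List (ℕ → ℝ)} {N : ℕ} (l : List ℕ) (hl : ∀ a ∈ l, a < N)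
    (hs : l.Pairwise (fun a b => κ a ≤ κ b)) : ∃ σ : ℕ → ℕ,
      (∀ a ∈ l, κ (σ (κ a)) = κ a ∧ σ (κ a) < N) ∧
      Pu I (prog d) fReps [encs (encC κ ks) l, .nil, .nil] (encs (enc (fun a => σ (κ a)) ks []) l)
        (4 * l.length + 2) := by
  cases l with
  | nil =>
    refine ⟨id, by simp, fun o => ev_of_wp ?_⟩
    change wp I (prog d) cReps _ _ _
    simp [cReps]
  | cons a l =>
    rw [List.pairwise_cons] at hs
    have ha := hl a (by simp)
    obtain ⟨σ, h1, h2, h3⟩ := reps_spec (I := I) (d := d) (ks := ks) l (κ a) a rfl ha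
      (fun b hb => ⟨hs.1 b hb, hl b (by simp [hb])⟩) hs.2
    refine ⟨σ, ?_, fun o => ev_of_wp ?_⟩
    · simp only [List.mem_cons, forall_eq_or_imp]
      exact ⟨by rw [h1]; exact ⟨rfl, ha⟩, h2⟩
    · change wp I (prog d) cReps _ _ _
      simp [cReps, encC, T.le]
      exact ⟨_, _, _, h3 o, by simp [enc, h1]; omega⟩

variable {ρ : ℕ → ℕ} {ks : List (ℕ → ℝ)} {rs : List (ℕ → ℤ)}

theorem number_spec {r : ℕ → ℤ} (l : List ℕ) : ∀ i : ℕ, i + l.length ≤ I.W →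
    (∀ j (h : j < l.length), r l[j] = i + j) →
    Pu I (prog d) fNumber [encs (enc ρ ks rs) l, .int i] (encs (enc ρ ks (r :: rs)) l) (3 * l.length + 2) := by
  induction l with
  | nil =>
    intro i _ _ o
    refine ev_of_wp ?_
    change wp I (prog d) cNumber _ _ _
    simp [cNumber]
  | cons a l ih =>
    intro i hi hr o
    simp only [List.length_cons] at hi
    have h0 : r a = i := (hr 0 (Nat.zero_lt_succ _)).trans (by simp)
    have ih := ih (i + 1) (by omega) (fun j h => by
      have := hr (j + 1) (by simpa using h)
      simp only [List.getElem_cons_succ] at this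
      rw [this]; push_cast; ring)
    have hpl : T.plus I.W (.int i) (.int 1) = .int ((i + 1 : ℕ) : ℤ) := by
      rw [plus_int]
      · push_cast; rfl
      · rw [abs_of_nonneg (by positivity)]; omega
    refine ev_of_wp ?_
    change wp I (prog d) cNumber _ _ _
    simp [cNumber, hpl]
    exact ⟨_, _, _, ih o, by simp [enc, h0]; omega⟩

theorem drop_spec {k : ℕ → ℝ} (l : List ℕ) :
    Pu I (prog d) fDrop [encs (enc ρ (k :: ks) rs) l] (encs (enc ρ ks rs) l) (3 * l.length + 2) := by
  induction l with
  | nil =>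
    intro o
    refine ev_of_wp ?_
    change wp I (prog d) cDrop _ _ _
    simp [cDrop]
  | cons a l ih =>
    intro o
    refine ev_of_wp ?_
    change wp I (prog d) cDrop _ _ _
    simp [cDrop]
    exact ⟨_, _, _, ih o, by simp [enc]; omega⟩

/-- The tree `t` finds the ranks of the coordinate `k`. -/
def Ranks (I : Inp) (d N C : ℕ) (l : List ℕ) (t : T) (k : ℕ → ℝ) (r : ℕ → ℤ) : Prop :=
  (∀ a ∈ l, 0 ≤ r a ∧ r a < N) ∧
  (∀ x : ℝ, ∃ z : ℤ, Pu I (prog d) (fSearch false) [t, .real x, .int (-1)] (.int z) C ∧ -1 ≤ z ∧ z < N ∧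
    ∀ a ∈ l, k a ≤ x ↔ r a ≤ z) ∧
  ∀ x : ℝ, ∃ z : ℤ, Pu I (prog d) (fSearch true) [t, .real x, .int (-1)] (.int z) C ∧ -1 ≤ z ∧ z < N ∧
    ∀ a ∈ l, k a < x ↔ r a ≤ z

theorem Ranks.mono {N C : ℕ} {l l' : List ℕ} {t : T} {k : ℕ → ℝ} {r : ℕ → ℤ} (h : Ranks I d N C l t k r)
    (hl : ∀ a ∈ l', a ∈ l) : Ranks I d N C l' t k r := by
  obtain ⟨h1, h2, h3⟩ := h
  refine ⟨fun a ha => h1 a (hl a ha), fun x => ?_, fun x => ?_⟩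
  · obtain ⟨z, z1, z2, z3, z4⟩ := h2 x
    exact ⟨z, z1, z2, z3, fun a ha => z4 a (hl a ha)⟩
  · obtain ⟨z, z1, z2, z3, z4⟩ := h3 x
    exact ⟨z, z1, z2, z3, fun a ha => z4 a (hl a ha)⟩

/-- The points with `p` form an initial segment of consecutive ranks, so `p` is equivalent to a
bound on the rank. For `i = 0` the default `i - 1` is the `-1` that stands for an empty segment. -/
theorem foldl_rank {r : ℕ → ℤ} {p : ℕ → Prop} [DecidablePred p] (l : List ℕ) : ∀ i : ℤ,
    (∀ j (h : j < l.length), r l[j] = i + j) → l.Pairwise (fun a b => p b → p a) →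
    (l.filter (p ·)).foldl (fun _ a => T.int (r a)) (.int (i - 1)) = .int (i - 1 + (l.filter (p ·)).length) ∧
    ∀ a ∈ l, p a ↔ r a ≤ i - 1 + (l.filter (p ·)).length := by
  induction l with
  | nil => simp
  | cons a l ih =>
    intro i hr hs
    rw [List.pairwise_cons] at hs
    have h0 : r a = i := (hr 0 (Nat.zero_lt_succ _)).trans (by simp)
    have hr' : ∀ j (h : j < l.length), r l[j] = i + 1 + j := fun j h => by
      have := hr (j + 1) (by simpa using h)
      simp only [List.getElem_cons_succ] at this
      rw [this]; push_cast; ring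
    obtain ⟨h1, h2⟩ := ih (i + 1) hr' hs.2
    by_cases hp : p a
    · rw [List.filter_cons_of_pos (by simpa using hp)]
      rw [add_sub_cancel_right] at h1 h2
      refine ⟨?_, ?_⟩
      · rw [List.foldl_cons, h0, h1]; congr 1; simp only [List.length_cons]; push_cast; ring
      · simp only [List.mem_cons, forall_eq_or_imp, hp, true_iff, List.length_cons]
        refine ⟨by rw [h0]; push_cast; omega, fun b hb => ?_⟩
        rw [h2 b hb]; push_cast; constructor <;> intro <;> omega
    · have e : (a :: l).filter (p ·) = [] := List.filter_eq_nil_iff.2 fun b hb => by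
        rcases List.mem_cons.1 hb with rfl | hb
        · simpa using hp
        · simpa using mt (hs.1 b hb) hp
      rw [e]
      refine ⟨by simp, fun b hb => ?_⟩
      have hb' : ¬ p b := by
        rcases List.mem_cons.1 hb with rfl | hb
        · exact hp
        · exact mt (hs.1 b hb) hp
      obtain ⟨j, hj, rfl⟩ := List.getElem_of_mem hb
      rw [hr j hj]
      simp [hb']

/-- Equal coordinates receive different ranks. This does no harm, since both `k a ≤ x` and `k a < x`
cut out initial segments of the sorted list. -/
theorem ranks_of_bst {k : ℕ → ℝ} {r : ℕ → ℤ} {h N : ℕ} {l : List ℕ} {t : T}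
    (hb : Bst (enc ρ (k :: ks) (r :: rs)) h t l) (hr : ∀ j (hj : j < l.length), r l[j] = j)
    (hs : l.Pairwise (fun a b => k a ≤ k b)) (hN : l.length ≤ N) : Ranks I d N (4 * h + 2) l t k r := by
  have hr' : ∀ j (h : j < l.length), r l[j] = 0 + j := fun j h => by rw [hr j h, zero_add]
  refine ⟨fun a ha => ?_, fun x => ?_, fun x => ?_⟩
  · obtain ⟨j, hj, rfl⟩ := List.getElem_of_mem ha
    rw [hr j hj]
    omega
  · have hm : l.Pairwise (fun a b => k b ≤ x → k a ≤ x) := hs.imp fun h h' => h.trans h'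
    obtain ⟨h1, h2⟩ := foldl_rank l 0 hr' hm
    refine ⟨_, ?_, ?_, ?_, h2⟩
    · rw [← h1]
      exact search_spec I d (e := enc ρ (k :: ks) (r :: rs)) (key := fun a => .real (k a))
        (pay := fun a => .int (r a)) (fun _ _ => rfl) (fun _ _ => rfl) false (.real x) (fun a => k a ≤ x)
        (fun a => by simp [T.le]) hb hm _
    · omega
    · have := List.length_filter_le (fun a => decide (k a ≤ x)) l; omega
  · have hm : l.Pairwise (fun a b => k b < x → k a < x) := hs.imp fun h h' => h.trans_lt h'
    obtain ⟨h1, h2⟩ := foldl_rank l 0 hr' hm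
    refine ⟨_, ?_, ?_, ?_, h2⟩
    · rw [← h1]
      exact search_spec I d (e := enc ρ (k :: ks) (r :: rs)) (key := fun a => .real (k a))
        (pay := fun a => .int (r a)) (fun _ _ => rfl) (fun _ _ => rfl) true (.real x) (fun a => k a < x)
        (fun a => by simp [T.le]) hb hm _
    · omega
    · have := List.length_filter_le (fun a => decide (k a < x)) l; omega

/-- Each coordinate puts its ranks in front of the earlier ones, so the ranks end up in reverse
order of the coordinates. The bounds of a query are reversed accordingly. -/
theorem prep_spec {fu : List ℤ} {N : ℕ} (hfu : N < 2 ^ fu.length) (hW : N ≤ I.W) (ks : List (ℕ → ℝ)) :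
    ∀ (rs : List (ℕ → ℤ)) (l : List ℕ), l.Nodup → l.length = N → l ≠ [] → ∃ (l' : List ℕ) (new : List (ℕ → ℤ))
      (ts : List T),
      Pu I (prog d) fPrep [encs (enc ρ ks rs) l, encs .int fu]
        (.node (encs (enc ρ [] (new.reverse ++ rs)) l') (encs id ts) .nil)
        (ks.length * (20 * N * (fu.length + 1) + 16 * N + 5 * fu.length + 17) + 2) ∧ l'.Perm l ∧
      List.Forall₂ (fun (kr : (ℕ → ℝ) × (ℕ → ℤ)) t => Ranks I d N (4 * fu.length + 2) l t kr.1 kr.2)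
        (ks.zip new) ts ∧ new.length = ks.length := by
  induction ks with
  | nil =>
    intro rs l _ _ _
    refine ⟨l, [], [], fun o => ev_of_wp ?_, .refl _, by simp, rfl⟩
    cases l with
    | nil =>
      change wp I (prog d) cPrep _ _ _
      simp [cPrep]
    | cons a l =>
      change wp I (prog d) cPrep _ _ _
      simp [cPrep, enc]
  | cons k ks ih =>
    intro rs l hl hN hne
    obtain ⟨l₁, r1, p1, s1⟩ := sort_spec (I := I) d (e := enc ρ (k :: ks) rs) (key := fun a => .real (k a))
      (fun _ _ => rfl) fu.length l (by omega) (fun a _ b _ => le_total (k a) (k b))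
    have hl1 := p1.length_eq
    set r : ℕ → ℤ := fun a => (l₁.idxOf a : ℤ) with hr
    have hnd : l₁.Nodup := p1.nodup_iff.2 hl
    have hr1 : ∀ j (hj : j < l₁.length), r l₁[j] = j := fun j hj => by simp [hr, hnd.idxOf_getElem]
    have r2 := number_spec (I := I) (d := d) (ρ := ρ) (ks := k :: ks) (rs := rs) (r := r) l₁ 0 (by omega)
      (fun j hj => by rw [hr1 j hj]; simp)
    obtain ⟨t, v₁, v₂, r3, hv, hb, hn⟩ := tree_spec I d (enc ρ (k :: ks) (r :: rs)) T.int fu l₁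
    have hv2 : v₂ = [] := by
      by_contra hne
      have := hn hne
      have h6 : l₁.length = v₁.length + v₂.length := by rw [hv]; simp
      have := List.length_pos_iff.2 hne
      omega
    subst hv2
    rw [List.append_nil] at hv
    rw [← hv] at r3 hb
    have r4 := drop_spec (I := I) (d := d) (ρ := ρ) (ks := ks) (rs := r :: rs) (k := k) l₁
    obtain ⟨l', new, ts, r5, p5, f5, n5⟩ := ih (r :: rs) l₁ hnd (by omega) (by
      rintro rfl; exact hne (List.length_eq_zero_iff.1 hl1.symm))
    refine ⟨l', r :: new, t :: ts, fun o => ev_of_wp ?_, p5.trans p1, ?_, by simp [n5]⟩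
    · have hk : I.look (fun _ => .nil) (I.look (fun _ => .nil) (encs (enc ρ (k :: ks) rs) l) 0) 0 ≠ .nil := by
        cases l with
        | nil => exact absurd rfl hne
        | cons a l => simp [enc]
      change wp I (prog d) cPrep _ _ _
      simp [cPrep, hk]
      refine ⟨_, _, _, r1 o, _, _, _, r2 o, _, _, _, r3 o, _, _, _, r4 o, _, _, _, r5 o, ?_⟩
      simp
      intro k₁ hk₁ k₂ hk₂ k₃ hk₃ k₄ hk₄ k₅ hk₅
      rw [hl1, hN] at hk₂ hk₃ hk₄
      rw [hN] at hk₅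
      have e1 : (ks.length + 1) * (20 * N * (fu.length + 1) + 16 * N + 5 * fu.length + 17) =
        ks.length * (20 * N * (fu.length + 1) + 16 * N + 5 * fu.length + 17) +
        20 * N * (fu.length + 1) + 16 * N + 5 * fu.length + 17 := by ring
      omega
    · rw [List.zip_cons_cons]
      refine .cons ?_ (f5.imp fun kr t h => ?_)
      · exact (ranks_of_bst hb hr1 s1 (by omega)).mono fun a => p1.mem_iff.2
      · exact h.mono fun a => p1.mem_iff.2

end

end FunLang

namespace FunLang

open Classical

/-! ### Construction and queries -/

/-- The powers of two below `2 ^ h`, in decreasing order. -/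
def pw : ℕ → List ℤ
  | 0 => []
  | h + 1 => 2 ^ h :: pw h

/-- The same powers of two are the bit values of the dominance keys and, with a final `0`, the
widths in the range tree. -/
theorem fuel_succ (h : ℕ) : fuel (h + 1) = pw h ++ [0] := by
  induction h with
  | zero => rfl
  | succ h ih =>
    rw [fuel, ih, pw, List.cons_append, pow_succ]
    simp

theorem sum_pw (h : ℕ) : (pw h).sum + 1 = 2 ^ h := by
  induction h with
  | zero => rfl
  | succ h ih => rw [pw, List.sum_cons, add_assoc, ih]; ring

theorem length_pw (h : ℕ) : (pw h).length = h := by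
  induction h with
  | zero => rfl
  | succ h ih => simp [pw, ih]

theorem bin_pw (h : ℕ) : Bin (pw h) := by
  induction h with
  | zero => trivial
  | succ h ih =>
    have := sum_pw h
    have h2 : (0 : ℤ) < 2 ^ h := by positivity
    exact ⟨this.symm, by omega, ih⟩

section

variable {I : Inp} {d : ℕ}

theorem pows_spec {H n : ℕ} (hH : ∀ i < H, 2 ^ i ≤ n) (hn : n < 2 ^ H) (hW : 2 ^ H ≤ I.W) (l : List ℤ)
    (k : ℕ) : ∀ i, i + k = H → Pu I (prog d) fPows [.int (2 ^ i), .int n, encs .int (pw i ++ l)]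
      (encs .int (pw H ++ l)) (3 * k + 2) := by
  induction k with
  | zero =>
    intro i hi o
    obtain rfl : i = H := by omega
    have : ¬ (2 : ℤ) ^ i ≤ n := by exact_mod_cast not_le.2 hn
    refine ev_of_wp ?_
    change wp I (prog d) cPows _ _ _
    simp [cPows, T.le, this]
  | succ k ih =>
    intro i hi o
    have h1 : (2 : ℤ) ^ i ≤ n := by exact_mod_cast hH i (by omega)
    have h2 : (2 : ℤ) ^ (i + 1) ≤ I.W := by
      exact_mod_cast (Nat.pow_le_pow_right (by norm_num) (by omega : i + 1 ≤ H)).trans hW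
    have hpl : T.plus I.W (.int (2 ^ i)) (.int (2 ^ i)) = .int (2 ^ (i + 1)) := by
      rw [plus_int]
      · congr 1; ring
      · rw [abs_of_nonneg (by positivity), ← two_mul, ← pow_succ']; exact h2
    have := ih (i + 1) (by omega) o
    simp only [pw, List.cons_append, encs_cons] at this
    refine ev_of_wp ?_
    change wp I (prog d) cPows _ _ _
    simp [cPows, T.le, h1, hpl]
    exact ⟨_, _, _, this, by simp; omega⟩

/-- The counter is one doubling ahead of the block, so a block is extended as long as its number of
leaves stays at most `s`. -/
theorem take_spec {s : ℕ} (hs : 2 * s ≤ I.W) (l : List ℤ) : ∀ i : ℕ, 2 ^ i ≤ s → ∃ b r,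
    Pu I (prog d) fTake [encs .int l, .int (2 ^ (i + 1)), .int s] (.node (encs .int b) (encs .int r) .nil)
      (4 * b.length + 3) ∧ l = b ++ r ∧ 2 ^ (i + b.length) ≤ s ∧ (r ≠ [] → s < 2 ^ (i + b.length + 1)) := by
  induction l with
  | nil =>
    intro i hi
    refine ⟨[], [], fun o => ev_of_wp ?_, rfl, hi, by simp⟩
    change wp I (prog d) cTake _ _ _
    simp [cTake]
  | cons w l ih =>
    intro i hi
    by_cases h : 2 ^ (i + 1) ≤ s
    · obtain ⟨b, r, r1, r2, r3, r4⟩ := ih (i + 1) h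
      have h1 : (2 : ℤ) ^ (i + 1) ≤ s := by exact_mod_cast h
      have h2 : (2 : ℤ) * s ≤ I.W := by exact_mod_cast hs
      have hpl : T.plus I.W (.int (2 ^ (i + 1))) (.int (2 ^ (i + 1))) = .int (2 ^ (i + 1 + 1)) := by
        rw [plus_int]
        · congr 1; ring
        · rw [abs_of_nonneg (by positivity)]; omega
      have e : i + (w :: b).length = i + 1 + b.length := by simp; omega
      refine ⟨w :: b, r, fun o => ev_of_wp ?_, by simp [r2], by rw [e]; exact r3, by rw [e]; exact r4⟩
      change wp I (prog d) cTake _ _ _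
      simp [cTake, T.le, h1, hpl]
      exact ⟨_, _, _, r1 o, by simp; omega⟩
    · have h1 : ¬ (2 : ℤ) ^ (i + 1) ≤ s := by exact_mod_cast h
      refine ⟨[], w :: l, fun o => ev_of_wp ?_, rfl, hi, fun _ => by simpa using h⟩
      change wp I (prog d) cTake _ _ _
      simp [cTake, T.le, h1]

/-- Every block but the last is maximal and therefore has at least `g` bits. This bounds the depth
of the trie by about `l.length / g + 1`. -/
theorem blocks_spec {s g : ℕ} (hs2 : 2 ≤ s) (hs : 2 * s ≤ I.W) (hg : 2 ^ g ≤ s) (m : ℕ) :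
    ∀ l : List ℤ, l.length ≤ m → ∃ bl, Pu I (prog d) fBlocks [encs .int l, .int s] (encs (encs .int) bl)
      (11 * l.length + 2) ∧ bl.flatten = l ∧ (∀ b ∈ bl, 2 ^ b.length ≤ s) ∧ bl.length * g ≤ l.length + g ∧
      (l = [] → bl = []) := by
  induction m with
  | zero =>
    intro l hl
    obtain rfl : l = [] := List.length_eq_zero_iff.1 (by omega)
    refine ⟨[], fun o => ev_of_wp ?_, rfl, by simp, by simp, by simp⟩
    change wp I (prog d) cBlocks _ _ _
    simp [cBlocks]
  | succ m ih =>
    intro l hl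
    cases l with
    | nil =>
      refine ⟨[], fun o => ev_of_wp ?_, rfl, by simp, by simp, by simp⟩
      change wp I (prog d) cBlocks _ _ _
      simp [cBlocks]
    | cons w l =>
      obtain ⟨b, r, r1, r2, r3, r4⟩ := take_spec (I := I) (d := d) hs (w :: l) 0 (by simp; omega)
      simp only [zero_add, pow_one] at r1 r3 r4
      have hb : b ≠ [] := by
        rintro rfl
        have := r4 (by rintro rfl; simp at r2)
        simp at this
        omega
      have hbl := List.length_pos_iff.2 hb
      have hlen : l.length + 1 = b.length + r.length := by
        have := congrArg List.length r2
        simpa using this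
      simp only [List.length_cons] at hl
      obtain ⟨bl, r5, r6, r7, r8, r9⟩ := ih r (by omega)
      refine ⟨b :: bl, fun o => ev_of_wp ?_, by rw [List.flatten_cons, r6, r2], ?_, ?_, by simp⟩
      · have r1 := r1 o
        simp only [encs_cons] at r1
        change wp I (prog d) cBlocks _ _ _
        simp [cBlocks]
        exact ⟨_, _, _, r1, _, _, _, r5 o, by simp; omega⟩
      · simp only [List.mem_cons, forall_eq_or_imp]; exact ⟨r3, r7⟩
      · have e : (b :: bl).length * g = bl.length * g + g := by simp only [List.length_cons]; ring
        simp only [List.length_cons] at e ⊢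
        by_cases hr : r = []
        · rw [r9 hr] at e ⊢; simp
        · have h3 := r4 hr
          have : g < b.length + 1 := (Nat.pow_lt_pow_iff_right (by norm_num : 1 < 2)).1 (hg.trans_lt h3)
          omega

/-- The lower bound is the largest rank of a coordinate below the box, and the upper bound is one
more than the largest rank of a coordinate not above it. A closed interval of reals thus becomes an
open interval of ranks, with ties treated correctly. -/
theorem bounds_spec {N C : ℕ} {l : List ℕ} (hW : N ≤ I.W) {krs : List ((ℕ → ℝ) × (ℕ → ℤ))} {ts : List T}
    (h : List.Forall₂ (fun kr t => Ranks I d N C l t kr.1 kr.2) krs ts) :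
    ∀ (ab : List (ℝ × ℝ)) (acc : List (ℤ × ℤ)), ab.length = krs.length → ∃ bs : List (ℤ × ℤ),
      Pu I (prog d) fBounds [encs id ts, encs .real (ab.map Prod.fst), encs .real (ab.map Prod.snd),
        encs encB acc] (encs encB (bs.reverse ++ acc)) (krs.length * (2 * C + 5) + 2) ∧
      bs.length = krs.length ∧ (∀ b ∈ bs, -1 ≤ b.1 ∧ b.1 < N ∧ 0 ≤ b.2 ∧ b.2 ≤ N) ∧
      ∀ p ∈ l, List.Forall₂ (fun b r => b.1 < r ∧ r < b.2) bs (krs.map (·.2 p)) ↔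
        List.Forall₂ (fun ab kr => ab.1 ≤ kr.1 p ∧ kr.1 p ≤ ab.2) ab krs := by
  induction h with
  | nil =>
    intro ab acc hab
    obtain rfl : ab = [] := by simpa using hab
    refine ⟨[], fun o => ev_of_wp ?_, rfl, by simp, by simp⟩
    change wp I (prog d) cBounds _ _ _
    simp [cBounds]
  | @cons kr t krs ts h _ ih =>
    intro ab acc hab
    cases ab with
    | nil => simp at hab
    | cons y ab =>
      obtain ⟨z, z1, z2, z3, z4⟩ := h.2.2 y.1
      obtain ⟨u, u1, u2, u3, u4⟩ := h.2.1 y.2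
      obtain ⟨bs, r1, r2, r3, r4⟩ := ih ab ((z, u + 1) :: acc) (by simpa using hab)
      have hpl : T.plus I.W (.int u) (.int 1) = .int (u + 1) := plus_int (by rw [abs_le]; omega)
      refine ⟨(z, u + 1) :: bs, fun o => ev_of_wp ?_, by simp [r2], ?_, fun p hp => ?_⟩
      · have r1 := r1 o
        simp only [encs_cons, encB] at r1
        change wp I (prog d) cBounds _ _ _
        simp [cBounds]
        refine ⟨_, _, _, z1 o, _, _, _, u1 o, ?_⟩
        simp [hpl]
        refine ⟨_, _, _, r1, ?_⟩
        simp
        intro k₁ hk₁ k₂ hk₂ k₃ hk₃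
        have : (krs.length + 1) * (2 * C + 5) = krs.length * (2 * C + 5) + 2 * C + 5 := by ring
        omega
      · simp only [List.mem_cons, forall_eq_or_imp]
        exact ⟨⟨z2, z3, by omega, by omega⟩, r3⟩
      · rw [List.map_cons, List.forall₂_cons, List.forall₂_cons, r4 p hp]
        have e1 := z4 p hp
        have e2 := u4 p hp
        refine and_congr_left fun _ => and_congr ?_ ?_
        · rw [← not_lt, e1, not_le]
        · rw [e2]; omega

end

end FunLang

/-! ### The complete construction and query functions -/

namespace FunLang

open Classical

/-- The input records hold the coordinates `x`, the colours `κ` and the links of a list. -/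
structure Input (I : Inp) (d : ℕ) (κ : ℕ → ℕ) (x : ℕ → ℕ → ℝ) : Prop where
  sc : I.sc = d + 2
  coord : ∀ a < I.n, ∀ j < d, I.cell a j = .real (x j a)
  color : ∀ a < I.n, I.cell a d = .col (κ a)
  link : ∀ a < I.n, I.cell a (d + 1) = if a + 1 < I.n then .pt (a + 1) else .nil

def Box (ks : List (ℕ → ℝ)) (ab : List (ℝ × ℝ)) (a : ℕ) : Prop :=
  List.Forall₂ (fun (ab : ℝ × ℝ) (k : ℕ → ℝ) => ab.1 ≤ k a ∧ k a ≤ ab.2) ab ks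

/-- The number of points of colour `c` in a box. -/
noncomputable def num (n : ℕ) (κ : ℕ → ℕ) (ks : List (ℕ → ℝ)) (ab : List (ℝ × ℝ)) (c : ℕ) : ℕ :=
  ((Finset.range n).filter fun a => Box ks ab a ∧ κ a = c).card

noncomputable def numCol (n : ℕ) (κ : ℕ → ℕ) (ks : List (ℕ → ℝ)) (ab : List (ℝ × ℝ)) : ℕ :=
  (((Finset.range n).filter (Box ks ab)).image κ).card

def buildCost (d n H K : ℕ) : ℕ :=
  structCost (H + 1) K d * n + d * (20 * n * (H + 2) + 16 * n + 5 * (H + 1) + 17) + 20 * n * (H + 1) +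
    10 * n + 17 * H + 40

theorem getD_snoc_lt {l : List T} {i : ℕ} {y : T} (h : i < l.length) :
    (l ++ [y]).getD i .nil = l.getD i .nil := by
  simp [List.getD, List.getElem?_append_left h]

theorem getD_snoc_eq {l : List T} {i : ℕ} {y : T} (h : i = l.length) : (l ++ [y]).getD i .nil = y := by
  subst h; simp [List.getD]

section

variable {I : Inp} {d : ℕ} {κ : ℕ → ℕ} {x : ℕ → ℕ → ℝ}

/-- A query of a range tree. -/
theorem query_spec (hin : Input I d κ x) (hW : I.n ≤ I.W) {bl : List (List ℤ)} {fu : List ℤ}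
    (hV : (I.n : ℤ) ≤ bl.flatten.sum) {A L C : ℕ} {t : T} {l : List ℕ} {ts : List T}
    {krs : List ((ℕ → ℝ) × (ℕ → ℤ))} {σ : ℕ → ℕ} (hl : l.Perm (List.range I.n))
    (hσ : ∀ a < I.n, κ (σ (κ a)) = κ a ∧ σ (κ a) < I.n)
    (hk : krs.map Prod.fst = (List.range d).map x)
    (hr : List.Forall₂ (fun kr t => Ranks I d I.n C l t kr.1 kr.2) krs ts)
    (ht : Asks I d bl fu d 0 A L t
      (l.map fun a => ([], (krs.map Prod.snd).reverse.map (· a), σ (κ a))))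
    {ab : List (ℝ × ℝ)} (hab : ab.length = d) : ∃ out : List (ℕ × ℤ),
    Ev I (prog d) fQuery (.node (encs id ts) t (ctx bl fu) ::
      ((ab.map Prod.fst).map T.real ++ (ab.map Prod.snd).map T.real)) ⟨fun _ => .nil, []⟩ .nil
      ⟨fun _ => .nil, out⟩
      (d * (2 * C + 5) + A + 17 * (L * numCol I.n κ ((List.range d).map x) ab) + 20) ∧
    out.Nodup ∧ ∀ (c : ℕ) (f : ℤ), (c, f) ∈ out ↔ f = num I.n κ ((List.range d).map x) ab c ∧ 0 < f := by
  set ks := (List.range d).map x with hks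
  have hlen : krs.length = d := by
    have := congrArg List.length hk
    simpa [hks] using this
  obtain ⟨bs, r1, r2, r3, r4⟩ := bounds_spec hW hr ab [] (by rw [hab, hlen])
  rw [List.append_nil] at r1
  have hmem : ∀ a, a ∈ l ↔ a < I.n := fun a => by rw [hl.mem_iff, List.mem_range]
  have hhit : ∀ a ∈ l, Hit bs.reverse [] ([], (krs.map Prod.snd).reverse.map (· a), σ (κ a)) ↔ Box ks ab a := by
    intro a ha
    have e : List.Forall₂ (fun (ab : ℝ × ℝ) (kr : (ℕ → ℝ) × (ℕ → ℤ)) => ab.1 ≤ kr.1 a ∧ kr.1 a ≤ ab.2) ab krs ↔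
        Box ks ab a := by
      rw [Box, ← hk, List.forall₂_map_right_iff]
    rw [← e, ← r4 a ha, Hit, List.map_reverse, List.forall₂_reverse_iff, List.map_map]
    simp [Function.comp_def]
  obtain ⟨es, q1, q2⟩ := ht bs.reverse [] (by simp [r2, hlen]) rfl (fun b hb => by
    have := r3 b (by simpa using hb)
    exact ⟨this.1, by omega, this.2.2.1, by omega⟩) (by simp) []
  set M : Multiset ℕ :=
    ↑(sel bs.reverse [] (l.map fun a => ([], (krs.map Prod.snd).reverse.map (· a), σ (κ a)))) with hM
  have hMeq : M = ((Multiset.range I.n).filter (Box ks ab)).map fun a => σ (κ a) := by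
    rw [hM, sel, List.filter_map, List.map_map, List.filter_congr (q := (Box ks ab ·)), ← Multiset.map_coe,
      ← Multiset.filter_coe, Multiset.coe_eq_coe.2 hl, Multiset.coe_range]
    · rfl
    · intro a ha
      simpa using hhit a ha
  have hMcard : M.card ≤ I.n := by
    rw [hMeq, Multiset.card_map]
    exact (Multiset.card_le_card (Multiset.filter_le _ _)).trans (by simp)
  have hMmem : ∀ v ∈ M, ∃ a < I.n, Box ks ab a ∧ v = σ (κ a) := by
    intro v hv
    rw [hMeq, Multiset.mem_map] at hv
    obtain ⟨a, ha, rfl⟩ := hv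
    rw [Multiset.mem_filter, Multiset.mem_range] at ha
    exact ⟨a, ha.1, ha.2, rfl⟩
  -- Since `κ (σ c) = c` for every colour that occurs, different colours have different
  -- representatives and their counts do not mix.
  have hcount : ∀ c, (∃ a < I.n, κ a = c) → M.count (σ c) = num I.n κ ks ab c := by
    rintro _ ⟨b, hb, rfl⟩
    rw [hMeq, Multiset.count_map, Multiset.filter_filter, num, Finset.card_def, Finset.filter_val,
      Finset.range_val]
    congr 1
    refine Multiset.filter_congr fun a ha => ?_
    rw [and_comm]
    refine and_congr_right fun _ => ⟨fun h => ?_, fun h => by rw [h]⟩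
    rw [← (hσ a (Multiset.mem_range.1 ha)).1, ← h, (hσ b hb).1]
  have hfin : M.toFinset.card ≤ numCol I.n κ ks ab := by
    have : M.toFinset ⊆ (((Finset.range I.n).filter (Box ks ab)).image κ).image σ := by
      intro v hv
      obtain ⟨a, ha, hb, rfl⟩ := hMmem v (Multiset.mem_toFinset.1 hv)
      exact Finset.mem_image_of_mem _ (Finset.mem_image_of_mem _ (by simp [ha, hb]))
    exact (Finset.card_le_card this).trans Finset.card_image_le
  obtain ⟨ts', es', a1, a2, a3, a4, a5, -, a7⟩ := aggregate_spec (d := d) hin.sc es q2.1 (fun a => by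
    rw [q2.2.1]
    exact_mod_cast (Multiset.count_le_card a M).trans (hMcard.trans hW))
  have hes : ∀ y ∈ es', ∃ a < I.n, Box ks ab a ∧ y.1 = σ (κ a) := by
    intro y hy
    have := (a5 y).1 hy
    rw [q2.2.1] at this
    exact hMmem y.1 (Multiset.count_pos.1 (by omega))
  have a8 := emit_spec (d := d) hin.sc κ es' (fun y hy => by
    obtain ⟨a, ha, -, h⟩ := hes y hy
    exact hin.color _ (by rw [h]; exact (hσ a ha).2)) []
  have hout : ∀ (c : ℕ) (f : ℤ), (c, f) ∈ es'.map (fun y => (κ y.1, y.2)) ↔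
      f = num I.n κ ks ab c ∧ 0 < f := by
    intro c f
    rw [List.mem_map]
    constructor
    · rintro ⟨y, hy, he⟩
      obtain ⟨rfl, rfl⟩ := Prod.mk.inj he
      obtain ⟨a, ha, hb, h⟩ := hes y hy
      have h1 := (a5 y).1 hy
      rw [q2.2.1, h, hcount _ ⟨a, ha, rfl⟩] at h1
      rw [h, (hσ a ha).1]
      exact h1
    · rintro ⟨rfl, h⟩
      have h' : 0 < num I.n κ ks ab c := by exact_mod_cast h
      obtain ⟨a, ha⟩ := Finset.card_pos.1 h'
      rw [Finset.mem_filter, Finset.mem_range] at ha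
      refine ⟨(σ c, num I.n κ ks ab c), (a5 _).2 ⟨?_, h⟩, ?_⟩
      · rw [q2.2.1, hcount c ⟨a, ha.1, ha.2.2⟩]
      · have := (hσ a ha.1).1
        rw [ha.2.2] at this
        rw [this]
  refine ⟨(es'.map (fun y => (κ y.1, y.2))).reverse ++ [], ev_of_wp ?_, ?_, ?_⟩
  · set env : List T := .node (encs id ts) t (ctx bl fu) ::
      ((ab.map Prod.fst).map T.real ++ (ab.map Prod.snd).map T.real) with henv
    have e0 : env.getD 0 .nil = .node (encs id ts) t (ctx bl fu) := rfl
    have elen : env.length = 2 * d + 1 := by simp [henv, hab]; omega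
    have eA : (List.range d).map (fun j => env.getD (j + 1) .nil) = (ab.map Prod.fst).map T.real := by
      refine List.ext_getElem (by simp [hab]) fun j h1 h2 => ?_
      simp only [List.length_map] at h2
      simp [henv, List.getElem?_append, h2]
    have eB : (List.range d).map (fun j => env.getD (j + 1 + d) .nil) = (ab.map Prod.snd).map T.real := by
      refine List.ext_getElem (by simp [hab]) fun j h1 h2 => ?_
      simp only [List.length_map] at h2
      have : j + 1 + d = (j + ab.length) + 1 := by omega
      rw [List.getElem_map, List.getElem_range, this, henv, List.getD_cons_succ]
      simp [h2]
    clear_value env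
    have eA' : encs id ((List.range d).map (fun j => env.getD (j + 1) .nil)) =
        encs .real (ab.map Prod.fst) := by rw [eA, encs_map]; rfl
    have eB' : encs id ((List.range d).map (fun j => env.getD (j + 1 + d) .nil)) =
        encs .real (ab.map Prod.snd) := by rw [eB, encs_map]; rfl
    change wp I (prog d) (cQuery d) _ _ _
    have hsnoc : ∀ y, (env ++ [y]).getD 0 .nil = .node (encs id ts) t (ctx bl fu) := fun y => by
      rw [getD_snoc_lt (by omega), e0]
    have h1 : ∀ y, (env ++ [y]).getD (2 * d + 1) .nil = y := fun y => getD_snoc_eq elen.symm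
    have h2 : ∀ y z, ((env ++ [y]) ++ [z]).getD (2 * d + 2) .nil = z := fun y z =>
      getD_snoc_eq (by simp [elen])
    have h3 : ∀ y z u, (((env ++ [y]) ++ [z]) ++ [u]).getD (2 * d + 3) .nil = u := fun y z u =>
      getD_snoc_eq (by simp [elen])
    have h4 : ∀ y z u v, ((((env ++ [y]) ++ [z]) ++ [u]) ++ [v]).getD (2 * d + 4) .nil = v :=
      fun y z u v => getD_snoc_eq (by simp [elen])
    simp only [cQuery, wp, List.map_cons, List.map_nil, listEx_eval, Ex.eval, List.map_map,
      Function.comp_def, e0, look_node_zero, eA', eB', hsnoc, h1, look_node_one, look_node_two]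
    refine ⟨_, _, _, r1 [], ?_⟩
    have q1 := q1 []
    rw [List.append_nil] at q1
    refine ⟨_, _, _, q1, ?_⟩
    simp only [h2]
    refine ⟨_, _, _, a1 [], ?_⟩
    simp only [h3]
    refine ⟨_, _, _, a2 [], ?_⟩
    simp only [h4]
    refine ⟨_, _, _, a8, ?_⟩
    intro k₁ hk₁ k₂ hk₂ k₃ hk₃ k₄ hk₄ k₅ hk₅
    refine ⟨by trivial, by trivial, ?_⟩
    -- Per entry, gathering costs `3`, counting `5`, collecting `5` and emitting `4`, which gives
    -- the factor `17`.
    have hesl : es.length ≤ L * numCol I.n κ ks ab := q2.2.2.trans (Nat.mul_le_mul_left _ hfin)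
    rw [hlen] at hk₅
    omega
  · rw [List.append_nil, List.nodup_reverse]
    refine List.Nodup.map_on (fun y hy z hz h => ?_) a3
    obtain ⟨a, ha, -, h1⟩ := hes y hy
    obtain ⟨b, hb, -, h2⟩ := hes z hz
    obtain ⟨h3, h4⟩ := Prod.mk.inj h
    refine Prod.ext ?_ h4
    rw [h1, (hσ a ha).1, h2, (hσ b hb).1] at h3
    rw [h1, h2, h3]
  · intro c f
    rw [List.append_nil, List.mem_reverse, hout]

theorem build_spec (hin : Input I d κ x) (hn : 2 ≤ I.n) {s m H g : ℕ} (hd : d = m + 1) (hs : 2 ≤ s)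
    (hsn : s ≤ I.n) (hW : 2 * I.n ≤ I.W) (hH : ∀ i < H, 2 ^ i ≤ I.n) (hH' : I.n < 2 ^ H) (hH2 : 2 ^ H ≤ 2 * I.n)
    (hg : 2 ^ g ≤ s) : ∃ (NB : ℕ) (root : T),
    Pu I (prog d) fBuild [.pt 0, .int s] root (buildCost d I.n H (insCost NB s m)) ∧ NB * g ≤ H + g ∧
    ∀ ab : List (ℝ × ℝ), ab.length = d → ∃ out : List (ℕ × ℤ),
      Ev I (prog d) fQuery (root :: ((ab.map Prod.fst).map T.real ++ (ab.map Prod.snd).map T.real))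
        ⟨fun _ => .nil, []⟩ .nil ⟨fun _ => .nil, out⟩
        (d * (8 * H + 17) + asksCost (H + 1) (askCost NB H m) d +
          17 * (2 ^ d * (NB ^ m * 2) * numCol I.n κ ((List.range d).map x) ab) + 20) ∧
      out.Nodup ∧ ∀ (c : ℕ) (f : ℤ), (c, f) ∈ out ↔ f = num I.n κ ((List.range d).map x) ab c ∧ 0 < f := by
  set ks := (List.range d).map x with hks
  have r1 := read_spec (d := d) hin.sc hin.coord hin.color hin.link I.n 0 (by omega)
  rw [if_pos (by omega), ← hks, ← List.range_eq_range'] at r1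
  obtain ⟨l₁, r2, p2, s2⟩ := sort_spec (I := I) d (e := encC κ ks) (key := fun a => .col (κ a)) (fun _ _ => rfl)
    H (List.range I.n) (by simpa using hH'.le) (fun a _ b _ => le_total (κ a) (κ b))
  have hlen1 : l₁.length = I.n := by simpa using p2.length_eq
  have hmem1 : ∀ a, a ∈ l₁ ↔ a < I.n := fun a => by rw [p2.mem_iff, List.mem_range]
  obtain ⟨σ, hσ, r3⟩ := reps_start_spec (I := I) (d := d) (ks := ks) l₁ (fun a ha => (hmem1 a).1 ha) s2
  have r4 := len_spec I d (enc (fun a => σ (κ a)) ks []) l₁ (by omega)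
  have r5 := pows_spec (I := I) (d := d) hH hH' (hH2.trans hW) [0] H 0 (by omega)
  have r6 := pows_spec (I := I) (d := d) hH hH' (hH2.trans hW) [] H 0 (by omega)
  rw [← fuel_succ H] at r5
  rw [List.append_nil, List.append_nil] at r6
  simp only [pw, pow_zero] at r5 r6
  obtain ⟨bl, r7, f7, g7, c7, -⟩ := blocks_spec (I := I) (d := d) hs (by omega) hg H (pw H)
    (length_pw H).le
  rw [length_pw] at r7 c7
  obtain ⟨l', new, ts, r8, p8, f8, n8⟩ := prep_spec (I := I) (d := d) (ρ := fun a => σ (κ a)) (fu := fuel (H + 1))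
    (N := I.n) (by rw [length_fuel, pow_succ]; omega) (by omega) ks [] l₁ (p2.nodup_iff.2 List.nodup_range)
    hlen1 (by rintro rfl; simp at hlen1; omega)
  have hksl : ks.length = d := by simp [hks]
  rw [length_fuel] at f8 r8
  set krs := ks.zip new with hkrs
  have hk1 : krs.map Prod.fst = ks := List.map_fst_zip n8.ge
  have hk2 : krs.map Prod.snd = new := List.map_snd_zip n8.le
  have p' : l'.Perm (List.range I.n) := p8.trans p2
  have hmem' : ∀ a, a ∈ l' ↔ a < I.n := fun a => by rw [p'.mem_iff, List.mem_range]
  -- The bit values sum to `2 ^ H - 1 ≥ n`, so they represent all ranks as well as the upper bounds,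
  -- which may equal `n`.
  have hsum : bl.flatten.sum + 1 = 2 ^ H := by rw [f7, sum_pw]
  have hV : (I.n : ℤ) ≤ bl.flatten.sum := by
    have : (I.n : ℤ) < 2 ^ H := by exact_mod_cast hH'
    omega
  have hVW : bl.flatten.sum < I.W := by
    have : (2 : ℤ) ^ H ≤ I.W := by exact_mod_cast hH2.trans hW
    omega
  have hrk : ∀ a < I.n, ∀ r ∈ new, 0 ≤ r a ∧ r a < I.n := by
    intro a ha r hr
    rw [← hk2, List.mem_map] at hr
    obtain ⟨kr, hkr, rfl⟩ := hr
    obtain ⟨i, hi, rfl⟩ := List.getElem_of_mem hkr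
    have := f8.get (by simpa using hi) (by simpa [f8.length_eq] using hi)
    exact this.1 a ((hmem1 a).2 ha)
  set el : ℕ → El := fun a => ([], new.reverse.map (· a), σ (κ a)) with hel
  have henc : encs (enc (fun a => σ (κ a)) [] (new.reverse ++ [])) l' = encs encEl (l'.map el) := by
    rw [List.append_nil]
    exact encs_congr el fun a _ => rfl
  obtain ⟨t, r9, a9⟩ := struct_spec (bl := bl) (fu := fuel (H + 1)) (G := s) (H := H) (n := I.n) (m := m) hin.sc g7
    (by rw [f7]; exact bin_pw H) hVW rfl hsum (by rw [pow_succ]; omega) (by omega) d 0 (by omega) (l'.map el) (by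
      simp only [List.mem_map]
      rintro _ ⟨a, ha, rfl⟩
      refine ⟨rfl, by simp [hel, n8, hksl], by simp [hel], ?_⟩
      simp only [hel, List.mem_map, List.mem_reverse]
      rintro _ ⟨r, hr, rfl⟩
      have := hrk a ((hmem' a).1 ha) r hr
      exact ⟨this.1, by omega⟩) (by simp [p'.length_eq])
  rw [henc] at r8
  refine ⟨bl.length, .node (encs id ts) t (ctx bl (fuel (H + 1))), fun o => ev_of_wp ?_, c7, fun ab hab => ?_⟩
  · change wp I (prog d) cBuild _ _ _
    have r4 := r4 o
    rw [hlen1] at r4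
    simp [cBuild]
    refine ⟨_, _, _, r1 o, _, _, _, r2 o, _, _, _, r3 o, _, _, _, r4, _, _, _, r5 o, _, _, _, r6 o, _, _, _,
      r7 o, _, _, _, r8 o, _, _, _, r9 o, ?_⟩
    simp
    intro k₁ hk₁ k₂ hk₂ k₃ hk₃ k₄ hk₄ k₅ hk₅ k₆ hk₆ k₇ hk₇ k₈ hk₈ k₉ hk₉
    rw [hksl] at hk₂
    rw [p'.length_eq, List.length_range] at hk₁
    rw [hlen1] at hk₇
    unfold buildCost
    have e : d * (20 * I.n * (H + 1 + 1) + 16 * I.n + 5 * (H + 1) + 17) =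
      d * (20 * I.n * (H + 2) + 16 * I.n + 5 * (H + 1) + 17) := by ring
    refine ⟨rfl, ?_⟩
    omega
  · have a9' : Asks I d bl (fuel (H + 1)) d 0 (asksCost (H + 1) (askCost bl.length bl.flatten.length m) d)
        (2 ^ d * (bl.length ^ m * 2)) t
        (l'.map fun a => ([], (krs.map Prod.snd).reverse.map (· a), σ (κ a))) := by
      rw [hk2]; exact a9
    obtain ⟨out, o1, o2, o3⟩ := query_spec hin (by omega) hV p' (fun a ha => hσ a ((hmem1 a).2 ha)) hk1
      (f8.imp fun kr t h => h.mono fun a => p8.mem_iff.1) a9' hab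
    refine ⟨out, o1.mono ?_, o2, o3⟩
    rw [f7, length_pw]
    have : d * (2 * (4 * (H + 1) + 2) + 5) = d * (8 * H + 17) := by ring
    rw [← hks]
    omega

end

end FunLang

namespace FunLang

open Classical PointerMachine ColorFrequency

/-! ### The programs on the machine -/

section

variable {n d φ : ℕ} (P : Fin n → Fin d → ℝ) (color : Fin n → Fin φ)

/-- Field `d + 2` follows the link and is `nil` in the given list, so it is free to serve as the
scratch field. -/
noncomputable def inp : Inp where
  W := n ^ 3
  n := n
  sc := d + 2
  cell a f :=
    if ha : a < n then
      if hf : f < d then .real (P ⟨a, ha⟩ ⟨f, hf⟩)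
      else if f = d then .col (color ⟨a, ha⟩)
      else if f = d + 1 ∧ a + 1 < n then .pt (a + 1)
      else .nil
    else .nil

def colorOf (a : ℕ) : ℕ := if h : a < n then color ⟨a, h⟩ else 0

noncomputable def coordOf (j a : ℕ) : ℝ := if h : a < n ∧ j < d then P ⟨a, h.1⟩ ⟨j, h.2⟩ else 0

theorem input_inp : Input (inp P color) d (colorOf color) (coordOf P) where
  sc := rfl
  coord a ha j hj := by
    have ha : a < n := ha
    simp [inp, coordOf, ha, hj]
  color a ha := by
    have ha : a < n := ha
    simp [inp, colorOf, ha]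
  link a ha := by
    have ha : a < n := ha
    simp [inp, ha]
    congr

theorem good_start (s : ℕ) : Good (inp P color) (buildStart s P color).heap fun _ => .nil := by
  refine ⟨le_rfl, fun a ha f => ?_⟩
  have ha : a < n := ha
  simp only [buildStart, Inp.field, inp, ha, dif_pos]
  split_ifs with h1 h2 h3 h4 h5 <;> simp [Rep] <;> omega

def boxList (a b : Fin d → ℝ) : List (ℝ × ℝ) := List.ofFn fun j => (a j, b j)

theorem box_iff (a b : Fin d → ℝ) (i : Fin n) :
    Box ((List.range d).map (coordOf P)) (boxList a b) i ↔ P i ∈ Set.Icc a b := by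
  rw [Box, List.forall₂_iff_get]
  simp only [boxList, List.length_ofFn, List.length_map, List.length_range, true_and, List.get_eq_getElem,
    List.getElem_ofFn, List.getElem_map, List.getElem_range, Set.mem_Icc, Pi.le_def, ← forall_and]
  constructor
  · intro h j
    have := h j j.2 j.2
    simpa [coordOf, i.2, j.2] using this
  · intro h j hj _
    have := h ⟨j, hj⟩
    simpa [coordOf, i.2, hj] using this

theorem num_eq_freq (a b : Fin d → ℝ) (c : Fin φ) :
    num n (colorOf color) ((List.range d).map (coordOf P)) (boxList a b) c =
      freq P color (Set.Icc a b) c := by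
  rw [num, freq, Set.ncard_eq_toFinset_card']
  symm
  rw [← Finset.card_map Fin.valEmbedding]
  congr 1
  ext m
  simp only [Finset.mem_map, Set.mem_toFinset, Set.mem_ofPred_eq, Finset.mem_filter, Finset.mem_range]
  constructor
  · rintro ⟨i, ⟨h1, h2⟩, rfl⟩
    refine ⟨i.2, (box_iff P a b i).2 h1, ?_⟩
    simp [colorOf, h2]
  · rintro ⟨hm, h1, h2⟩
    refine ⟨⟨m, hm⟩, ⟨(box_iff P a b ⟨m, hm⟩).1 h1, ?_⟩, rfl⟩
    simp only [colorOf, hm, dif_pos] at h2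
    exact Fin.ext h2

theorem colorOf_lt {c : ℕ} {ks : List (ℕ → ℝ)} {ab : List (ℝ × ℝ)} (h : 0 < num n (colorOf color) ks ab c) :
    c < φ := by
  obtain ⟨m, hm⟩ := Finset.card_pos.1 h
  rw [Finset.mem_filter, Finset.mem_range] at hm
  obtain ⟨hm, -, rfl⟩ := hm
  simp only [colorOf, hm, dif_pos]
  exact (color ⟨m, hm⟩).2

theorem numCol_le (a b : Fin d → ℝ) :
    numCol n (colorOf color) ((List.range d).map (coordOf P)) (boxList a b) ≤
      numColors P color (Set.Icc a b) := by
  rw [numColors, Set.ncard_eq_toFinset_card', ← Finset.card_map Fin.valEmbedding]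
  refine Finset.card_le_card fun c hc => ?_
  rw [Finset.mem_image] at hc
  obtain ⟨m, hm, rfl⟩ := hc
  rw [Finset.mem_filter, Finset.mem_range] at hm
  have hpos : 0 < num n (colorOf color) ((List.range d).map (coordOf P)) (boxList a b)
      (color ⟨m, hm.1⟩ : ℕ) := by
    exact Finset.card_pos.2 ⟨m, Finset.mem_filter.2
      ⟨Finset.mem_range.2 hm.1, hm.2, by simp [colorOf, hm.1]⟩⟩
  simp only [Finset.mem_map, Set.mem_toFinset, Set.mem_ofPred_eq]
  refine ⟨color ⟨m, hm.1⟩, ?_, by simp [colorOf, hm.1]⟩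
  rwa [num_eq_freq] at hpos

theorem reports_of_out (a b : Fin d → ℝ) {out : List (ℕ × ℤ)} (hnd : out.Nodup)
    (hout : ∀ (c : ℕ) (f : ℤ), (c, f) ∈ out ↔
      f = num n (colorOf color) ((List.range d).map (coordOf P)) (boxList a b) c ∧ 0 < f) :
    Reports P color (Set.Icc a b) (out.map fun p => (Val.col p.1, Val.int p.2)) := by
  have hlt : ∀ y ∈ out, y.1 < φ ∧ ((y.2.toNat : ℕ) : ℤ) = y.2 := by
    intro y hy
    have := (hout y.1 y.2).1 hy
    refine ⟨colorOf_lt color (c := y.1) (by have h1 := this.1; have h2 := this.2; rw [h1] at h2; exact_mod_cast h2),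
      by omega⟩
  refine ⟨out.attach.map fun y => ((⟨y.1.1, (hlt y.1 y.2).1⟩ : Fin φ), y.1.2.toNat), ?_, ?_, ?_⟩
  · refine (List.nodup_attach.2 hnd).map fun y z h => ?_
    obtain ⟨h1, h2⟩ := Prod.mk.inj h
    have h3 := (hlt y.1 y.2).2
    have h4 := (hlt z.1 z.2).2
    refine Subtype.ext (Prod.ext (congrArg Fin.val h1) ?_)
    rw [← h3, ← h4, h2]
  · intro c f
    rw [List.mem_map, ← num_eq_freq]
    constructor
    · rintro ⟨⟨y, hy⟩, -, h⟩
      obtain ⟨rfl, rfl⟩ := Prod.mk.inj h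
      have h1 := (hout y.1 y.2).1 hy
      have h2 := (hlt y hy).2
      refine ⟨?_, by have := h1.2; change 0 < y.2.toNat; omega⟩
      have := h1.1
      rw [← h2] at this
      exact_mod_cast this
    · rintro ⟨rfl, h⟩
      exact ⟨⟨(c, _), (hout _ _).2 ⟨rfl, by exact_mod_cast h⟩⟩, List.mem_attach _ _, by simp⟩
  · conv_lhs => rw [← List.attach_map_subtype_val out]
    rw [List.map_map, List.map_map]
    refine List.map_congr_left fun y _ => ?_
    simp [(hlt y.1 y.2).2]

end

def queryCost (d NB H m k : ℕ) : ℕ :=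
  d * (8 * H + 17) + asksCost (H + 1) (askCost NB H m) d + 17 * (2 ^ d * (NB ^ m * 2) * k) + 20

theorem getD_rep {d n : ℕ} (h : Heap) {root : T} {v : Val} (hv : Rep n h root v) (a b : Fin d → ℝ) (i : ℕ)
    (hi : i < 2 * d + 1) :
    Rep n h ((root :: (((boxList a b).map Prod.fst).map T.real ++
      ((boxList a b).map Prod.snd).map T.real)).getD i .nil) ((queryStart h v a b).reg i) := by
  have hlen : (boxList a b).length = d := by simp [boxList]
  cases i with
  | zero => simpa [queryStart] using hv
  | succ i =>
    rw [List.getD_cons_succ]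
    by_cases h1 : i < d
    · have : (((boxList a b).map Prod.fst).map T.real ++ ((boxList a b).map Prod.snd).map T.real).getD i .nil =
          .real (a ⟨i, h1⟩) := by
        rw [List.getD_append _ _ _ _ (by simpa [hlen] using h1), List.getD_eq_getElem _ _ (by simpa [hlen] using h1)]
        simp [boxList]
      rw [this]
      simp [queryStart, h1, Rep]
    · have h2 : i - d < d := by omega
      have : (((boxList a b).map Prod.fst).map T.real ++ ((boxList a b).map Prod.snd).map T.real).getD i .nil =
          .real (b ⟨i - d, h2⟩) := by
        rw [List.getD_append_right _ _ _ _ (by simp [hlen]; omega),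
          List.getD_eq_getElem _ _ (by simp [hlen]; omega)]
        simp [boxList]
      rw [this]
      simp [queryStart, h1, h2, Rep]

/-- Invariant of all memories after queries: the input is intact with empty scratch fields, and the
memory extends that left by the construction. Hence every query meets the same structure, and its
reachable records are among those present after the construction, at most `n` plus the construction
time. -/
theorem exists_solves {d m : ℕ} (hd : d = m + 1) : ∃ K : ℕ, ∀ (n s φ : ℕ) (P : Fin n → Fin d → ℝ)
    (color : Fin n → Fin φ), 2 ≤ s → s ≤ n → ∀ H g : ℕ, (∀ i < H, 2 ^ i ≤ n) → n < 2 ^ H → 2 ^ H ≤ 2 * n →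
    2 ^ g ≤ s → ∃ NB : ℕ, NB * g ≤ H + g ∧ ∀ (bt sz : ℝ) (qt : ℝ → ℝ),
      ((K * (buildCost d n H (insCost NB s m) + 1) : ℕ) : ℝ) ≤ bt →
      ((n + K * (buildCost d n H (insCost NB s m) + 1) : ℕ) : ℝ) ≤ sz →
      (∀ k : ℕ, ((K * (queryCost d NB H m k + 1) : ℕ) : ℝ) ≤ qt k) →
      Solves (n ^ 3) (whole (prog d) (d + 2) fBuild) (whole (prog d) (d + 2) fQuery) s P color bt sz qt := by
  obtain ⟨K₁, hK₁⟩ := exists_exec_whole (prog d) (prog_wf d) (d + 2) fBuild (by change 37 < 39; norm_num)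
  obtain ⟨K₂, hK₂⟩ := exists_exec_whole (prog d) (prog_wf d) (d + 2) fQuery (by change 38 < 39; norm_num)
  refine ⟨K₁ + K₂, fun n s φ P color hs hsn H g hH hH1 hH2 hg => ?_⟩
  have hn : 2 ≤ n := hs.trans hsn
  set I := inp P color with hI
  have hIn : I.n = n := rfl
  have hIW : I.W = n ^ 3 := rfl
  have hW : 2 * I.n ≤ I.W := by
    rw [hIn, hIW]
    nlinarith [Nat.pow_le_pow_left hn 2, sq_nonneg n, pow_succ n 2]
  obtain ⟨NB, root, r1, r2, r3⟩ := build_spec (input_inp P color) hn hd hs hsn hW hH hH1 hH2 hg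
  refine ⟨NB, r2, fun bt sz qt hbt hsz hqt => ?_⟩
  obtain ⟨t, τ, e1, e2, e3, e4, e5, e6⟩ := hK₁ I rfl [.pt 0, .int s] _ _ _ _ (buildStart s P color) rfl (r1 [])
    (by
      intro i hi
      have hi : i < 2 := hi
      interval_cases i
      · simp [buildStart, Rep, hI, inp]; omega
      · simp [buildStart, Rep]) (good_start P color s) rfl
  have e2' : t ≤ (K₁ + K₂) * (buildCost d n H (insCost NB s m) + 1) :=
    e2.trans (Nat.mul_le_mul_right _ (by omega))
  refine ⟨t, τ, e1, le_trans (by exact_mod_cast e2') hbt, ?_⟩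
  have hquery : ∀ h : Heap, Good I h (fun _ => .nil) → XExt τ.heap h → ∀ a b : Fin d → ℝ, ∃ u υ,
      Exec (n ^ 3) (whole (prog d) (d + 2) fQuery) (queryStart h (τ.reg 0) a b) u υ ∧
      Reports P color (Set.Icc a b) υ.out ∧ (u : ℝ) ≤ qt (numColors P color (Set.Icc a b)) ∧
      Good I υ.heap (fun _ => .nil) ∧ XExt τ.heap υ.heap := by
    intro h hg' hx a b
    obtain ⟨out, o1, o2, o3⟩ := r3 (boxList a b) (by simp [boxList])
    obtain ⟨u, υ, f1, f2, f3, f4, -, f6⟩ := hK₂ I rfl _ _ _ _ _ (queryStart h (τ.reg 0) a b) (by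
        simp [boxList, prog, arity]; omega) o1 (by
        intro i hi
        exact getD_rep h (e5.mono hx.ext) a b i (by simp [boxList] at hi; omega)) hg' rfl
    refine ⟨u, υ, f1, ?_, ?_, f3, hx.trans (f4.xext hg' f3)⟩
    · rw [f6]; exact reports_of_out P color a b o2 o3
    · refine le_trans ?_ (hqt _)
      have h1 := numCol_le P color a b
      have h2 : u ≤ (K₁ + K₂) * (queryCost d NB H m (numColors P color (Set.Icc a b)) + 1) := by
        refine f2.trans (Nat.mul_le_mul (by omega) ?_)
        have := Nat.mul_le_mul_left (2 ^ d * (NB ^ m * 2)) h1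
        unfold queryCost
        rw [hIn]
        omega
      exact_mod_cast h2
  have hafter : ∀ h, AfterQueries (n ^ 3) d (whole (prog d) (d + 2) fQuery) (τ.reg 0) τ.heap h →
      Good I h (fun _ => .nil) ∧ XExt τ.heap h := by
    intro h hh
    induction hh with
    | init => exact ⟨e3, XExt.refl _⟩
    | @step h a b t' σ _ he ih =>
      obtain ⟨u, υ, f1, -, -, f4, f5⟩ := hquery h ih.1 ih.2 a b
      -- The given run is the one known to preserve the invariant.
      rw [exec_det he f1]
      exact ⟨f4, f5⟩
  intro h hh
  obtain ⟨h1, h2⟩ := hafter h hh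
  refine ⟨sizeAtMost_of_rep e3 h2 e5 (le_trans ?_ hsz), fun a b => ?_⟩
  · have := next_le_of_exec e1
    have h3 : (buildStart s P color).heap.next = n := rfl
    rw [h3] at this
    exact_mod_cast this.trans (by omega)
  · obtain ⟨u, υ, f1, f2, f3, -, -⟩ := hquery h h1 h2 a b
    exact ⟨u, υ, f1, f2, f3⟩

end FunLang

namespace FunLang

open PointerMachine ColorFrequency

/-! ### Asymptotic bounds -/

/-- Each key contributes a factor `NB * s ≤ 5 * (s * l)`; lower terms are absorbed because `1 ≤ s *
l`. -/
theorem insCost_le (j : ℕ) : ∃ c : ℝ, 0 ≤ c ∧ ∀ (NB s : ℕ) (l : ℝ), (NB : ℝ) ≤ 5 * l → 1 ≤ s * l →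
    (insCost NB s j : ℝ) ≤ c * (s * l) ^ j := by
  induction j with
  | zero => exact ⟨41, by norm_num, fun NB s l _ _ => by simp [insCost]⟩
  | succ j ih =>
    obtain ⟨c, hc, h⟩ := ih
    refine ⟨5 * c + 95, by positivity, fun NB s l hN hs => ?_⟩
    have h1 := h NB s l hN hs
    have h2 : (1 : ℝ) ≤ (s * l) ^ j := one_le_pow₀ hs
    have h3 : (1 : ℝ) ≤ (s * l) ^ (j + 1) := one_le_pow₀ hs
    have h4 : (NB : ℝ) * s ≤ 5 * (s * l) := by
      calc (NB : ℝ) * s ≤ 5 * l * s := by gcongr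
        _ = 5 * (s * l) := by ring
    simp only [insCost]
    push_cast
    calc (NB : ℝ) * (s * (insCost NB s j + 18)) + 5 = NB * s * (insCost NB s j + 18) + 5 := by ring
      _ ≤ 5 * (s * l) * (c * (s * l) ^ j + 18 * (s * l) ^ j) + 5 * (s * l) ^ (j + 1) := by
        gcongr
        · linarith
        · linarith
      _ = (5 * c + 95) * (s * l) ^ (j + 1) := by ring

/-- The hypothesis `L ≤ Y` lets the insertion cost `Y` absorb the logarithm of the sorting, so that
only `j` factors `L` arise. -/
theorem structCost_le (j : ℕ) : ∃ c : ℝ, 0 ≤ c ∧ ∀ (F K : ℕ) (L Y : ℝ), (F : ℝ) ≤ 5 * L → (K : ℝ) ≤ Y →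
    1 ≤ L → L ≤ Y → (structCost F K j : ℝ) ≤ c * (L ^ j * Y) := by
  induction j with
  | zero =>
    refine ⟨180, by norm_num, fun F K L Y hF hK h1 hL => ?_⟩
    simp only [structCost]
    push_cast
    linarith
  | succ j ih =>
    obtain ⟨c, hc, h⟩ := ih
    refine ⟨5 * c + 165, by positivity, fun F K L Y hF hK h1 hL => ?_⟩
    have h2 := h F K L Y hF hK h1 hL
    have h3 : (1 : ℝ) ≤ L ^ j * Y := one_le_mul_of_one_le_of_one_le (one_le_pow₀ h1) (h1.trans hL)
    have h4 : (1 : ℝ) ≤ L * (L ^ j * Y) := one_le_mul_of_one_le_of_one_le h1 h3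
    simp only [structCost]
    push_cast
    calc (F : ℝ) * (structCost F K j + 32) + 5
        ≤ 5 * L * (c * (L ^ j * Y) + 32 * (L ^ j * Y)) + 5 * (L * (L ^ j * Y)) := by
          gcongr
          · linarith
          · linarith
      _ = (5 * c + 165) * (L ^ (j + 1) * Y) := by ring

theorem buildCost_le {d : ℕ} (hd : d ≠ 0) : ∃ c : ℝ, 0 ≤ c ∧ ∀ (n H K : ℕ) (L Y : ℝ), 1 ≤ n →
    ((H + 1 : ℕ) : ℝ) ≤ 5 * L → (K : ℝ) ≤ Y → 1 ≤ L → L ≤ Y →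
    ((buildCost d n H K + 1 : ℕ) : ℝ) ≤ c * (n * L ^ d * Y) := by
  obtain ⟨c, hc, h⟩ := structCost_le d
  refine ⟨c + d * (200 + 16 + 25 + 17) + 100 + 10 + 85 + 41, by positivity, fun n H K L Y hn hH hK h1 hL => ?_⟩
  have h2 := h (H + 1) K L Y hH hK h1 hL
  have hn' : (1 : ℝ) ≤ n := by exact_mod_cast hn
  have h3 : L ≤ L ^ d := le_self_pow₀ h1 hd
  have hY : 1 ≤ Y := h1.trans hL
  have h4 : (n : ℝ) * L ≤ n * L ^ d * Y := by
    calc (n : ℝ) * L ≤ n * L ^ d := by gcongr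
      _ ≤ n * L ^ d * Y := le_mul_of_one_le_right (by positivity) hY
  have h5 : (n : ℝ) ≤ n * L := le_mul_of_one_le_right (by positivity) h1
  have h6 : L ≤ n * L := le_mul_of_one_le_left (by positivity) hn'
  set Z := (n : ℝ) * L ^ d * Y with hZ
  have hH0 : (0 : ℝ) ≤ H := Nat.cast_nonneg _
  push_cast at hH
  have h7 : (n : ℝ) * (H + 1) ≤ 5 * Z := by
    calc (n : ℝ) * (H + 1) ≤ n * (5 * L) := by gcongr
      _ = 5 * (n * L) := by ring
      _ ≤ 5 * Z := by gcongr
  have h8 : (n : ℝ) * (H + 2) ≤ 10 * Z := by nlinarith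
  have h9 : (structCost (H + 1) K d : ℝ) * n ≤ c * Z := by
    calc (structCost (H + 1) K d : ℝ) * n ≤ c * (L ^ d * Y) * n := by gcongr
      _ = c * Z := by rw [hZ]; ring
  have h10 : (20 : ℝ) * n * (H + 2) + 16 * n + 5 * (H + 1) + 17 ≤ (200 + 16 + 25 + 17) * Z := by linarith
  have h11 : (d : ℝ) * (20 * n * (H + 2) + 16 * n + 5 * (H + 1) + 17) ≤ d * ((200 + 16 + 25 + 17) * Z) := by
    gcongr
  unfold buildCost
  push_cast
  nlinarith

/-- For the last key the descent through all bits costs `O(L)` and the bags cost `O(l)`, which is no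
more. Each earlier key multiplies by the number of blocks, so there is one factor `l` fewer than
keys. -/
theorem askCost_le (j : ℕ) : ∃ c : ℝ, 0 ≤ c ∧ ∀ (NB H : ℕ) (L l : ℝ), (NB : ℝ) ≤ 5 * l → (H : ℝ) ≤ 5 * L →
    1 ≤ l → l ≤ L → (askCost NB H (j + 1) : ℝ) ≤ c * (L * l ^ j) := by
  induction j with
  | zero =>
    refine ⟨85, by norm_num, fun NB H L l hN hH h1 hl => ?_⟩
    simp only [askCost]
    push_cast
    linarith
  | succ j ih =>
    obtain ⟨c, hc, h⟩ := ih
    refine ⟨5 * c + 60, by positivity, fun NB H L l hN hH h1 hl => ?_⟩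
    have h2 := h NB H L l hN hH h1 hl
    have h0 : 1 ≤ L := h1.trans hl
    have h3 : (1 : ℝ) ≤ L * l ^ j := one_le_mul_of_one_le_of_one_le h0 (one_le_pow₀ h1)
    have h4 : L ≤ L * l ^ (j + 1) := le_mul_of_one_le_right (by linarith) (one_le_pow₀ h1)
    rw [askCost]
    push_cast
    calc (NB : ℝ) * (askCost NB H (j + 1) + 7) + 4 * H + 5
        ≤ 5 * l * (c * (L * l ^ j) + 7 * (L * l ^ j)) + 4 * (5 * (L * l ^ (j + 1))) + 5 * (L * l ^ (j + 1)) := by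
          gcongr
          · linarith
          · linarith
          · linarith
      _ = (5 * c + 60) * (L * l ^ (j + 1)) := by ring

theorem asksCost_le (j : ℕ) : ∃ c : ℝ, 0 ≤ c ∧ ∀ (F A : ℕ) (Y : ℝ), (F : ℝ) ≤ 5 * Y → 1 ≤ Y → ∀ a : ℝ,
    (A : ℝ) ≤ a * Y → 0 ≤ a → (asksCost F A j : ℝ) ≤ c * (a + 1) * Y := by
  induction j with
  | zero =>
    refine ⟨28, by norm_num, fun F A Y hF hY a hA ha => ?_⟩
    simp only [asksCost]
    push_cast
    nlinarith
  | succ j ih =>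
    obtain ⟨c, hc, h⟩ := ih
    refine ⟨2 * c + 30, by positivity, fun F A Y hF hY a hA ha => ?_⟩
    have h2 := h F A Y hF hY a hA ha
    simp only [asksCost]
    push_cast
    nlinarith [mul_nonneg ha (by linarith : (0 : ℝ) ≤ Y)]

theorem queryCost_le (d m : ℕ) : ∃ c : ℝ, 0 ≤ c ∧ ∀ (NB H : ℕ) (L l : ℝ), (NB : ℝ) ≤ 5 * l →
    ((H + 1 : ℕ) : ℝ) ≤ 5 * L → 1 ≤ l → l ≤ L → ∀ k : ℕ,
    ((queryCost d NB H (m + 1) k + 1 : ℕ) : ℝ) ≤ c * (L * l ^ m + k * l ^ (m + 1)) := by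
  obtain ⟨a, ha, h⟩ := askCost_le m
  obtain ⟨c, hc, h'⟩ := asksCost_le d
  refine ⟨d * 57 + c * (a + 1) + 21 + 34 * 2 ^ d * 5 ^ (m + 1), by positivity,
    fun NB H L l hN hH h1 hl k => ?_⟩
  have h0 : 1 ≤ L := h1.trans hl
  have hLY : L ≤ L * l ^ m := le_mul_of_one_le_right (by linarith) (one_le_pow₀ h1)
  have hH' : (H : ℝ) ≤ 5 * L := by push_cast at hH; linarith
  have h2 := h NB H L l hN hH' h1 hl
  have h3 := h' (H + 1) (askCost NB H (m + 1)) (L * l ^ m) (by linarith) (by linarith) a h2 ha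
  have h4 : (NB : ℝ) ^ (m + 1) ≤ 5 ^ (m + 1) * l ^ (m + 1) := by
    rw [← mul_pow]; gcongr
  set Y := L * l ^ m with hY
  set Z := (k : ℝ) * l ^ (m + 1) with hZ
  have hZ0 : 0 ≤ Z := by positivity
  have hY0 : 1 ≤ Y := by linarith
  have h5 : (17 : ℝ) * (2 ^ d * (NB ^ (m + 1) * 2) * k) ≤ 34 * 2 ^ d * 5 ^ (m + 1) * Z := by
    calc (17 : ℝ) * (2 ^ d * (NB ^ (m + 1) * 2) * k)
        ≤ 17 * (2 ^ d * (5 ^ (m + 1) * l ^ (m + 1) * 2) * k) := by gcongr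
      _ = 34 * 2 ^ d * 5 ^ (m + 1) * Z := by rw [hZ]; ring
  have h6 : (d : ℝ) * (8 * H + 17) ≤ d * (57 * Y) := by gcongr; linarith
  have h7 : (0 : ℝ) ≤ 34 * 2 ^ d * 5 ^ (m + 1) := by positivity
  unfold queryCost
  push_cast
  have h8 : 0 ≤ (d * 57 + c * (a + 1) + 21) * Z := by positivity
  have h9 : 0 ≤ (34 * 2 ^ d * 5 ^ (m + 1) : ℝ) * Y := by positivity
  nlinarith

end FunLang

/-! ### Logarithms, the number of blocks and the choice of the parameter -/

namespace FunLang

open PointerMachine ColorFrequency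

theorem Solves.mono {n d φ W : ℕ} {build query : Cmd} {s : ℕ} {P : Fin n → Fin d → ℝ}
    {color : Fin n → Fin φ} {bt bt' sz sz' : ℝ} {qt qt' : ℝ → ℝ}
    (h : Solves W build query s P color bt sz qt) (hb : bt ≤ bt') (hs : sz ≤ sz')
    (hq : ∀ k : ℕ, qt k ≤ qt' k) : Solves W build query s P color bt' sz' qt' := by
  obtain ⟨t, σ, h1, h2, h3⟩ := h
  refine ⟨t, σ, h1, h2.trans hb, fun hp hA => ?_⟩
  obtain ⟨h4, h5⟩ := h3 hp hA
  refine ⟨?_, fun a b => ?_⟩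
  · obtain ⟨S, hS⟩ := h4
    exact ⟨S, by grind⟩
  · obtain ⟨u, τ, h6, h7, h8⟩ := h5 a b
    exact ⟨u, τ, h6, h7, h8.trans (hq _)⟩

theorem half_le_log {n : ℕ} (hn : 2 ≤ n) : 1 / 2 ≤ Real.log n := by
  have h1 : Real.log 2 ≤ Real.log n := Real.log_le_log (by norm_num) (by exact_mod_cast hn)
  have := Real.log_two_gt_d9
  linarith

theorem one_le_logb {n s : ℕ} (hs : 2 ≤ s) (hsn : s ≤ n) : 1 ≤ Real.logb s n := by
  have h1 : (1 : ℝ) < s := by exact_mod_cast hs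
  rw [Real.le_logb_iff_rpow_le h1 (by exact_mod_cast (by omega : 0 < n)), Real.rpow_one]
  exact_mod_cast hsn

theorem logb_mul_log {n s : ℕ} (hs : 2 ≤ s) : Real.logb s n * Real.log s = Real.log n := by
  have h1 : (1 : ℝ) < s := by exact_mod_cast hs
  exact div_mul_cancel₀ _ (Real.log_pos h1).ne'

theorem logb_le_two_mul_log {n s : ℕ} (hs : 2 ≤ s) (hsn : s ≤ n) : Real.logb s n ≤ 2 * Real.log n := by
  rw [← logb_mul_log hs (n := n)]
  nlinarith [half_le_log hs, one_le_logb hs hsn]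

/-- This follows from `log s ≤ s - 1` and lets the insertion cost dominate the cost of sorting. -/
theorem log_le_mul_logb {n s : ℕ} (hs : 2 ≤ s) (hsn : s ≤ n) : Real.log n ≤ s * Real.logb s n := by
  rw [← logb_mul_log hs (n := n)]
  have h1 : (0 : ℝ) < s := by exact_mod_cast (by omega : 0 < s)
  nlinarith [Real.log_le_sub_one_of_pos h1, one_le_logb hs hsn]

theorem natLog_mul_log_two_le {n : ℕ} (hn : 2 ≤ n) : Nat.log 2 n * Real.log 2 ≤ Real.log n := by
  rw [← Real.log_pow]
  exact Real.log_le_log (by positivity) (by exact_mod_cast Nat.pow_log_le_self 2 (by omega))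

theorem log_le_natLog_succ {s : ℕ} (hs : 2 ≤ s) : Real.log s ≤ (Nat.log 2 s + 1) * Real.log 2 := by
  have h : Real.log s ≤ Real.log (2 ^ (Nat.log 2 s + 1)) :=
    Real.log_le_log (by exact_mod_cast (by omega : 0 < s))
      (by exact_mod_cast (Nat.lt_pow_succ_log_self (by norm_num) s).le)
  rw [Real.log_pow] at h
  exact_mod_cast h

theorem height_le {n : ℕ} (hn : 2 ≤ n) : ((Nat.log 2 n + 1 + 1 : ℕ) : ℝ) ≤ 5 * (2 * Real.log n) := by
  have := natLog_mul_log_two_le hn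
  have := half_le_log hn
  have := Real.log_two_gt_d9
  push_cast
  have : (0 : ℝ) ≤ Nat.log 2 n := by positivity
  nlinarith

/-- With `g = Nat.log 2 s ≥ 1`, the number of bits of `s` satisfies `g + 1 ≤ 2 * g`. Hence rounding
`log_2 s` down to `g` costs a factor `2` at most. -/
theorem numBlocks_le {n s NB : ℕ} (hs : 2 ≤ s) (hsn : s ≤ n)
    (h : NB * Nat.log 2 s ≤ Nat.log 2 n + 1 + Nat.log 2 s) : (NB : ℝ) ≤ 5 * Real.logb s n := by
  have hl := one_le_logb hs hsn
  have hg : (1 : ℝ) ≤ Nat.log 2 s := by exact_mod_cast Nat.log_pos (by norm_num) hs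
  have h2 := Real.log_pos (by norm_num : (1 : ℝ) < 2)
  have h' : (NB : ℝ) * Nat.log 2 s ≤ Nat.log 2 n + 1 + Nat.log 2 s := by exact_mod_cast h
  have h3 : (Nat.log 2 n : ℝ) ≤ 2 * Real.logb s n * Nat.log 2 s := by
    refine le_of_mul_le_mul_right ?_ h2
    calc Nat.log 2 n * Real.log 2 ≤ Real.log n := natLog_mul_log_two_le (hs.trans hsn)
      _ = Real.logb s n * Real.log s := (logb_mul_log hs).symm
      _ ≤ Real.logb s n * ((Nat.log 2 s + 1) * Real.log 2) := by gcongr; exact log_le_natLog_succ hs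
      _ ≤ Real.logb s n * ((Nat.log 2 s + Nat.log 2 s) * Real.log 2) := by gcongr
      _ = 2 * Real.logb s n * Nat.log 2 s * Real.log 2 := by ring
  refine le_of_mul_le_mul_right (?_ : _ ≤ _ * (Nat.log 2 s : ℝ)) (by linarith)
  nlinarith

/-- The height is `Nat.log 2 n + 1`, and `2 * log n` is used as the unit because it is at least `1`.
The construction time obeys the bound proved for the size; its additional logarithm is not needed.
-/
theorem exists_solves_real {d : ℕ} (hd : 2 ≤ d) : ∃ C : ℝ, 0 ≤ C ∧
    ∀ (n s φ : ℕ) (P : Fin n → Fin d → ℝ) (color : Fin n → Fin φ), 2 ≤ s → s ≤ n →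
      Solves (n ^ 3) (whole (prog d) (d + 2) fBuild) (whole (prog d) (d + 2) fQuery) s P color
        (C * (n * Real.log n ^ (d + 1) * (s * Real.logb s n) ^ (d - 1)))
        (C * (n * Real.log n ^ d * (s * Real.logb s n) ^ (d - 1)))
        (fun k => C * (Real.log n * Real.logb s n ^ (d - 2) + k * Real.logb s n ^ (d - 1))) := by
  obtain ⟨m, rfl⟩ : ∃ m, d = m + 2 := ⟨d - 2, by omega⟩
  obtain ⟨K, hK⟩ := exists_solves (d := m + 2) (m := m + 1) rfl
  obtain ⟨ci, hci, hi⟩ := insCost_le (m + 1)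
  obtain ⟨cb, hcb, hb⟩ := buildCost_le (d := m + 2) (by omega)
  obtain ⟨cq, hcq, hq⟩ := queryCost_le (m + 2) m
  set D : ℝ := (1 + K * cb) * (2 ^ (m + 2) * (ci + 2)) with hD
  have hD0 : 0 ≤ D := by positivity
  refine ⟨2 * D + 2 * K * cq, by positivity, fun n s φ P color hs hsn => ?_⟩
  have hn : 2 ≤ n := hs.trans hsn
  obtain ⟨NB, hNB, hsol⟩ := hK n s φ P color hs hsn (Nat.log 2 n + 1) (Nat.log 2 s)
    (fun i hi => (Nat.pow_le_pow_right (by norm_num) (by omega)).trans (Nat.pow_log_le_self 2 (by omega)))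
    (Nat.lt_pow_succ_log_self (by norm_num) n)
    (by rw [pow_succ]; have := Nat.pow_log_le_self 2 (by omega : n ≠ 0); omega)
    (Nat.pow_log_le_self 2 (by omega))
  have hNB' := numBlocks_le hs hsn hNB
  have hlam := half_le_log hn
  have hl1 := one_le_logb hs hsn
  have hlL := logb_le_two_mul_log hs hsn
  have hsl := log_le_mul_logb hs hsn
  have hH := height_le hn
  set lam := Real.log n
  set l := Real.logb s n
  have hs' : (2 : ℝ) ≤ s := by exact_mod_cast hs
  have hsl1 : 1 ≤ s * l := by nlinarith
  have hslm : s * l ≤ (s * l) ^ (m + 1) := le_self_pow₀ hsl1 (by omega)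
  have hsl0 : (0 : ℝ) ≤ (s * l) ^ (m + 1) := by positivity
  -- The summand `2` in `ci + 2` ensures that `2 * lam` is at most the insertion bound.
  have hcost := hb n (Nat.log 2 n + 1) (insCost NB s (m + 1)) (2 * lam) ((ci + 2) * (s * l) ^ (m + 1))
    (by omega) hH ((hi NB s l hNB' hsl1).trans (by nlinarith)) (by linarith) (by nlinarith)
  have hY1 : 1 ≤ (2 * lam) ^ (m + 2) * ((ci + 2) * (s * l) ^ (m + 1)) :=
    one_le_mul_of_one_le_of_one_le (one_le_pow₀ (by linarith)) (by nlinarith)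
  have hsize : ((n + K * (buildCost (m + 2) n (Nat.log 2 n + 1) (insCost NB s (m + 1)) + 1) : ℕ) : ℝ) ≤
      D * (n * lam ^ (m + 2) * (s * l) ^ (m + 1)) := by
    push_cast at hcost ⊢
    calc _ ≤ n * ((2 * lam) ^ (m + 2) * ((ci + 2) * (s * l) ^ (m + 1))) +
          K * (cb * (n * (2 * lam) ^ (m + 2) * ((ci + 2) * (s * l) ^ (m + 1)))) := by
          gcongr
          exact le_mul_of_one_le_right (by positivity) hY1
      _ = _ := by rw [hD, mul_pow]; ring
  have hX : 0 ≤ n * lam ^ (m + 2) * (s * l) ^ (m + 1) := by positivity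
  have hKq : 0 ≤ 2 * K * cq := by positivity
  refine hsol _ _ _ ?_ (hsize.trans ?_) fun k => ?_
  -- The time bound follows from the size bound by inserting the factor `2 * lam ≥ 1`.
  · refine le_trans (le_trans (by push_cast; linarith) hsize) ?_
    calc D * (n * lam ^ (m + 2) * (s * l) ^ (m + 1))
        ≤ D * (n * lam ^ (m + 2) * (s * l) ^ (m + 1)) * (2 * lam) :=
          le_mul_of_one_le_right (by positivity) (by linarith)
      _ = 2 * D * (n * lam ^ (m + 2 + 1) * (s * l) ^ (m + 1)) := by ring
      _ ≤ _ := by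
          gcongr
          · linarith
          · exact le_rfl
  · change _ ≤ _ * (n * lam ^ (m + 2) * (s * l) ^ (m + 1))
    gcongr
    linarith
  · have h := hq NB (Nat.log 2 n + 1) (2 * lam) l hNB' hH hl1 hlL k
    push_cast at h ⊢
    change _ ≤ _ * (lam * l ^ m + k * l ^ (m + 1))
    calc _ ≤ K * (cq * (2 * lam * l ^ m + k * l ^ (m + 1))) := by gcongr
      _ ≤ K * (cq * (2 * (lam * l ^ m + k * l ^ (m + 1)))) := by
          gcongr
          have : 0 ≤ k * l ^ (m + 1) := by positivity
          linarith
      _ = 2 * K * cq * (lam * l ^ m + k * l ^ (m + 1)) := by ring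
      _ ≤ _ := by gcongr; linarith

/-- With `δ = ε / d`, the factor `s ^ (d - 1)` contributes `d - 1` factors `n ^ δ` and the
logarithms contribute one more, together `n ^ ε`. Moreover `log_s n` is bounded: it is `1` if `s =
n` and at most `1 / δ` otherwise. -/
theorem exists_solves_rpow {d : ℕ} (hd : 2 ≤ d) {ε : ℝ} (hε : 0 < ε) : ∃ C : ℝ,
    ∀ (n s φ : ℕ) (P : Fin n → Fin d → ℝ) (color : Fin n → Fin φ), 2 ≤ n →
      s = min n ⌈(n : ℝ) ^ (ε / d)⌉₊ →
      Solves (n ^ 3) (whole (prog d) (d + 2) fBuild) (whole (prog d) (d + 2) fQuery) s P color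
        (C * (n : ℝ) ^ (1 + ε)) (C * (n : ℝ) ^ (1 + ε)) (fun k => C * (Real.log n + k)) := by
  obtain ⟨C, hC, h⟩ := exists_solves_real hd
  have hd0 : (0 : ℝ) < d := by exact_mod_cast (by omega : 0 < d)
  set δ := ε / d with hδ
  have hδ0 : 0 < δ := by positivity
  set M := max 1 (1 / δ) with hM
  have hM1 : 1 ≤ M := le_max_left _ _
  -- The constant comes from `log n ≤ n ^ η / η` with `η = δ / (d + 1)`, raised to the power `d +
  -- 1`.
  set A := (1 / (δ / (d + 1))) ^ (d + 1) with hA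
  have hA0 : 0 ≤ A := by positivity
  refine ⟨C * (2 * A * (2 * M) ^ (d - 1) + M ^ (d - 1)), fun n s φ P color hn hsdef => ?_⟩
  have hn1 : (1 : ℝ) < n := by exact_mod_cast hn
  have hp1 : 1 < (n : ℝ) ^ δ := Real.one_lt_rpow hn1 hδ0
  have hceil : 2 ≤ ⌈(n : ℝ) ^ δ⌉₊ := by
    have : 1 < ⌈(n : ℝ) ^ δ⌉₊ := Nat.lt_ceil.2 (by exact_mod_cast hp1)
    omega
  have hs : 2 ≤ s := by rw [hsdef]; exact le_min hn hceil
  have hsn : s ≤ n := by rw [hsdef]; exact min_le_left _ _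
  have hlam := half_le_log hn
  have hl1 := one_le_logb hs hsn
  have hs2 : (s : ℝ) ≤ 2 * (n : ℝ) ^ δ := by
    have h1 : (s : ℝ) ≤ ⌈(n : ℝ) ^ δ⌉₊ := by rw [hsdef]; exact_mod_cast min_le_right _ _
    have h2 := Nat.ceil_lt_add_one (by positivity : 0 ≤ (n : ℝ) ^ δ)
    linarith
  have hlM : Real.logb s n ≤ M := by
    have hs1 : (1 : ℝ) < s := by exact_mod_cast hs
    rcases min_choice n ⌈(n : ℝ) ^ δ⌉₊ with h' | h'
    · rw [hsdef, h', Real.logb_self_eq_one hn1]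
      exact hM1
    · refine le_trans ?_ (le_max_right _ _)
      rw [Real.logb_le_iff_le_rpow hs1 (by linarith)]
      have h3 : (n : ℝ) ^ δ ≤ s := by rw [hsdef, h']; exact Nat.le_ceil _
      calc (n : ℝ) = ((n : ℝ) ^ δ) ^ (1 / δ) := by
            rw [← Real.rpow_mul (by positivity), mul_one_div_cancel hδ0.ne', Real.rpow_one]
        _ ≤ (s : ℝ) ^ (1 / δ) := by gcongr
  have hlog : Real.log n ^ (d + 1) ≤ A * (n : ℝ) ^ δ := by
    have hη : 0 < δ / (d + 1) := by positivity
    calc Real.log n ^ (d + 1) ≤ ((n : ℝ) ^ (δ / (d + 1)) / (δ / (d + 1))) ^ (d + 1) := by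
          gcongr
          exact Real.log_le_rpow_div (by positivity) hη
      _ = A * ((n : ℝ) ^ (δ / (d + 1))) ^ (d + 1) := by rw [hA]; ring
      _ = A * (n : ℝ) ^ δ := by
          rw [← Real.rpow_natCast, ← Real.rpow_mul (by positivity)]
          congr 2
          push_cast
          field_simp
  have hexp : (n : ℝ) * (n : ℝ) ^ δ * ((n : ℝ) ^ δ) ^ (d - 1) = (n : ℝ) ^ (1 + ε) := by
    obtain ⟨m, rfl⟩ : ∃ m, d = m + 1 := ⟨d - 1, by omega⟩
    rw [Nat.add_sub_cancel, mul_assoc, ← pow_succ', ← Real.rpow_natCast, ← Real.rpow_mul (by positivity), hδ,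
      div_mul_cancel₀ _ hd0.ne', Real.rpow_add (by positivity), Real.rpow_one]
  have hmain : n * Real.log n ^ (d + 1) * (s * Real.logb s n) ^ (d - 1) ≤
      A * (2 * M) ^ (d - 1) * (n : ℝ) ^ (1 + ε) := by
    calc _ ≤ n * (A * (n : ℝ) ^ δ) * (2 * (n : ℝ) ^ δ * M) ^ (d - 1) := by gcongr
      _ = A * (2 * M) ^ (d - 1) * (n * (n : ℝ) ^ δ * ((n : ℝ) ^ δ) ^ (d - 1)) := by
          rw [show 2 * (n : ℝ) ^ δ * M = 2 * M * (n : ℝ) ^ δ by ring, mul_pow]; ring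
      _ = _ := by rw [hexp]
  have hle : n * Real.log n ^ d * (s * Real.logb s n) ^ (d - 1) ≤
      2 * (n * Real.log n ^ (d + 1) * (s * Real.logb s n) ^ (d - 1)) := by
    calc _ ≤ n * Real.log n ^ d * (s * Real.logb s n) ^ (d - 1) * (2 * Real.log n) :=
          le_mul_of_one_le_right (by positivity) (by linarith)
      _ = _ := by ring
  have hB : 0 ≤ A * (2 * M) ^ (d - 1) * (n : ℝ) ^ (1 + ε) := by positivity
  have hM0 : 0 ≤ M ^ (d - 1) * (n : ℝ) ^ (1 + ε) := by positivity
  refine Solves.mono (h n s φ P color hs hsn) ?_ ?_ fun k => ?_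
  · rw [mul_assoc C (_ + _)]
    refine mul_le_mul_of_nonneg_left ?_ hC
    linarith
  · rw [mul_assoc C (_ + _)]
    refine mul_le_mul_of_nonneg_left ?_ hC
    linarith
  · rw [mul_assoc]
    refine mul_le_mul_of_nonneg_left ?_ hC
    have h1 : Real.logb s n ^ (d - 2) ≤ M ^ (d - 1) :=
      (pow_le_pow_left₀ (by positivity) hlM _).trans (pow_le_pow_right₀ hM1 (by omega))
    have h2 : Real.logb s n ^ (d - 1) ≤ M ^ (d - 1) := pow_le_pow_left₀ (by positivity) hlM _
    calc Real.log n * Real.logb s n ^ (d - 2) + k * Real.logb s n ^ (d - 1)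
        ≤ Real.log n * M ^ (d - 1) + k * M ^ (d - 1) := by gcongr
      _ = M ^ (d - 1) * (Real.log n + k) := by ring
      _ ≤ _ := by
          gcongr
          have : 0 ≤ 2 * A * (2 * M) ^ (d - 1) := by positivity
          linarith

end FunLang

theorem mainTheorem4 (d : ℕ) (hd : 2 ≤ d) :
    ∃ (build query : PointerMachine.Cmd) (w : ℕ),
      (∃ C : ℝ, ∀ (n s φ : ℕ) (P : Fin n → Fin d → ℝ) (color : Fin n → Fin φ), 2 ≤ s → s ≤ n →
        ColorFrequency.Solves (n ^ w) build query s P color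
          (C * (n * Real.log n ^ (d + 1) * (s * Real.logb s n) ^ (d - 1)))
          (C * (n * Real.log n ^ d * (s * Real.logb s n) ^ (d - 1)))
          (fun k => C * (Real.log n * Real.logb s n ^ (d - 2) + k * Real.logb s n ^ (d - 1)))) ∧
      (∀ ε : ℝ, 0 < ε → ∃ C : ℝ,
        ∀ (n s φ : ℕ) (P : Fin n → Fin d → ℝ) (color : Fin n → Fin φ), 2 ≤ n →
          s = min n ⌈(n : ℝ) ^ (ε / d)⌉₊ →
          ColorFrequency.Solves (n ^ w) build query s P color
            (C * (n : ℝ) ^ (1 + ε))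
            (C * (n : ℝ) ^ (1 + ε))
            (fun k => C * (Real.log n + k))) := by
  refine ⟨_, _, 3, ?_, fun ε hε => FunLang.exists_solves_rpow hd hε⟩
  obtain ⟨C, -, h⟩ := FunLang.exists_solves_real hd
  exact ⟨C, h⟩
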